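/- Let $T^2=\mathbb R^2/\mathbb Z^2$, $\mathbf 0=(0,0)$, $z=(\tfrac15,\tfrac25)$, $w=(\tfrac45,\tfrac35)$ and $X=\{\mathbf 0,z,w\}\subset T^2$. For $g\ge 1$, a closed orientable surface of genus $g$ is a topological space homeomorphic to the quotient of a $4g$-gon by the side identifications of the boundary word $a_1b_1a_1^{-1}b_1^{-1}\cdots a_gb_ga_g^{-1}b_g^{-1}$. **Construction.** Take a two-fold unbranched cover $p\colon S\to T^2$, an embedded arc $\alpha$ in $T^2$ from $z$ to $w$, and, disjoint from $\alpha$, a simple loop $\beta$ based at $\mathbf 0$ which does not lift to a loop in $S$. Let $\alpha_1,\alpha_2\subset S$ be the two lifts of $\alpha$ and let $\beta_0\subset S$ be one lift of $\beta$ (an arc joining the two preimages of $\mathbf 0$). Let $\Sigma$ be the surface with boundary obtained by cutting $S$ open along $\alpha_1,\alpha_2,\beta_0$, with exposed boundary arcs $\alpha_1^\pm,\alpha_2^\pm,\beta_0^\pm$; here the signs are chosen so that $\alpha_1^+$ and $\alpha_2^+$ lie over the same side of $\alpha$. Take finitely many copies $\Sigma_1,\dots,\Sigma_k$ of $\Sigma$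 and glue all their exposed arcs in pairs, identifying points over the same point of $T^2$, so that 1. each $\alpha_m^+$ in $\Sigma_i$ is glued to some $\alpha_n^-$ in some $\Sigma_j$ with $(j,n)\neq(i,m)$, where $m,n\in\{1,2\}$ (so every $\alpha_n^-$ is glued to exactly one $\alpha_m^+$); 2. each $\beta_0^+$ in $\Sigma_i$ is glued to $\beta_0^-$ in some $\Sigma_j$ with $j\neq i$ (so every $\beta_0^-$ is glued to exactly one $\beta_0^+$). The result $\widetilde S$ has a canonical map $\widetilde S\to T^2$ induced by $p$. **Proposition.** Let $g\ge 4$ and let $M$ be a closed orientable surface of genus $g$. Then for some choice of $p,\alpha,\beta$, of the lift $\beta_0$, and of a gluing as above, there is a homeomorphism $h\colon M\to\widetilde S$, and the composition of $h$ with the canonical map $\widetilde S\to T^2$ is a branched cover $q\colon M\to T^2$: it is continuous and surjective with finite fibres, is a covering map over $T^2\setminus X$, and near each point $y\in q^{-1}(X)$ it has the form $\zeta\mapsto\zeta^{d}$ in suitable topological complex charts centred at $y$ and $q(y)$, where the local degree $d=d(y)$ satisfies $d\ge 2$. -/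

import Mathlib

noncomputable section

namespace TorusGluing

/-! ### Closed orientable surfaces of genus `g` -/

/-- The closed unit disc, regarded as a polygon once its boundary circle is subdivided. -/
abbrev Disc : Type := Metric.closedBall (0 : ℂ) 1

/-- The boundary of the disc, subdivided as a `4 g`-gon: the vertices are the points with integral
parameter `x` (modulo `4 g`), and the side number `m` consists of the points with parameter in
`[m, m + 1]`. -/
def boundaryPoint (g : ℕ) (x : ℝ) : Disc :=
  ⟨Complex.exp ((2 * Real.pi * x / (4 * g) : ℝ) * Complex.I), by
    simp [Complex.norm_exp_ofReal_mul_I, -Complex.ofReal_div, -Complex.ofReal_mul]⟩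

/-- Side identification of the `4 g`-gon according to the boundary word
`a₁ b₁ a₁⁻¹ b₁⁻¹ ⋯ a_g b_g a_g⁻¹ b_g⁻¹`: for each `j`, side `4 j` is glued to side `4 j + 2`
and side `4 j + 1` is glued to side `4 j + 3`, with reversed direction. -/
inductive SideRel (g : ℕ) : Disc → Disc → Prop
  | glue (j : Fin g) (s : Fin 2) (t : unitInterval) :
      SideRel g (boundaryPoint g (4 * (j : ℕ) + (s : ℕ) + t))
        (boundaryPoint g (4 * (j : ℕ) + (s : ℕ) + 3 - t))

/-- The standard closed orientable surface of genus `g ≥ 1`. -/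
abbrev StandardSurface (g : ℕ) : Type := Quot (SideRel g)

/-- `M` is a closed (connected) orientable surface of genus `g` (for `g ≥ 1`). -/
def IsClosedOrientableSurface (g : ℕ) (M : Type*) [TopologicalSpace M] : Prop :=
  Nonempty (M ≃ₜ StandardSurface g)

/-! ### Branched covers -/

/-- The map `p` has local degree `d ≥ 1` at `y`: in suitable complex-valued topological charts
centred at `y` and at `p y`, it is the map `ζ ↦ ζ ^ d`. -/
def HasLocalDegree {M N : Type*} [TopologicalSpace M] [TopologicalSpace N]
    (p : M → N) (y : M) (d : ℕ) : Prop :=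
  1 ≤ d ∧ ∃ (e : OpenPartialHomeomorph M ℂ) (e' : OpenPartialHomeomorph N ℂ),
    y ∈ e.source ∧ e y = 0 ∧ p y ∈ e'.source ∧ e' (p y) = 0 ∧
    Set.MapsTo p e.source e'.source ∧ ∀ x ∈ e.source, e' (p x) = e x ^ d

/-- `p` is a (finite-sheeted) branched cover, unbranched outside of the finite set `X`. -/
structure IsBranchedCover {M N : Type*} [TopologicalSpace M] [TopologicalSpace N]
    (p : M → N) (X : Set N) : Prop where
  finite : X.Finite
  continuous : Continuous p
  surjective : Function.Surjective p
  finite_fiber : ∀ x, (p ⁻¹' {x}).Finite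
  covering : IsCoveringMapOn p Xᶜ
  local_model : ∀ y, p y ∈ X → ∃ d, HasLocalDegree p y d

/-! ### The torus and its three marked points -/

/-- The torus `ℝ² / ℤ²`. -/
abbrev Torus : Type := UnitAddCircle × UnitAddCircle

/-- The point `(1/5, 2/5)` of the torus. -/
def zPt : Torus := (((1 / 5 : ℝ) : UnitAddCircle), ((2 / 5 : ℝ) : UnitAddCircle))

/-- The point `(4/5, 3/5)` of the torus. -/
def wPt : Torus := (((4 / 5 : ℝ) : UnitAddCircle), ((3 / 5 : ℝ) : UnitAddCircle))

/-- The set `{0, z, w}`. -/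
def marked : Set Torus := {0, zPt, wPt}

/-! ### Cutting a double cover of the torus along three arcs -/

/-- The two sides of an arc. -/
inductive Side
  | plus
  | minus

/-- The open unit interval. -/
abbrev OpenUnit : Type := Set.Ioo (0 : unitInterval) 1

/-- `U Side.plus` and `U Side.minus` are the two sides of the arc `c` inside an open
neighbourhood of the interior of `c`: they are disjoint open sets which do not meet the arc, together with the interior of the arc they form an
open set, and each of them accumulates at every interior point of the arc. -/
structure IsSides {N : Type*} [TopologicalSpace N] (c : unitInterval → N) (U : Side → Set N) :
    Prop where
  isOpen : ∀ s, IsOpen (U s)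
  disjoint : Disjoint (U Side.plus) (U Side.minus)
  disjoint_arc : ∀ s, Disjoint (U s) (Set.range c)
  isOpen_union : IsOpen (U Side.plus ∪ U Side.minus ∪ c '' Set.Ioo 0 1)
  mem_closure : ∀ s, c '' Set.Ioo 0 1 ⊆ closure (U s)

/-- The input of the construction: a two-fold unbranched cover `p : S → T²`; an arc `α` from `z`
to `w` and, disjoint from it, a simple loop `β` based at `0`; the two lifts of `α` to `S`; and a
lift of `β`, which is required not to be a loop (so `β` is essential, as a null-homotopic loop
lifts to loops only, and `S` is connected). The remaining fields name the two sides of `α` in `T²`,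
which lift to the sides of both lifts of `α`, and the two sides of the lift of `β` in `S`. -/
structure CutData where
  S : Type
  [topS : TopologicalSpace S]
  p : S → Torus
  isCoveringMap : IsCoveringMap p
  two_fold : ∀ x, (p ⁻¹' {x}).ncard = 2
  α : Path zPt wPt
  α_injective : Function.Injective α
  β : Path (0 : Torus) 0
  β_simple : ∀ s t, β s = β t → s = t ∨ (s = 0 ∧ t = 1) ∨ (s = 1 ∧ t = 0)
  disjoint : Disjoint (Set.range α) (Set.range β)
  αLift : Fin 2 → C(unitInterval, S)
  p_αLift : ∀ j t, p (αLift j t) = α t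
  αLift_ne : αLift 0 ≠ αLift 1
  βLift : C(unitInterval, S)
  p_βLift : ∀ t, p (βLift t) = β t
  βLift_ne : βLift 0 ≠ βLift 1
  αSide : Side → Set Torus
  αSide_isSides : IsSides α αSide
  βSide : Side → Set S
  βSide_isSides : IsSides βLift βSide

attribute [instance] CutData.topS

namespace CutData

variable (C : CutData)

/-- The union of the interiors of the three arcs in `S`. -/
def openArcs : Set C.S :=
  (⋃ j, C.αLift j '' Set.Ioo 0 1) ∪ C.βLift '' Set.Ioo 0 1

/-- The surface with boundary obtained from `S` by cutting it open along the three arcs: every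
interior point of one of the arcs is doubled into a point on the `+` side and a point on the `-`
side, all other points of `S` (including the end points of the arcs) are kept. -/
inductive Cut : Type
  | off (x : C.S) (hx : x ∉ C.openArcs) : Cut
  | alpha (j : Fin 2) (t : OpenUnit) (s : Side) : Cut
  | beta (t : OpenUnit) (s : Side) : Cut

/-- The map from the cut-open surface back to `S`. -/
def reglue : C.Cut → C.S
  | .off x _ => x
  | .alpha j t _ => C.αLift j t
  | .beta t _ => C.βLift t

/-- The points of the cut-open surface on the side `s` of the lifts of `α`. -/
def αNear (s : Side) : Set C.Cut :=
  C.reglue ⁻¹' (C.p ⁻¹' C.αSide s) ∪ {y | ∃ j t, y = .alpha j t s}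

/-- The points of the cut-open surface on the side `s` of the lift of `β`. -/
def βNear (s : Side) : Set C.Cut :=
  C.reglue ⁻¹' C.βSide s ∪ {y | ∃ t, y = .beta t s}

/-- The topology of the cut-open surface: the coarsest one for which the map to `S` is continuous
and the two sides of each arc, with the respective copy of the open arc added, are open. -/
instance : TopologicalSpace C.Cut :=
  TopologicalSpace.induced C.reglue inferInstance ⊓
    TopologicalSpace.generateFrom (Set.range C.αNear ∪ Set.range C.βNear)

theorem αLift_notMem_openArcs (j : Fin 2) {t : unitInterval} (ht : t ∉ Set.Ioo 0 1) :
    C.αLift j t ∉ C.openArcs := by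
  rintro (h | ⟨t', _, h⟩)
  · obtain ⟨j', t', ht', h⟩ := Set.mem_iUnion.1 h
    have h' := congrArg C.p h
    rw [C.p_αLift, C.p_αLift] at h'
    exact ht (C.α_injective h' ▸ ht')
  · have h' := congrArg C.p h
    rw [C.p_αLift, C.p_βLift] at h'
    exact Set.disjoint_left.1 C.disjoint ⟨t, h'.symm⟩ ⟨t', rfl⟩

theorem βLift_notMem_openArcs {t : unitInterval} (ht : t ∉ Set.Ioo 0 1) :
    C.βLift t ∉ C.openArcs := by
  rintro (h | ⟨t', ht', h⟩)
  · obtain ⟨j', t', _, h⟩ := Set.mem_iUnion.1 h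
    have h' := congrArg C.p h
    rw [C.p_αLift, C.p_βLift] at h'
    exact Set.disjoint_left.1 C.disjoint ⟨t', h'⟩ ⟨t, rfl⟩
  · have h' := congrArg C.p h
    rw [C.p_βLift, C.p_βLift] at h'
    rcases C.β_simple _ _ h' with h | h | h
    · exact ht (h ▸ ht')
    · exact ht'.1.ne' h.1
    · exact ht'.2.ne h.1

open Classical in
/-- The exposed arc on the side `s` of the lift number `j` of `α`. -/
def αEdge (j : Fin 2) (s : Side) (t : unitInterval) : C.Cut :=
  if h : t ∈ Set.Ioo 0 1 then .alpha j ⟨t, h⟩ s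
  else .off (C.αLift j t) (C.αLift_notMem_openArcs j h)

open Classical in
/-- The exposed arc on the side `s` of the lift of `β`. -/
def βEdge (s : Side) (t : unitInterval) : C.Cut :=
  if h : t ∈ Set.Ioo 0 1 then .beta ⟨t, h⟩ s
  else .off (C.βLift t) (C.βLift_notMem_openArcs h)

theorem reglue_αEdge (j : Fin 2) (s : Side) (t : unitInterval) :
    C.reglue (C.αEdge j s t) = C.αLift j t := by
  unfold αEdge
  split_ifs <;> rfl

theorem reglue_βEdge (s : Side) (t : unitInterval) :
    C.reglue (C.βEdge s t) = C.βLift t := by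
  unfold βEdge
  split_ifs <;> rfl

end CutData

/-! ### Gluing copies of the cut-open surface -/

/-- Instructions for gluing `k` copies of the cut-open surface along all their exposed arcs in
pairs. The `+` arc of the lift number `j` of `α` in the copy number `i` is glued to the `-` arc of
the lift number `(a (i, j)).2` in the copy number `(a (i, j)).1`, and it must not be glued to the
`-` arc of the same lift in the same copy. The `+` arc of the lift of `β` in the copy number `i` is
glued to the `-` arc of the lift of `β` in the copy number `b i`, which must be another copy. -/
structure Gluing where
  k : ℕ
  a : Equiv.Perm (Fin k × Fin 2)
  a_ne : ∀ x, a x ≠ x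
  b : Equiv.Perm (Fin k)
  b_ne : ∀ i, b i ≠ i

/-- The identifications prescribed by the gluing instructions. Arcs are glued so that points lying
over the same point of the torus are identified. -/
inductive GlueRel (C : CutData) (G : Gluing) : Fin G.k × C.Cut → Fin G.k × C.Cut → Prop
  | alpha (x : Fin G.k × Fin 2) (t : unitInterval) :
      GlueRel C G (x.1, C.αEdge x.2 .plus t) ((G.a x).1, C.αEdge (G.a x).2 .minus t)
  | beta (i : Fin G.k) (t : unitInterval) :
      GlueRel C G (i, C.βEdge .plus t) (G.b i, C.βEdge .minus t)

/-- The closed surface obtained from the gluing instructions. -/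
abbrev GluedSurface (C : CutData) (G : Gluing) : Type := Quot (GlueRel C G)

/-- The canonical map from the glued surface to the torus. -/
def gluedProj (C : CutData) (G : Gluing) : GluedSurface C G → Torus :=
  Quot.lift (fun y => C.p (C.reglue y.2)) (by
    rintro _ _ (⟨x, t⟩ | ⟨i, t⟩)
    · simp only [C.reglue_αEdge, C.p_αLift]
    · simp only [C.reglue_βEdge])

end TorusGluing

end

/-! The shear (x, y) ↦ (x + 3y, y) carries the vertical segment {0} × [2/5, 3/5] to an arc from z to
w, because 6/5 ≡ 1/5 and 9/5 ≡ 4/5 modulo one, and it carries the circle y = 0 to a loop based at 0.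
These are α and β, and the double cover doubles the first coordinate before shearing. Its total
space is again a torus, made of two unit squares side by side: the lifts of α are slits on the left
walls of the squares, and β₀ is the bottom of the first square. Hence k glued copies form a surface
tiled by 2k squares and governed by three permutations of the squares: τ (`Gluing.top`) for crossing
a horizontal wall, σ (`otherSheet`) for crossing a vertical wall off the slit, and σ'
(`Gluing.slit`) for crossing it on the slit. This is `exists_squares_homeomorph_gluedSurface`.

The branching is read off from monodromy. Around a point of the torus the four quadrants are glued
cyclically, and one full turn permutes the squares by a permutation ρ. It is trivial except at the
corner, where it is the commutator of τ and σ, and at the ends of the slit, where it is σσ'⁻¹ or its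
inverse. Condition 1 of the construction says that σ and σ' agree nowhere; condition 2 makes the
commutator free of fixed points. So over a marked point every cycle of ρ has length at least two. A
cycle of length d is covered by one disc on which the projection is ζ ↦ ζ^d
(`LocalGluing.exists_branchedDisc`). Off the marked points d = 1, and compactness turns the local
homeomorphism into a covering.

The genus is found by cutting and pasting. Cutting every square at the heights 2/5 and 3/5 gives 6k
quadrilaterals with labelled sides (`nonempty_tiles_homeomorph`). Boundary words may be rotated, two
polygons may be merged along a common letter, a pair aa⁻¹ may be cancelled, and two linked pairs may
be collected into a commutator (`SameSurface.handle`); the basic moves are realised by explicit maps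
of the disc. If the copies are chained cyclically along β₀ and the two slits of each copy are glued
to each other, every copy contributes two commutators, so the genus is 2k. If the four slits of the
first two copies are glued in one cycle, these two copies contribute five commutators instead of
four, so the genus is 2k + 1. With k ≥ 2 copies this yields every genus g ≥ 4. -/

noncomputable section

namespace TorusGluing

open Topology Set

section

/-! ### Quotients of marked spaces -/

/-- A quotient map which matches the generated equivalence relations induces a homeomorphism of
the quotients. -/
theorem nonempty_quot_homeomorph {T T' : Type*} [TopologicalSpace T] [TopologicalSpace T']
    {R : T → T → Prop} {R' : T' → T' → Prop} {μ : T → T'} (hμ : IsQuotientMap μ)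
    (h₁ : ∀ x y, R x y → Quot.mk R' (μ x) = Quot.mk R' (μ y))
    (h₂ : ∀ x y, μ x = μ y → Quot.mk R x = Quot.mk R y)
    (h₃ : ∀ x' y', R' x' y' → ∃ x y, μ x = x' ∧ μ y = y' ∧ Quot.mk R x = Quot.mk R y) :
    ∃ e : Quot R ≃ₜ Quot R', ∀ x, e (Quot.mk R x) = Quot.mk R' (μ x) := by
  let f : Quot R → Quot R' := Quot.lift (fun x => Quot.mk R' (μ x)) h₁
  -- The inverse is defined by an arbitrary section of `μ`; the choice disappears in `Quot R`
  -- because `h₂` identifies points with equal image.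
  choose σ hσ using hμ.surjective
  have hσ' : ∀ x, Quot.mk R (σ (μ x)) = Quot.mk R x := fun x => h₂ _ _ (hσ _)
  let k : Quot R' → Quot R := Quot.lift (fun x' => Quot.mk R (σ x')) (by
    intro x' y' h
    obtain ⟨x, y, rfl, rfl, hxy⟩ := h₃ _ _ h
    rw [hσ', hσ', hxy])
  have hf : Continuous f := continuous_quot_lift _ (continuous_quot_mk.comp hμ.continuous)
  have hk : Continuous k := by
    -- The section need not be continuous. Since `μ` is a quotient map, it is enough to precompose
    -- with `μ`, and then the section is no longer visible.
    refine continuous_quot_lift _ (hμ.continuous_iff.2 ?_)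
    have : (fun x' => Quot.mk R (σ x')) ∘ μ = Quot.mk R := funext hσ'
    rw [this]
    exact continuous_quot_mk
  refine ⟨⟨⟨f, k, ?_, ?_⟩, hf, hk⟩, fun x => rfl⟩
  · rintro ⟨x⟩
    exact hσ' x
  · rintro ⟨x'⟩
    exact congrArg (Quot.mk R') (hσ x')

variable {L : Type*}

/-- The identifications of a space with marked paths: points with the same parameter on paths
with the same label are identified. -/
inductive MarkRel {T : Type*} (M : L → (unitInterval → T) → Prop) : T → T → Prop
  | mk {l : L} {c c' : unitInterval → T} (h : M l c) (h' : M l c') (t : unitInterval) :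
      MarkRel M (c t) (c' t)

/-- A quotient map which performs the identifications with labels in `K`, and carries the other
marked paths to the marked paths of the target, induces a homeomorphism. -/
theorem MarkRel.nonempty_homeomorph {T T' : Type*} [TopologicalSpace T] [TopologicalSpace T']
    {M : L → (unitInterval → T) → Prop} {M' : L → (unitInterval → T') → Prop} {μ : T → T'}
    (hμ : IsQuotientMap μ) (K : Set L)
    (hK : ∀ l ∈ K, ∀ c c', M l c → M l c' → ∀ t, μ (c t) = μ (c' t))
    (hker : ∀ x y, μ x = μ y → Quot.mk (MarkRel M) x = Quot.mk (MarkRel M) y)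
    (hf : ∀ l, l ∉ K → ∀ c, M l c → M' l (μ ∘ c))
    (hb : ∀ l c', M' l c' → ∃ c, M l c ∧ c' = μ ∘ c) :
    Nonempty (Quot (MarkRel M) ≃ₜ Quot (MarkRel M')) := by
  refine (nonempty_quot_homeomorph (R := MarkRel M) (R' := MarkRel M') hμ ?_ hker ?_).nonempty
  · rintro _ _ ⟨h, h', t⟩
    rename_i l c c'
    by_cases hl : l ∈ K
    · rw [hK l hl c c' h h' t]
    · exact Quot.sound (MarkRel.mk (hf l hl c h) (hf l hl c' h') t)
  · rintro _ _ ⟨h, h', t⟩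
    obtain ⟨c, hc, rfl⟩ := hb _ _ h
    obtain ⟨c', hc', rfl⟩ := hb _ _ h'
    exact ⟨c t, c' t, rfl, rfl, Quot.sound (MarkRel.mk hc hc' t)⟩

/-! ### Polar coordinates on the disc -/

/-- The point of the unit circle at angle `2 π x`. -/
def ang (x : ℝ) : Disc :=
  ⟨Complex.exp ((2 * Real.pi * x : ℝ) * Complex.I), by
    simp [Complex.norm_exp_ofReal_mul_I, -Complex.ofReal_mul]⟩

theorem coe_ang (x : ℝ) :
    (ang x : ℂ) = ⟨Real.cos (2 * Real.pi * x), Real.sin (2 * Real.pi * x)⟩ := by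
  apply Complex.ext
  · simp only [ang, Complex.exp_ofReal_mul_I_re]
  · simp only [ang, Complex.exp_ofReal_mul_I_im]

theorem norm_ang (x : ℝ) : ‖(ang x : ℂ)‖ = 1 := by
  simp [ang, Complex.norm_exp_ofReal_mul_I, -Complex.ofReal_mul]

theorem ang_eq_ang_iff {x y : ℝ} : ang x = ang y ↔ ∃ n : ℤ, x = y + n := by
  rw [Subtype.ext_iff]
  simp only [ang, Complex.exp_eq_exp_iff_exists_int]
  have hπ : (Real.pi : ℂ) ≠ 0 := by exact_mod_cast Real.pi_ne_zero
  refine exists_congr fun n => ?_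
  constructor
  · intro h
    have h' : ((x : ℂ)) = y + n := by
      have h2 : (2 * Real.pi * Complex.I) * ((x : ℂ) - (y + n)) = 0 := by
        push_cast at h
        linear_combination h
      have := (mul_eq_zero.1 h2).resolve_left (by simp [hπ])
      linear_combination this
    exact_mod_cast h'
  · rintro rfl
    push_cast
    ring

theorem ang_add_intCast (x : ℝ) (n : ℤ) : ang (x + n) = ang x := ang_eq_ang_iff.2 ⟨n, rfl⟩

theorem continuous_ang : Continuous ang := by
  unfold ang
  fun_prop

theorem exists_ang_eq {z : Disc} (hz : ‖(z : ℂ)‖ = 1) : ∃ x ∈ Ico (0 : ℝ) 1, ang x = z := by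
  obtain ⟨x, hx⟩ : ∃ x : ℝ, ang x = z := by
    refine ⟨Complex.arg z / (2 * Real.pi), Subtype.ext ?_⟩
    have := Complex.norm_mul_exp_arg_mul_I (z : ℂ)
    rw [hz] at this
    have hπ : Real.pi ≠ 0 := Real.pi_ne_zero
    have h2 : 2 * Real.pi * (Complex.arg z / (2 * Real.pi)) = Complex.arg z := by field_simp
    simp only [ang, h2]
    simpa using this
  refine ⟨Int.fract x, ⟨Int.fract_nonneg _, Int.fract_lt_one _⟩, ?_⟩
  rw [← hx, ang_eq_ang_iff]
  exact ⟨-⌊x⌋, by push_cast; rw [Int.fract]; ring⟩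

/-- Polar coordinates on the disc, with angles measured in full turns. -/
def polar (p : unitInterval × ℝ) : Disc :=
  ⟨p.1 * ang p.2, by
    have := p.1.2
    simp only [Metric.mem_closedBall, dist_zero_right, norm_mul, norm_ang, mul_one,
      Complex.norm_real, Real.norm_eq_abs, abs_le]
    exact ⟨by linarith [this.1], this.2⟩⟩

theorem continuous_polar : Continuous polar := by
  unfold polar
  have := continuous_ang
  fun_prop

theorem norm_polar (p : unitInterval × ℝ) : ‖(polar p : ℂ)‖ = p.1 := by
  simp [polar, norm_ang, abs_of_nonneg p.1.2.1]

theorem polar_one (x : ℝ) : polar (1, x) = ang x := Subtype.ext (by simp [polar])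

/-- Continuous maps out of the disc are built below by descending along polar coordinates; this is
the kernel they have to respect, namely the collapsed centre and full turns. -/
theorem polar_eq_polar_iff {p q : unitInterval × ℝ} :
    polar p = polar q ↔ p.1 = q.1 ∧ (p.1 = 0 ∨ ∃ n : ℤ, p.2 = q.2 + n) := by
  constructor
  · intro h
    have h1 : p.1 = q.1 := Subtype.ext (by rw [← norm_polar, ← norm_polar, h])
    refine ⟨h1, or_iff_not_imp_left.2 fun h0 => ?_⟩
    rw [← ang_eq_ang_iff]
    have := congrArg (Subtype.val) h
    simp only [polar, h1] at this
    have h0' : ((q.1 : ℝ) : ℂ) ≠ 0 := by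
      rw [← h1]
      intro h2
      exact h0 (Subtype.ext (by exact_mod_cast h2))
    exact Subtype.ext (mul_left_cancel₀ h0' this)
  · rintro ⟨h1, h2⟩
    apply Subtype.ext
    rcases h2 with h2 | h2
    · have hq : q.1 = 0 := h1 ▸ h2
      simp [polar, h2, hq]
    · simp only [polar, h1, ang_eq_ang_iff.2 h2]

theorem exists_polar_eq (z : Disc) : ∃ r : unitInterval, ∃ x ∈ Ico (0 : ℝ) 1, polar (r, x) = z := by
  by_cases hz : (z : ℂ) = 0
  · exact ⟨0, 0, ⟨le_rfl, one_pos⟩, Subtype.ext (by simp [polar, hz])⟩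
  · have hn : ‖(z : ℂ)‖ ≤ 1 := mem_closedBall_zero_iff.1 z.2
    have hne : (‖(z : ℂ)‖ : ℂ) ≠ 0 := by simpa using hz
    obtain ⟨x, hx, h⟩ := exists_ang_eq (z := ⟨z / ‖(z : ℂ)‖, by simp [hz]⟩) (by simp [hz])
    refine ⟨⟨‖(z : ℂ)‖, norm_nonneg _, hn⟩, x, hx, Subtype.ext ?_⟩
    simp only [polar, h]
    field_simp

/-- The arc from angle `u` to angle `v`. -/
def arc (u v : ℝ) (t : unitInterval) : Disc := ang (u + t * (v - u))

end

section

variable {L : Type*}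

/-! ### Families of discs with marked boundary arcs -/

/-- The marked paths of a family of discs with labelled boundary arcs. -/
def discMarks {ι : Type*} (m : ι → L → ℝ → ℝ → Prop) (l : L) (c : unitInterval → ι × Disc) : Prop :=
  ∃ i u v, m i l u v ∧ c = fun t => (i, arc u v t)

/-- The surface obtained from a family of discs by gluing boundary arcs with equal labels. -/
abbrev DiscSurface {ι : Type*} (m : ι → L → ℝ → ℝ → Prop) : Type _ := Quot (MarkRel (discMarks m))

/-- Add one disc to a family. -/
def consDisc {ι : Type*} (a : L → ℝ → ℝ → Prop) (m : ι → L → ℝ → ℝ → Prop) :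
    Option ι → L → ℝ → ℝ → Prop
  | none => a
  | some i => m i

theorem discRel_of {ι : Type*} {m : ι → L → ℝ → ℝ → Prop} {i i' : ι} {l : L} {u v u' v' : ℝ}
    (h : m i l u v) (h' : m i' l u' v') (t : unitInterval) :
    Quot.mk (MarkRel (discMarks m)) (i, arc u v t) =
      Quot.mk (MarkRel (discMarks m)) (i', arc u' v' t) :=
  Quot.sound (MarkRel.mk (c := fun t => (i, arc u v t)) (c' := fun t => (i', arc u' v' t))
    ⟨i, u, v, h, rfl⟩ ⟨i', u', v', h', rfl⟩ t)

theorem DiscSurface.reindex {ι κ : Type*} [TopologicalSpace ι] [TopologicalSpace κ]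
    [DiscreteTopology ι] [DiscreteTopology κ] (e : ι ≃ κ) (m : ι → L → ℝ → ℝ → Prop)
    (n : κ → L → ℝ → ℝ → Prop) (h : ∀ i, m i = n (e i)) :
    Nonempty (DiscSurface m ≃ₜ DiscSurface n) := by
  have hc : Continuous e := continuous_of_discreteTopology
  have hc' : Continuous e.symm := continuous_of_discreteTopology
  let E : ι ≃ₜ κ := ⟨e, hc, hc'⟩
  let F : ι × Disc ≃ₜ κ × Disc := E.prodCongr (Homeomorph.refl _)
  refine MarkRel.nonempty_homeomorph (μ := F) F.isQuotientMap ∅ (by simp) ?_ ?_ ?_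
  · intro x y hxy
    rw [F.injective hxy]
  · rintro l - c ⟨i, u, v, hm, rfl⟩
    exact ⟨e i, u, v, h i ▸ hm, rfl⟩
  · rintro l c' ⟨i, u, v, hm, rfl⟩
    obtain ⟨j, rfl⟩ := e.surjective i
    exact ⟨_, ⟨j, u, v, (h j).symm ▸ hm, rfl⟩, rfl⟩

/-- Index sets carry the discrete topology, so that the product with the disc is a disjoint union of
discs. -/
instance {ι : Type*} : TopologicalSpace (Option ι) := ⊥

instance {ι : Type*} : DiscreteTopology (Option ι) := ⟨rfl⟩

section Change

variable {ι : Type*} [Finite ι]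

/-- Changing one disc of a family by a map which performs the identifications with labels in `K`. -/
theorem DiscSurface.change {a a' : L → ℝ → ℝ → Prop} (m : ι → L → ℝ → ℝ → Prop) {μ : Disc → Disc}
    (hμ : Continuous μ) (hμs : Function.Surjective μ) (K : Set L)
    (hm : ∀ l ∈ K, ∀ i u v, ¬ m i l u v)
    (hK : ∀ l ∈ K, ∀ u v u' v', a l u v → a l u' v' → ∀ t, μ (arc u v t) = μ (arc u' v' t))
    (hker : ∀ x y, μ x = μ y → x = y ∨ ∃ l u v u' v' t,
      a l u v ∧ a l u' v' ∧ x = arc u v t ∧ y = arc u' v' t)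
    (hf : ∀ l u v, l ∉ K → a l u v → ∃ u' v', a' l u' v' ∧ ∀ t, μ (arc u v t) = arc u' v' t)
    (hb : ∀ l u' v', a' l u' v' → ∃ u v, a l u v ∧ ∀ t, μ (arc u v t) = arc u' v' t) :
    Nonempty (DiscSurface (consDisc a m) ≃ₜ DiscSurface (consDisc a' m)) := by
  let F : Option ι × Disc → Option ι × Disc := fun p => (p.1, p.1.elim (μ p.2) fun _ => p.2)
  have hF : Continuous F := by
    rw [continuous_prod_of_discrete_left]
    rintro (_ | i)
    · exact continuous_const.prodMk hμ
    · exact continuous_const.prodMk continuous_id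
  have hFs : Function.Surjective F := by
    rintro ⟨_ | i, z⟩
    · obtain ⟨x, rfl⟩ := hμs z
      exact ⟨(none, x), rfl⟩
    · exact ⟨(some i, z), rfl⟩
  -- Finitely many discs form a compact space, so a continuous surjection onto a Hausdorff space is
  -- a quotient map.
  refine MarkRel.nonempty_homeomorph (μ := F) (.of_surjective_continuous hFs hF) K ?_ ?_ ?_ ?_
  · rintro l hl _ _ ⟨_ | i, u, v, h, rfl⟩ ⟨_ | i', u', v', h', rfl⟩ t
    · exact Prod.ext rfl (hK l hl _ _ _ _ h h' t)
    · exact absurd h' (hm l hl _ _ _)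
    · exact absurd h (hm l hl _ _ _)
    · exact absurd h (hm l hl _ _ _)
  · rintro ⟨_ | i, x⟩ ⟨_ | i', y⟩ h
    · rcases hker x y (congrArg Prod.snd h) with rfl | ⟨l, u, v, u', v', t, h1, h2, rfl, rfl⟩
      · rfl
      · exact discRel_of (m := consDisc a m) (i := none) (i' := none) h1 h2 t
    · cases congrArg Prod.fst h
    · cases congrArg Prod.fst h
    · exact congrArg _ h
  · rintro l hl _ ⟨_ | i, u, v, h, rfl⟩
    · obtain ⟨u', v', h', he⟩ := hf l u v hl h
      exact ⟨none, u', v', h', funext fun t => Prod.ext rfl (he t)⟩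
    · exact ⟨some i, u, v, h, rfl⟩
  · rintro l _ ⟨_ | i, u', v', h, rfl⟩
    · obtain ⟨u, v, h', he⟩ := hb l u' v' h
      exact ⟨_, ⟨none, u, v, h', rfl⟩, funext fun t => Prod.ext rfl (he t).symm⟩
    · exact ⟨_, ⟨some i, u', v', h, rfl⟩, rfl⟩

/-- Merging two discs of a family by a map which performs the identifications with label `l₀`. -/
theorem DiscSurface.merge {a b c : L → ℝ → ℝ → Prop} (m : ι → L → ℝ → ℝ → Prop)
    {μ ν : Disc → Disc} (hμ : Continuous μ) (hν : Continuous ν)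
    (hs : ∀ z, (∃ x, μ x = z) ∨ ∃ x, ν x = z) (hμi : Function.Injective μ)
    (hνi : Function.Injective ν) (l₀ : L) {u₀ v₀ u₁ v₁ : ℝ}
    (hm : ∀ i u v, ¬ m i l₀ u v)
    (ha : ∀ u v, a l₀ u v ↔ u = u₀ ∧ v = v₀) (hb : ∀ u v, b l₀ u v ↔ u = u₁ ∧ v = v₁)
    (hab : ∀ t, μ (arc u₀ v₀ t) = ν (arc u₁ v₁ t))
    (hker : ∀ x y, μ x = ν y → ∃ t, x = arc u₀ v₀ t ∧ y = arc u₁ v₁ t)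
    (hf : ∀ l u v, l ≠ l₀ → a l u v → ∃ u' v', c l u' v' ∧ ∀ t, μ (arc u v t) = arc u' v' t)
    (hf' : ∀ l u v, l ≠ l₀ → b l u v → ∃ u' v', c l u' v' ∧ ∀ t, ν (arc u v t) = arc u' v' t)
    (hc : ∀ l u' v', c l u' v' → (∃ u v, a l u v ∧ ∀ t, μ (arc u v t) = arc u' v' t) ∨
      ∃ u v, b l u v ∧ ∀ t, ν (arc u v t) = arc u' v' t) :
    Nonempty (DiscSurface (consDisc a (consDisc b m)) ≃ₜ DiscSurface (consDisc c m)) := by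
  let F : Option (Option ι) × Disc → Option ι × Disc := fun p =>
    match p.1 with
    | none => (none, μ p.2)
    | some none => (none, ν p.2)
    | some (some i) => (some i, p.2)
  have hF : Continuous F := by
    rw [continuous_prod_of_discrete_left]
    rintro (_ | _ | i)
    · exact continuous_const.prodMk hμ
    · exact continuous_const.prodMk hν
    · exact continuous_const.prodMk continuous_id
  have hFs : Function.Surjective F := by
    rintro ⟨_ | i, z⟩
    · rcases hs z with ⟨x, rfl⟩ | ⟨x, rfl⟩
      · exact ⟨(none, x), rfl⟩
      · exact ⟨(some none, x), rfl⟩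
    · exact ⟨(some (some i), z), rfl⟩
  have hA : ∀ t, Quot.mk (MarkRel (discMarks (consDisc a (consDisc b m)))) (none, arc u₀ v₀ t) =
      Quot.mk _ (some none, arc u₁ v₁ t) := fun t =>
    discRel_of (m := consDisc a (consDisc b m)) (i := none) (i' := some none)
      ((ha _ _).2 ⟨rfl, rfl⟩) ((hb _ _).2 ⟨rfl, rfl⟩) t
  refine MarkRel.nonempty_homeomorph (μ := F) (.of_surjective_continuous hFs hF) {l₀} ?_ ?_ ?_ ?_
  · rintro l rfl _ _ ⟨_ | _ | i, u, v, h, rfl⟩ ⟨_ | _ | i', u', v', h', rfl⟩ t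
    · obtain ⟨rfl, rfl⟩ := (ha _ _).1 h
      obtain ⟨rfl, rfl⟩ := (ha _ _).1 h'
      rfl
    · obtain ⟨rfl, rfl⟩ := (ha _ _).1 h
      obtain ⟨rfl, rfl⟩ := (hb _ _).1 h'
      exact congrArg (Prod.mk none) (hab t)
    · exact absurd h' (hm _ _ _)
    · obtain ⟨rfl, rfl⟩ := (hb _ _).1 h
      obtain ⟨rfl, rfl⟩ := (ha _ _).1 h'
      exact congrArg (Prod.mk none) (hab t).symm
    · obtain ⟨rfl, rfl⟩ := (hb _ _).1 h
      obtain ⟨rfl, rfl⟩ := (hb _ _).1 h'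
      rfl
    · exact absurd h' (hm _ _ _)
    · exact absurd h (hm _ _ _)
    · exact absurd h (hm _ _ _)
    · exact absurd h (hm _ _ _)
  · rintro ⟨_ | _ | i, x⟩ ⟨_ | _ | i', y⟩ h
    · exact congrArg _ (congrArg _ (hμi (congrArg Prod.snd h)))
    · obtain ⟨t, rfl, rfl⟩ := hker x y (congrArg Prod.snd h)
      exact hA t
    · cases congrArg Prod.fst h
    · obtain ⟨t, rfl, rfl⟩ := hker y x (congrArg Prod.snd h).symm
      exact (hA t).symm
    · exact congrArg _ (congrArg _ (hνi (congrArg Prod.snd h)))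
    · cases congrArg Prod.fst h
    · cases congrArg Prod.fst h
    · cases congrArg Prod.fst h
    · obtain ⟨h1, h2⟩ := Prod.ext_iff.1 h
      cases h1
      cases h2
      rfl
  · rintro l hl _ ⟨_ | _ | i, u, v, h, rfl⟩
    · obtain ⟨u', v', h', he⟩ := hf l u v hl h
      exact ⟨none, u', v', h', funext fun t => Prod.ext rfl (he t)⟩
    · obtain ⟨u', v', h', he⟩ := hf' l u v hl h
      exact ⟨none, u', v', h', funext fun t => Prod.ext rfl (he t)⟩
    · exact ⟨some i, u, v, h, rfl⟩
  · rintro l _ ⟨_ | i, u', v', h, rfl⟩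
    · rcases hc l u' v' h with ⟨u, v, h', he⟩ | ⟨u, v, h', he⟩
      · exact ⟨_, ⟨none, u, v, h', rfl⟩, funext fun t => Prod.ext rfl (he t).symm⟩
      · exact ⟨_, ⟨some none, u, v, h', rfl⟩, funext fun t => Prod.ext rfl (he t).symm⟩
    · exact ⟨_, ⟨some (some i), u', v', h, rfl⟩, rfl⟩

end Change

/-! ### Words as subdivisions of arcs -/

/-- The arcs of angle `δ` labelled by a word, starting at angle `θ`. -/
def seg (w : List (L × Bool)) (θ δ : ℝ) (l : L) (u v : ℝ) : Prop :=
  ∃ (j : ℕ) (b : Bool), w[j]? = some (l, b) ∧ u = θ + (j + cond b 0 1) * δ ∧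
    v = θ + (j + cond b 1 0) * δ

theorem seg_append (X Y : List (L × Bool)) (θ δ : ℝ) (l : L) (u v : ℝ) :
    seg (X ++ Y) θ δ l u v ↔ seg X θ δ l u v ∨ seg Y (θ + X.length * δ) δ l u v := by
  constructor
  · rintro ⟨j, b, h, rfl, rfl⟩
    rw [List.getElem?_append] at h
    split_ifs at h with hj
    · exact Or.inl ⟨j, b, h, rfl, rfl⟩
    · refine Or.inr ⟨j - X.length, b, h, ?_, ?_⟩ <;>
      · push_cast [not_lt.1 hj]
        ring
  · rintro (⟨j, b, h, rfl, rfl⟩ | ⟨j, b, h, rfl, rfl⟩)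
    · refine ⟨j, b, ?_, rfl, rfl⟩
      rw [List.getElem?_append_left (List.getElem?_eq_some_iff.1 h).1, h]
    · refine ⟨X.length + j, b, ?_, ?_, ?_⟩
      · rw [List.getElem?_append_right (by omega), ← h]
        congr 1
        omega
      · push_cast
        ring
      · push_cast
        ring

theorem seg.mem {w : List (L × Bool)} {θ δ : ℝ} {l : L} {u v : ℝ} (h : seg w θ δ l u v) :
    ∃ b, (l, b) ∈ w := by
  obtain ⟨j, b, h, -, -⟩ := h
  exact ⟨b, List.mem_of_getElem? h⟩

theorem seg_singleton (x : L × Bool) (θ δ : ℝ) (l : L) (u v : ℝ) :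
    seg [x] θ δ l u v ↔ l = x.1 ∧ u = θ + cond x.2 0 1 * δ ∧ v = θ + cond x.2 1 0 * δ := by
  constructor
  · rintro ⟨j, b, h, rfl, rfl⟩
    have hj : j = 0 := by
      have := (List.getElem?_eq_some_iff.1 h).1
      simpa using this
    subst hj
    simp only [List.getElem?_cons_zero, Option.some.injEq] at h
    subst h
    simp
  · rintro ⟨rfl, rfl, rfl⟩
    exact ⟨0, x.2, by simp, by simp, by simp⟩

theorem seg.arc_mem {w : List (L × Bool)} {θ δ : ℝ} (hδ : 0 ≤ δ) {l : L} {u v : ℝ}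
    (h : seg w θ δ l u v) (t : unitInterval) :
    u + t * (v - u) ∈ Icc θ (θ + w.length * δ) := by
  obtain ⟨j, b, h, rfl, rfl⟩ := h
  have hj : ((j : ℝ) + 1) ≤ w.length := by
    exact_mod_cast (List.getElem?_eq_some_iff.1 h).1
  have h0 := t.2.1
  have h1 := t.2.2
  have h2 : ((j : ℝ) + 1) * δ ≤ w.length * δ := mul_le_mul_of_nonneg_right hj hδ
  have h3 : 0 ≤ (j : ℝ) * δ := by positivity
  have h4 : (t : ℝ) * δ ≤ 1 * δ := mul_le_mul_of_nonneg_right h1 hδ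
  have h5 : 0 ≤ (t : ℝ) * δ := by positivity
  cases b <;> simp only [cond_true, cond_false] <;> constructor <;> nlinarith

/-- A map which is affine in the angle carries the arcs of a word to the arcs of the same word. -/
theorem seg.map {w : List (L × Bool)} {θ δ : ℝ} (hδ : 0 ≤ δ) {μ : Disc → Disc} {κ s : ℝ}
    (hμ : ∀ x ∈ Icc θ (θ + w.length * δ), μ (ang x) = ang (κ * x + s)) {l : L} {u v : ℝ}
    (h : seg w θ δ l u v) :
    ∃ u' v', seg w (κ * θ + s) (κ * δ) l u' v' ∧ ∀ t, μ (arc u v t) = arc u' v' t := by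
  refine ⟨κ * u + s, κ * v + s, ?_, fun t => ?_⟩
  · obtain ⟨j, b, h, rfl, rfl⟩ := h
    exact ⟨j, b, h, by ring, by ring⟩
  · rw [arc, hμ _ (h.arc_mem hδ t), arc]
    congr 1
    ring

theorem seg.comap {w : List (L × Bool)} {θ δ : ℝ} (hδ : 0 ≤ δ) {μ : Disc → Disc} {κ s : ℝ}
    (hμ : ∀ x ∈ Icc θ (θ + w.length * δ), μ (ang x) = ang (κ * x + s)) {l : L} {u' v' : ℝ}
    (h : seg w (κ * θ + s) (κ * δ) l u' v') :
    ∃ u v, seg w θ δ l u v ∧ ∀ t, μ (arc u v t) = arc u' v' t := by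
  obtain ⟨j, b, h, rfl, rfl⟩ := h
  have h' : seg w θ δ l (θ + (j + cond b 0 1) * δ) (θ + (j + cond b 1 0) * δ) :=
    ⟨j, b, h, rfl, rfl⟩
  refine ⟨_, _, h', fun t => ?_⟩
  rw [arc, hμ _ (h'.arc_mem hδ t), arc]
  congr 1
  ring

/-- The arcs of the regular polygon with the given boundary word. -/
def polygon (w : List (L × Bool)) : L → ℝ → ℝ → Prop := seg w 0 (1 / w.length)

/-- The arcs of the bigon with the first word along the upper half circle and the second word along
the lower half circle. -/
def bigon (X Y : List (L × Bool)) (l : L) (u v : ℝ) : Prop :=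
  seg X 0 (1 / (2 * X.length)) l u v ∨ seg Y (1 / 2) (1 / (2 * Y.length)) l u v

end

/-! ### Explicit maps of the disc -/

theorem Disc.sq_add_sq_le (z : Disc) : (z : ℂ).re ^ 2 + (z : ℂ).im ^ 2 ≤ 1 := by
  have h : ‖(z : ℂ)‖ ≤ 1 := mem_closedBall_zero_iff.1 z.2
  have h2 : ‖(z : ℂ)‖ ^ 2 ≤ 1 := pow_le_one₀ (norm_nonneg _) h
  rw [Complex.sq_norm, Complex.normSq_apply] at h2
  linarith

theorem mem_disc {z : ℂ} (h : z.re ^ 2 + z.im ^ 2 ≤ 1) : z ∈ Metric.closedBall (0 : ℂ) 1 := by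
  rw [mem_closedBall_zero_iff, ← abs_of_nonneg (norm_nonneg z), ← sq_le_one_iff_abs_le_one,
    Complex.sq_norm, Complex.normSq_apply]
  linarith

/-- Half the length of the vertical chord through a point of the disc. -/
def chord (z : Disc) : ℝ := Real.sqrt (1 - (z : ℂ).re ^ 2)

theorem chord_nonneg (z : Disc) : 0 ≤ chord z := Real.sqrt_nonneg _

theorem chord_sq (z : Disc) : chord z ^ 2 = 1 - (z : ℂ).re ^ 2 :=
  Real.sq_sqrt (by nlinarith [z.sq_add_sq_le, sq_nonneg (z : ℂ).im])

theorem abs_im_le_chord (z : Disc) : |(z : ℂ).im| ≤ chord z :=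
  abs_le_of_sq_le_sq (by nlinarith [z.sq_add_sq_le, chord_sq z]) (chord_nonneg z)

theorem continuous_chord : Continuous chord := by
  unfold chord
  fun_prop

/-- Compress the disc vertically to its upper half. -/
def upHalf (z : Disc) : Disc :=
  ⟨⟨(z : ℂ).re, ((z : ℂ).im + chord z) / 2⟩, mem_disc (by
    have h := abs_le.1 (abs_im_le_chord z)
    have := chord_sq z
    dsimp only
    nlinarith [h.1, h.2])⟩

/-- Compress the disc vertically to its lower half. -/
def downHalf (z : Disc) : Disc :=
  ⟨⟨(z : ℂ).re, ((z : ℂ).im - chord z) / 2⟩, mem_disc (by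
    have h := abs_le.1 (abs_im_le_chord z)
    have := chord_sq z
    dsimp only
    nlinarith [h.1, h.2])⟩

theorem continuous_mk_complex {T : Type*} [TopologicalSpace T] {f g : T → ℝ} (hf : Continuous f)
    (hg : Continuous g) : Continuous fun x => (⟨f x, g x⟩ : ℂ) :=
  Complex.equivRealProdCLM.symm.continuous.comp (hf.prodMk hg)

theorem continuous_upHalf : Continuous upHalf := by
  have := continuous_chord
  exact (continuous_mk_complex (by fun_prop) (by fun_prop)).subtype_mk _

theorem continuous_downHalf : Continuous downHalf := by
  have := continuous_chord
  exact (continuous_mk_complex (by fun_prop) (by fun_prop)).subtype_mk _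

theorem chord_eq_of_re_eq {x y : Disc} (h : (x : ℂ).re = (y : ℂ).re) : chord x = chord y := by
  rw [chord, chord, h]

theorem upHalf_injective : Function.Injective upHalf := by
  intro x y h
  have h' := congrArg Subtype.val h
  obtain ⟨h1, h2⟩ := Complex.ext_iff.1 h'
  simp only [upHalf] at h1 h2
  rw [chord_eq_of_re_eq h1] at h2
  exact Subtype.ext (Complex.ext h1 (by linarith))

theorem downHalf_injective : Function.Injective downHalf := by
  intro x y h
  have h' := congrArg Subtype.val h
  obtain ⟨h1, h2⟩ := Complex.ext_iff.1 h'
  simp only [downHalf] at h1 h2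
  rw [chord_eq_of_re_eq h1] at h2
  exact Subtype.ext (Complex.ext h1 (by linarith))

theorem exists_upHalf_eq {z : Disc} (hz : 0 ≤ (z : ℂ).im) : ∃ x, upHalf x = z := by
  have h := (abs_le.1 (abs_im_le_chord z))
  have hc := chord_sq z
  -- On each vertical chord `upHalf` is affine; this is its inverse there.
  let x : Disc := ⟨⟨(z : ℂ).re, 2 * (z : ℂ).im - chord z⟩, mem_disc (by dsimp only; nlinarith)⟩
  refine ⟨x, Subtype.ext (Complex.ext rfl ?_)⟩
  have : chord x = chord z := chord_eq_of_re_eq rfl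
  simp only [upHalf, this, x]
  ring

theorem exists_downHalf_eq {z : Disc} (hz : (z : ℂ).im ≤ 0) : ∃ x, downHalf x = z := by
  have h := (abs_le.1 (abs_im_le_chord z))
  have hc := chord_sq z
  let x : Disc := ⟨⟨(z : ℂ).re, 2 * (z : ℂ).im + chord z⟩, mem_disc (by dsimp only; nlinarith)⟩
  refine ⟨x, Subtype.ext (Complex.ext rfl ?_)⟩
  have : chord x = chord z := chord_eq_of_re_eq rfl
  simp only [downHalf, this, x]
  ring

theorem upHalf_im_nonneg (x : Disc) : 0 ≤ (upHalf x : ℂ).im := by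
  have h := (abs_le.1 (abs_im_le_chord x)).1
  simp only [upHalf]
  linarith

theorem downHalf_im_nonpos (x : Disc) : (downHalf x : ℂ).im ≤ 0 := by
  have h := (abs_le.1 (abs_im_le_chord x)).2
  simp only [downHalf]
  linarith

theorem ang_re (x : ℝ) : (ang x : ℂ).re = Real.cos (2 * Real.pi * x) := by rw [coe_ang]

theorem ang_im (x : ℝ) : (ang x : ℂ).im = Real.sin (2 * Real.pi * x) := by rw [coe_ang]

theorem chord_ang (x : ℝ) : chord (ang x) = |Real.sin (2 * Real.pi * x)| := by
  rw [chord, ang_re, Real.abs_sin_eq_sqrt_one_sub_cos_sq]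

theorem chord_ang_of_le {x : ℝ} (hx : x ∈ Icc (0 : ℝ) (1 / 2)) :
    chord (ang x) = (ang x : ℂ).im := by
  rw [chord_ang, ang_im, abs_of_nonneg]
  have := Real.pi_pos
  exact Real.sin_nonneg_of_nonneg_of_le_pi (by have := hx.1; positivity) (by nlinarith [hx.2])

theorem chord_ang_of_ge {x : ℝ} (hx : x ∈ Icc (1 / 2 : ℝ) 1) :
    chord (ang x) = -(ang x : ℂ).im := by
  rw [chord_ang, ang_im, abs_of_nonpos]
  have := Real.pi_pos
  rw [← Real.sin_sub_two_pi]
  exact Real.sin_nonpos_of_nonpos_of_neg_pi_le (by nlinarith [hx.2]) (by nlinarith [hx.1])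

theorem upHalf_ang {x : ℝ} (hx : x ∈ Icc (0 : ℝ) (1 / 2)) : upHalf (ang x) = ang x := by
  refine Subtype.ext (Complex.ext rfl ?_)
  simp only [upHalf, chord_ang_of_le hx]
  ring

theorem downHalf_ang {x : ℝ} (hx : x ∈ Icc (1 / 2 : ℝ) 1) : downHalf (ang x) = ang x := by
  refine Subtype.ext (Complex.ext rfl ?_)
  simp only [downHalf, chord_ang_of_ge hx]
  ring

theorem coe_upHalf_ang {x : ℝ} (hx : x ∈ Icc (1 / 2 : ℝ) 1) :
    (upHalf (ang x) : ℂ) = Real.cos (2 * Real.pi * x) := by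
  refine Complex.ext (by rw [Complex.ofReal_re, ← ang_re]; rfl) ?_
  simp only [upHalf, chord_ang_of_ge hx, Complex.ofReal_im]
  ring

theorem coe_downHalf_ang {x : ℝ} (hx : x ∈ Icc (0 : ℝ) (1 / 2)) :
    (downHalf (ang x) : ℂ) = Real.cos (2 * Real.pi * x) := by
  refine Complex.ext (by rw [Complex.ofReal_re, ← ang_re]; rfl) ?_
  simp only [downHalf, chord_ang_of_le hx, Complex.ofReal_im]
  ring

/-- Both compressions send a flattened boundary point to its real part on the diameter, so complex
conjugate boundary points meet. This makes the two half discs fit together. -/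
theorem upHalf_ang_eq_downHalf_ang {x : ℝ} (hx : x ∈ Icc (1 / 2 : ℝ) 1) :
    upHalf (ang x) = downHalf (ang (1 - x)) := by
  apply Subtype.ext
  rw [coe_upHalf_ang hx, coe_downHalf_ang ⟨by linarith [hx.2], by linarith [hx.1]⟩]
  rw [show 2 * Real.pi * (1 - x) = 2 * Real.pi - 2 * Real.pi * x by ring, Real.cos_two_pi_sub]

/-- A point at the bottom of its vertical chord is a point of the lower half circle. -/
theorem exists_ang_eq_of_bottom {z : Disc} (hz : (z : ℂ).im = -chord z) :
    ∃ x ∈ Icc (1 / 2 : ℝ) 1, ang x = z := by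
  have hn : ‖(z : ℂ)‖ = 1 := by
    rw [← sq_eq_sq₀ (norm_nonneg _) zero_le_one, Complex.sq_norm, Complex.normSq_apply, hz]
    nlinarith [chord_sq z]
  obtain ⟨x, hx, rfl⟩ := exists_ang_eq hn
  by_cases h : 1 / 2 ≤ x
  · exact ⟨x, ⟨h, hx.2.le⟩, rfl⟩
  · rw [not_le] at h
    rw [chord_ang_of_le ⟨hx.1, h.le⟩] at hz
    have h0 : Real.sin (2 * Real.pi * x) = 0 := by rw [← ang_im]; linarith
    have := Real.pi_pos
    have hx0 : x = 0 := by
      by_contra hne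
      have : 0 < x := lt_of_le_of_ne hx.1 (Ne.symm hne)
      exact (Real.sin_pos_of_pos_of_lt_pi (by positivity) (by nlinarith)).ne' h0
    subst hx0
    -- The only remaining point has angle 0, which is outside the range and is replaced by a full
    -- turn.
    exact ⟨1, ⟨by norm_num, le_rfl⟩, ang_eq_ang_iff.2 ⟨1, by simp⟩⟩

/-- The two images lie in opposite closed half planes, so they meet only on the diameter; only
points at the bottom of their chord are compressed upwards onto it. -/
theorem exists_of_upHalf_eq_downHalf {x y : Disc} (h : upHalf x = downHalf y) :
    ∃ θ ∈ Icc (1 / 2 : ℝ) 1, x = ang θ ∧ y = ang (1 - θ) := by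
  have h1 := upHalf_im_nonneg x
  have h2 := downHalf_im_nonpos y
  have hx : (upHalf x : ℂ).im = 0 := le_antisymm (h ▸ h2) h1
  obtain ⟨θ, hθ, rfl⟩ := exists_ang_eq_of_bottom (z := x) (by
    simp only [upHalf] at hx
    linarith)
  refine ⟨θ, hθ, rfl, ?_⟩
  rw [upHalf_ang_eq_downHalf_ang hθ] at h
  exact (downHalf_injective h).symm

/-- Fold the lower half circle: compress the disc to its upper half and take squares. -/
def foldDisc (z : Disc) : Disc :=
  ⟨(upHalf z : ℂ) ^ 2, by
    have := mem_closedBall_zero_iff.1 (upHalf z).2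
    rw [mem_closedBall_zero_iff, norm_pow]
    exact pow_le_one₀ (norm_nonneg _) this⟩

theorem continuous_foldDisc : Continuous foldDisc := by
  exact ((continuous_subtype_val.comp continuous_upHalf).pow 2).subtype_mk _

/-- One of the two square roots of a complex number lies in the closed upper half plane. -/
theorem foldDisc_surjective : Function.Surjective foldDisc := by
  intro z
  obtain ⟨w, hw, hi⟩ : ∃ w : ℂ, w ^ 2 = z ∧ 0 ≤ w.im := by
    obtain ⟨w, hw⟩ := IsAlgClosed.exists_pow_nat_eq (z : ℂ) two_pos
    rcases le_total 0 w.im with h | h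
    · exact ⟨w, hw, h⟩
    · exact ⟨-w, by simpa using hw, by simpa using h⟩
  have hn : ‖w‖ ≤ 1 := by
    have := mem_closedBall_zero_iff.1 z.2
    rw [← hw, norm_pow] at this
    exact (pow_le_one_iff_of_nonneg (norm_nonneg _) two_ne_zero).1 this
  obtain ⟨x, hx⟩ := exists_upHalf_eq (z := ⟨w, mem_closedBall_zero_iff.2 hn⟩) hi
  exact ⟨x, Subtype.ext (by simp only [foldDisc, hx, hw])⟩

theorem foldDisc_ang {x : ℝ} (hx : x ∈ Icc (0 : ℝ) (1 / 2)) : foldDisc (ang x) = ang (2 * x) := by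
  apply Subtype.ext
  simp only [foldDisc, upHalf_ang hx]
  rw [ang, ang, ← Complex.exp_nat_mul]
  congr 1
  push_cast
  ring

/-- Squaring identifies opposite points of the diameter. On the lower half circle, flattened onto
the diameter, this is the reflection in the vertical axis. -/
theorem foldDisc_ang_eq {x : ℝ} (hx : x ∈ Icc (1 / 2 : ℝ) 1) :
    foldDisc (ang x) = foldDisc (ang (3 / 2 - x)) := by
  apply Subtype.ext
  simp only [foldDisc, coe_upHalf_ang hx]
  rw [coe_upHalf_ang ⟨by linarith [hx.2], by linarith [hx.1]⟩,
    show 2 * Real.pi * (3 / 2 - x) = Real.pi - 2 * Real.pi * x + 2 * Real.pi by ring,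
    Real.cos_add_two_pi, Real.cos_pi_sub]
  simp

/-- Two points of the closed upper half plane with the same square are equal or are opposite real
numbers, and the real points come from the lower half circle. -/
theorem eq_or_exists_of_foldDisc_eq {x y : Disc} (h : foldDisc x = foldDisc y) :
    x = y ∨ ∃ θ ∈ Icc (1 / 2 : ℝ) 1, x = ang θ ∧ y = ang (3 / 2 - θ) := by
  have h' : (upHalf x : ℂ) ^ 2 = (upHalf y : ℂ) ^ 2 := congrArg Subtype.val h
  rcases sq_eq_sq_iff_eq_or_eq_neg.1 h' with h' | h'
  · exact Or.inl (upHalf_injective (Subtype.ext h'))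
  · right
    have hx := upHalf_im_nonneg x
    have hy := upHalf_im_nonneg y
    have hxy := congrArg Complex.im h'
    simp only [Complex.neg_im] at hxy
    have hx0 : (upHalf x : ℂ).im = 0 := by linarith
    have hy0 : (upHalf y : ℂ).im = 0 := by linarith
    have hre := congrArg Complex.re h'
    obtain ⟨θ, hθ, rfl⟩ := exists_ang_eq_of_bottom (z := x) (by
      simp only [upHalf] at hx0
      linarith)
    refine ⟨θ, hθ, rfl, upHalf_injective (Subtype.ext ?_)⟩
    rw [coe_upHalf_ang ⟨by linarith [hθ.2], by linarith [hθ.1]⟩]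
    rw [coe_upHalf_ang hθ] at h'
    rw [show 2 * Real.pi * (3 / 2 - θ) = Real.pi - 2 * Real.pi * θ + 2 * Real.pi by ring,
      Real.cos_add_two_pi, Real.cos_pi_sub]
    rw [Complex.ofReal_neg]
    linear_combination h'

/-- The rotation by half a turn. -/
def negDisc (z : Disc) : Disc := ⟨-z, by simpa only [mem_closedBall_zero_iff, norm_neg] using z.2⟩

theorem continuous_negDisc : Continuous negDisc := by
  unfold negDisc
  fun_prop

theorem negDisc_negDisc (z : Disc) : negDisc (negDisc z) = z := Subtype.ext (neg_neg _)

theorem negDisc_ang (x : ℝ) : negDisc (ang x) = ang (x + 1 / 2) := by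
  apply Subtype.ext
  change -(ang x : ℂ) = _
  rw [coe_ang, coe_ang, show 2 * Real.pi * (x + 1 / 2) = 2 * Real.pi * x + Real.pi by ring,
    Real.cos_add_pi, Real.sin_add_pi]
  rfl

/-! ### Reparametrising the boundary circle -/

/-- The piecewise linear reparametrization of the unit interval which carries `s` to `1 / 2`. -/
def bend (s x : ℝ) : ℝ := if x ≤ s then x / (2 * s) else 1 / 2 + (x - s) / (2 * (1 - s))

theorem continuous_bend {s : ℝ} (h0 : 0 < s) (h1 : s < 1) : Continuous (bend s) := by
  refine Continuous.if_le (by fun_prop) (by fun_prop) continuous_id continuous_const ?_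
  rintro x rfl
  field_simp
  ring

theorem bend_inj {s : ℝ} (h0 : 0 < s) (h1 : s < 1) : StrictMono (bend s) := by
  intro x y h
  have h2 : 0 < 1 - s := by linarith
  unfold bend
  split_ifs with hx hy hy
  · gcongr
  · have h3 : x / (2 * s) ≤ 1 / 2 := by
      rw [div_le_div_iff₀ (by positivity) (by norm_num)]
      linarith
    have h4 : 0 < (y - s) / (2 * (1 - s)) := div_pos (by linarith) (by positivity)
    linarith
  · linarith
  · gcongr

theorem bend_zero {s : ℝ} (h0 : 0 < s) : bend s 0 = 0 := by simp [bend, h0.le]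

theorem bend_one {s : ℝ} (h1 : s < 1) : bend s 1 = 1 := by
  have h2 : 1 - s ≠ 0 := by linarith
  rw [bend, if_neg (by linarith)]
  field_simp
  ring

/-- The homeomorphism of the disc which reparametrizes the angle by `bend s`. -/
theorem exists_bendDisc {s : ℝ} (h0 : 0 < s) (h1 : s < 1) :
    ∃ μ : Disc → Disc, Continuous μ ∧ Function.Bijective μ ∧
      ∀ x ∈ Icc (0 : ℝ) 1, μ (ang x) = ang (bend s x) := by
  let P : unitInterval × unitInterval → Disc := fun p => polar (p.1, p.2)
  have hP : Continuous P := continuous_polar.comp (by fun_prop)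
  have hPs : Function.Surjective P := by
    intro z
    obtain ⟨r, x, hx, rfl⟩ := exists_polar_eq z
    exact ⟨(r, ⟨x, hx.1, hx.2.le⟩), rfl⟩
  have hq : IsQuotientMap P := .of_surjective_continuous hPs hP
  let Q : unitInterval × unitInterval → Disc := fun p => polar (p.1, bend s p.2)
  have hQ : Continuous Q := continuous_polar.comp
    (continuous_fst.prodMk ((continuous_bend h0 h1).comp (by fun_prop)))
  have hmono := bend_inj h0 h1
  have hb0 := bend_zero h0
  have hb1 := bend_one h1
  have hmem : ∀ x : unitInterval, bend s x ∈ Icc (0 : ℝ) 1 := fun x =>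
    ⟨hb0 ▸ hmono.monotone x.2.1, hb1 ▸ hmono.monotone x.2.2⟩
  have key : ∀ x y : ℝ, x ∈ Icc (0 : ℝ) 1 → y ∈ Icc (0 : ℝ) 1 →
      ((∃ n : ℤ, x = y + n) ↔ x = y ∨ (x = 0 ∧ y = 1) ∨ (x = 1 ∧ y = 0)) := by
    rintro x y ⟨hx0, hx1⟩ ⟨hy0, hy1⟩
    constructor
    · rintro ⟨n, hn⟩
      have hn1 : -1 ≤ n := by
        have : (-1 : ℝ) ≤ n := by linarith
        exact_mod_cast this
      have hn2 : n ≤ 1 := by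
        have : (n : ℝ) ≤ 1 := by linarith
        exact_mod_cast this
      have : n = -1 ∨ n = 0 ∨ n = 1 := by omega
      rcases this with rfl | rfl | rfl <;> push_cast at hn
      · right; left; constructor <;> linarith
      · left; linarith
      · right; right; constructor <;> linarith
    · rintro (h | ⟨rfl, rfl⟩ | ⟨rfl, rfl⟩)
      · exact ⟨0, by simp [h]⟩
      · exact ⟨-1, by simp⟩
      · exact ⟨1, by simp⟩
  -- Since `bend s` is injective and fixes 0 and 1, both parametrisations of the disc have the same
  -- fibres; hence `Q` descends along `P` to a bijection of the disc.
  have hPQ : ∀ p q, P p = P q ↔ Q p = Q q := by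
    rintro ⟨r, x⟩ ⟨r', x'⟩
    simp only [P, Q, polar_eq_polar_iff, key _ _ x.2 x'.2, key _ _ (hmem x) (hmem x'),
      hmono.injective.eq_iff]
    have e0 : ∀ y : ℝ, bend s y = 0 ↔ y = 0 := fun y => by
      rw [← hb0, hmono.injective.eq_iff, hb0]
    have e1 : ∀ y : ℝ, bend s y = 1 ↔ y = 1 := fun y => by
      conv_lhs => rw [← hb1, hmono.injective.eq_iff]
    simp only [e0, e1]
  have hQs : Function.Surjective Q := by
    intro z
    obtain ⟨r, x, hx, rfl⟩ := exists_polar_eq z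
    obtain ⟨y, hy, hxy⟩ := intermediate_value_Icc zero_le_one
      (continuous_bend h0 h1).continuousOn (show x ∈ Icc (bend s 0) (bend s 1) by
        rw [hb0, hb1]; exact ⟨hx.1, hx.2.le⟩)
    exact ⟨(r, ⟨y, hy⟩), congrArg polar (Prod.ext rfl hxy)⟩
  choose σ hσ using hPs
  have hfac : ∀ p, Q (σ (P p)) = Q p := fun p => (hPQ _ _).1 (hσ _)
  refine ⟨fun z => Q (σ z), ?_, ⟨?_, ?_⟩, ?_⟩
  · refine hq.continuous_iff.2 ?_
    convert hQ using 1
    exact funext hfac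
  · intro x y h
    have := (hPQ _ _).2 h
    rwa [hσ, hσ] at this
  · intro z
    obtain ⟨p, rfl⟩ := hQs z
    exact ⟨P p, hfac p⟩
  · intro x hx
    have := hfac (1, ⟨x, hx⟩)
    simpa only [P, Q, polar_one] using this

section

variable {L : Type*}

/-! ### Cutting and pasting polygons -/

/-- The inverse of a signed letter. -/
def inv (x : L × Bool) : L × Bool := (x.1, !x.2)

/-- The commutator of two signed letters. -/
def commWord (p : (L × Bool) × (L × Bool)) : List (L × Bool) := [p.1, p.2, inv p.1, inv p.2]

section Moves

variable {ι : Type*} [Finite ι] (m : ι → L → ℝ → ℝ → Prop)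

theorem length_pos_real {w : List (L × Bool)} (h : w ≠ []) : (0 : ℝ) < w.length := by
  exact_mod_cast List.length_pos_iff.2 h

/-- With word lengths a and b, the junction of the two words sits at angle a / (a + b). Bending it
to 1/2 puts each word on a half circle, where the explicit half disc maps apply. -/
theorem polygon_append_homeomorph_bigon {X Y : List (L × Bool)} (hX : X ≠ []) (hY : Y ≠ []) :
    Nonempty (DiscSurface (consDisc (polygon (X ++ Y)) m) ≃ₜ
      DiscSurface (consDisc (bigon X Y) m)) := by
  have hx := length_pos_real hX
  have hy := length_pos_real hY
  set a : ℝ := ((X.length : ℕ) : ℝ) with ha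
  set b : ℝ := ((Y.length : ℕ) : ℝ) with hb
  have hab : 0 < a + b := by positivity
  have hs0 : 0 < a / (a + b) := by positivity
  have hs1 : a / (a + b) < 1 := by rw [div_lt_one hab]; linarith
  obtain ⟨μ, hμ, hμb, h⟩ := exists_bendDisc hs0 hs1
  have hl : ((X ++ Y).length : ℝ) = a + b := by simp [ha, hb]
  have hδ : 0 ≤ 1 / (a + b) := by positivity
  have h1 : ∀ x ∈ Icc (0 : ℝ) (0 + a * (1 / (a + b))),
      μ (ang x) = ang ((a + b) / (2 * a) * x + 0) := by
    rintro x ⟨hx0, hx1⟩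
    rw [zero_add, mul_one_div] at hx1
    rw [h x ⟨hx0, by linarith⟩, bend, if_pos hx1]
    congr 1
    field_simp
    ring
  have h2 : ∀ x ∈ Icc (0 + a * (1 / (a + b)) : ℝ) (0 + a * (1 / (a + b)) + b * (1 / (a + b))),
      μ (ang x) = ang ((a + b) / (2 * b) * x + (1 / 2 - a / (2 * b))) := by
    rintro x ⟨hx0, hx1⟩
    rw [zero_add, mul_one_div] at hx0 hx1
    have hx2 : x ≤ 1 := by
      refine hx1.trans (le_of_eq ?_)
      field_simp
    rw [h x ⟨by linarith, hx2⟩]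
    have hc : 1 - a / (a + b) = b / (a + b) := by field_simp; ring
    -- At the break point itself `bend` uses its first formula, which has the same value.
    have hv : bend (a / (a + b)) x = 1 / 2 + (x - a / (a + b)) / (2 * (b / (a + b))) := by
      rw [bend, hc]
      split_ifs with hx3
      · obtain rfl : x = a / (a + b) := le_antisymm hx3 hx0
        field_simp
        ring
      · rfl
    rw [hv]
    congr 1
    field_simp
    ring
  have e1 : (a + b) / (2 * a) * 0 + 0 = 0 := by simp
  have e2 : (a + b) / (2 * a) * (1 / (a + b)) = 1 / (2 * a) := by field_simp
  have e3 : (a + b) / (2 * b) * (0 + a * (1 / (a + b))) + (1 / 2 - a / (2 * b)) = 1 / 2 := by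
    field_simp
    ring
  have e4 : (a + b) / (2 * b) * (1 / (a + b)) = 1 / (2 * b) := by field_simp
  refine DiscSurface.change m hμ hμb.2 ∅ (by simp) (by simp) (fun x y hxy => Or.inl (hμb.1 hxy))
    ?_ ?_
  · rintro l u v - h
    rw [polygon, hl, seg_append] at h
    rcases h with h | h
    · obtain ⟨u', v', h', he⟩ := h.map hδ h1
      rw [e1, e2] at h'
      exact ⟨u', v', Or.inl h', he⟩
    · obtain ⟨u', v', h', he⟩ := h.map hδ h2
      rw [e3, e4] at h'
      exact ⟨u', v', Or.inr h', he⟩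
  · rintro l u' v' (h | h)
    · rw [← ha, ← e1, ← e2] at h
      obtain ⟨u, v, h', he⟩ := h.comap hδ h1
      refine ⟨u, v, ?_, he⟩
      rw [polygon, hl, seg_append]
      exact Or.inl h'
    · rw [← hb, ← e3, ← e4] at h
      obtain ⟨u, v, h', he⟩ := h.comap hδ h2
      refine ⟨u, v, ?_, he⟩
      rw [polygon, hl, seg_append]
      exact Or.inr h'

/-- A half turn exchanges the two half circles; this is the source of the cyclic rotation of
boundary words. -/
theorem bigon_swap_homeomorph {X Y : List (L × Bool)} :
    Nonempty (DiscSurface (consDisc (bigon X Y) m) ≃ₜ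
      DiscSurface (consDisc (bigon Y X) m)) := by
  have h1 : ∀ (s : Set ℝ), ∀ x ∈ s, negDisc (ang x) = ang (1 * x + 1 / 2) := fun s x _ => by
    rw [negDisc_ang, one_mul]
  have h2 : ∀ (s : Set ℝ), ∀ x ∈ s, negDisc (ang x) = ang (1 * x + -(1 / 2)) := fun s x _ => by
    rw [negDisc_ang, ang_eq_ang_iff]
    exact ⟨1, by push_cast; ring⟩
  have e1 : (1 : ℝ) * 0 + 1 / 2 = 1 / 2 := by norm_num
  have e2 : (1 : ℝ) * (1 / 2) + -(1 / 2) = 0 := by norm_num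
  have hinv : Function.Involutive negDisc := negDisc_negDisc
  refine DiscSurface.change m continuous_negDisc hinv.surjective ∅ (by simp) (by simp)
    (fun x y hxy => Or.inl (hinv.injective hxy)) ?_ ?_
  · rintro l u v - (h | h)
    · obtain ⟨u', v', h', he⟩ := h.map (by positivity) (h1 _)
      rw [e1, one_mul] at h'
      exact ⟨u', v', Or.inr h', he⟩
    · obtain ⟨u', v', h', he⟩ := h.map (by positivity) (h2 _)
      rw [e2, one_mul] at h'
      exact ⟨u', v', Or.inl h', he⟩
  · rintro l u' v' (h | h)
    · rw [← e2, ← one_mul (1 / (2 * (Y.length : ℝ)))] at h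
      obtain ⟨u, v, h', he⟩ := h.comap (by positivity) (h2 _)
      exact ⟨u, v, Or.inr h', he⟩
    · rw [← e1, ← one_mul (1 / (2 * (X.length : ℝ)))] at h
      obtain ⟨u, v, h', he⟩ := h.comap (by positivity) (h1 _)
      exact ⟨u, v, Or.inl h', he⟩

/-- The parameter of a side with the given sign. -/
def sideParam (b : Bool) (t : unitInterval) : unitInterval := cond b t (unitInterval.symm t)

/-- The position of a side is separated from its direction: a negative letter covers the same angles
with reversed parameter. -/
theorem seg_singleton_arc (x : L × Bool) {θ δ u v : ℝ} (h : seg [x] θ δ x.1 u v)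
    (t : unitInterval) : arc u v t = ang (θ + sideParam x.2 t * δ) := by
  obtain ⟨-, rfl, rfl⟩ := (seg_singleton _ _ _ _ _ _).1 h
  cases hx : x.2 <;> simp only [arc, sideParam, cond_true, cond_false, unitInterval.coe_symm_eq] <;>
    congr 1 <;> ring

theorem sideParam_sideParam (b : Bool) (t : unitInterval) : sideParam b (sideParam b t) = t := by
  cases b <;> simp [sideParam]

theorem sideParam_not (b : Bool) (t : unitInterval) :
    (sideParam (!b) t : ℝ) = 1 - sideParam b t := by
  cases b <;> simp [sideParam]

/-- One disc is compressed to the upper half and the other to the lower half. The side `a` and the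
side `inv a` both become the diameter, and their opposite signs make the two parametrisations agree
there. As the letter occurs nowhere else, nothing else is identified. -/
theorem merge_homeomorph {X Y : List (L × Bool)} (a : L × Bool)
    (hX : ∀ b, (a.1, b) ∉ X) (hY : ∀ b, (a.1, b) ∉ Y) (hm : ∀ i u v, ¬ m i a.1 u v) :
    Nonempty (DiscSurface (consDisc (bigon X [a]) (consDisc (bigon [inv a] Y) m)) ≃ₜ
      DiscSurface (consDisc (bigon X Y) m)) := by
  have hXs : ∀ {θ δ u v}, ¬ seg X θ δ a.1 u v := fun h => let ⟨b, hb⟩ := h.mem; hX b hb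
  have hYs : ∀ {θ δ u v}, ¬ seg Y θ δ a.1 u v := fun h => let ⟨b, hb⟩ := h.mem; hY b hb
  have hδ : (1 : ℝ) / (2 * ([a].length : ℕ)) = 1 / 2 := by simp
  have hδ' : (1 : ℝ) / (2 * ([inv a].length : ℕ)) = 1 / 2 := by simp
  have h1 : ∀ x ∈ Icc (0 : ℝ) (0 + X.length * (1 / (2 * X.length))),
      upHalf (ang x) = ang (1 * x + 0) := by
    rintro x ⟨hx0, hx1⟩
    rw [one_mul, add_zero, upHalf_ang ⟨hx0, hx1.trans ?_⟩]
    rcases X.length.eq_zero_or_pos with h | h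
    · simp [h]
    · apply le_of_eq
      field_simp
      ring
  have h2 : ∀ x ∈ Icc (1 / 2 : ℝ) (1 / 2 + Y.length * (1 / (2 * Y.length))),
      downHalf (ang x) = ang (1 * x + 0) := by
    rintro x ⟨hx0, hx1⟩
    rw [one_mul, add_zero, downHalf_ang ⟨hx0, hx1.trans ?_⟩]
    rcases Y.length.eq_zero_or_pos with h | h
    · norm_num [h]
    · apply le_of_eq
      field_simp
      ring
  have ha : ∀ u v, bigon X [a] a.1 u v ↔
      u = 1 / 2 + cond a.2 0 1 * (1 / 2) ∧ v = 1 / 2 + cond a.2 1 0 * (1 / 2) := by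
    intro u v
    simp only [bigon, hXs, false_or, hδ, seg_singleton, true_and]
  have hb : ∀ u v, bigon [inv a] Y a.1 u v ↔
      u = 0 + cond (!a.2) 0 1 * (1 / 2) ∧ v = 0 + cond (!a.2) 1 0 * (1 / 2) := by
    intro u v
    simp only [bigon, hYs, or_false, hδ', seg_singleton]
    simp only [inv, true_and]
  have harc := fun t => seg_singleton_arc a (θ := 1 / 2) (δ := 1 / 2)
    ((seg_singleton _ _ _ _ _ _).2 ⟨rfl, rfl, rfl⟩) t
  have harc' : ∀ t, arc (0 + cond (!a.2) 0 1 * (1 / 2)) (0 + cond (!a.2) 1 0 * (1 / 2)) t =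
      ang (1 - (1 / 2 + sideParam a.2 t * (1 / 2))) := fun t => by
    have := seg_singleton_arc (inv a) (θ := 0) (δ := 1 / 2)
      ((seg_singleton _ _ _ _ _ _).2 ⟨rfl, rfl, rfl⟩) t
    simp only [inv, sideParam_not] at this
    rw [this]
    congr 1
    ring
  refine DiscSurface.merge (a := bigon X [a]) (b := bigon [inv a] Y) (c := bigon X Y) m
    continuous_upHalf continuous_downHalf ?_ upHalf_injective downHalf_injective a.1 hm
    ha hb ?_ ?_ ?_ ?_ ?_
  · intro z
    rcases le_total 0 (z : ℂ).im with h | h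
    · exact Or.inl (exists_upHalf_eq h)
    · exact Or.inr (exists_downHalf_eq h)
  · intro t
    rw [harc, harc', upHalf_ang_eq_downHalf_ang]
    have := (sideParam a.2 t).2
    constructor <;> linarith [this.1, this.2]
  · intro x y hxy
    obtain ⟨θ, hθ, rfl, rfl⟩ := exists_of_upHalf_eq_downHalf hxy
    -- The number 2θ - 1 is the fraction of the lower half circle covered at θ; `sideParam` is an
    -- involution and cancels the one in `harc`.
    refine ⟨sideParam a.2 ⟨2 * θ - 1, by linarith [hθ.1], by linarith [hθ.2]⟩, ?_, ?_⟩
    · rw [harc, sideParam_sideParam]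
      congr 1
      ring
    · rw [harc', sideParam_sideParam]
      congr 1
      ring
  · rintro l u v hl (h | h)
    · obtain ⟨u', v', h', he⟩ := h.map (by positivity) h1
      rw [one_mul, add_zero, one_mul] at h'
      exact ⟨u', v', Or.inl h', he⟩
    · exact absurd ((seg_singleton _ _ _ _ _ _).1 h).1 hl
  · rintro l u v hl (h | h)
    · exact absurd ((seg_singleton _ _ _ _ _ _).1 h).1 hl
    · obtain ⟨u', v', h', he⟩ := h.map (by positivity) h2
      rw [one_mul, add_zero, one_mul] at h'
      exact ⟨u', v', Or.inr h', he⟩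
  · rintro l u' v' (h | h)
    · rw [← add_zero (0 : ℝ), ← one_mul (0 : ℝ), ← one_mul (1 / (2 * (X.length : ℝ)))] at h
      obtain ⟨u, v, h', he⟩ := seg.comap (κ := 1) (s := 0) (by positivity) h1 (by simpa using h)
      exact Or.inl ⟨u, v, Or.inl h', he⟩
    · obtain ⟨u, v, h', he⟩ := seg.comap (κ := 1) (s := 0) (by positivity) h2 (by simpa using h)
      exact Or.inr ⟨u, v, Or.inr h', he⟩

/-- The lower half circle carries `a` and its inverse on two quarter circles. Folding at the
midpoint glues them, and squaring stretches the upper half circle to the whole circle with the word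
`X`. -/
theorem cancel_homeomorph {X : List (L × Bool)} (a : L × Bool)
    (hX : ∀ b, (a.1, b) ∉ X) (hm : ∀ i u v, ¬ m i a.1 u v) :
    Nonempty (DiscSurface (consDisc (bigon X [a, inv a]) m) ≃ₜ
      DiscSurface (consDisc (polygon X) m)) := by
  have hXs : ∀ {θ δ u v}, ¬ seg X θ δ a.1 u v := fun h => let ⟨b, hb⟩ := h.mem; hX b hb
  have h1 : ∀ x ∈ Icc (0 : ℝ) (0 + X.length * (1 / (2 * X.length))),
      foldDisc (ang x) = ang (2 * x + 0) := by
    rintro x ⟨hx0, hx1⟩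
    rw [add_zero, foldDisc_ang ⟨hx0, hx1.trans ?_⟩]
    rcases X.length.eq_zero_or_pos with h | h
    · simp [h]
    · apply le_of_eq
      field_simp
      ring
  have h2 : ∀ l u v, seg [a, inv a] (1 / 2) (1 / (2 * ([a, inv a].length : ℕ))) l u v ↔
      seg [a] (1 / 2) (1 / 4) l u v ∨ seg [inv a] (3 / 4) (1 / 4) l u v := by
    intro l u v
    have e := seg_append [a] [inv a] (1 / 2) (1 / 4) l u v
    rw [show (1 / 2 + ([a].length : ℝ) * (1 / 4) : ℝ) = 3 / 4 by norm_num] at e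
    rw [← e]
    norm_num
  have hA : ∀ {u v}, seg [a] (1 / 2) (1 / 4) a.1 u v → ∀ t, arc u v t =
      ang (1 / 2 + sideParam a.2 t * (1 / 4)) := fun h t => seg_singleton_arc a h t
  have hB : ∀ {u v}, seg [inv a] (3 / 4) (1 / 4) a.1 u v → ∀ t, arc u v t =
      ang (3 / 2 - (1 / 2 + sideParam a.2 t * (1 / 4))) := fun h t => by
    rw [seg_singleton_arc (inv a) h t, inv, sideParam_not]
    congr 1
    ring
  have hAB : ∀ {u v}, bigon X [a, inv a] a.1 u v → ∀ t, foldDisc (arc u v t) =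
      foldDisc (ang (1 / 2 + sideParam a.2 t * (1 / 4))) := by
    rintro u v h t
    simp only [bigon, hXs, false_or, h2] at h
    rcases h with h | h
    · rw [hA h]
    · rw [hB h, ← foldDisc_ang_eq]
      have := (sideParam a.2 t).2
      constructor <;> linarith [this.1, this.2]
  have hs : seg [a] (1 / 2) (1 / 4) a.1 (1 / 2 + cond a.2 0 1 * (1 / 4))
      (1 / 2 + cond a.2 1 0 * (1 / 4)) := (seg_singleton _ _ _ _ _ _).2 ⟨rfl, rfl, rfl⟩
  have hs' : seg [inv a] (3 / 4) (1 / 4) a.1 (3 / 4 + cond (!a.2) 0 1 * (1 / 4))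
      (3 / 4 + cond (!a.2) 1 0 * (1 / 4)) := (seg_singleton _ _ _ _ _ _).2 ⟨rfl, rfl, rfl⟩
  refine DiscSurface.change m continuous_foldDisc foldDisc_surjective {a.1} ?_ ?_ ?_ ?_ ?_
  · rintro l rfl i u v
    exact hm i u v
  · rintro l rfl u v u' v' h h' t
    rw [hAB h, hAB h']
  · intro x y hxy
    rcases eq_or_exists_of_foldDisc_eq hxy with rfl | ⟨θ, hθ, rfl, rfl⟩
    · exact Or.inl rfl
    · right
      -- The angle 3/4 is the fold; it decides which of the two points lies on the side `a`.
      rcases le_total θ (3 / 4) with h | h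
      · refine ⟨a.1, _, _, _, _, sideParam a.2 ⟨4 * θ - 2, by linarith [hθ.1], by linarith⟩,
          Or.inr ((h2 _ _ _).2 (Or.inl hs)), Or.inr ((h2 _ _ _).2 (Or.inr hs')), ?_, ?_⟩
        · rw [hA hs, sideParam_sideParam]
          congr 1
          ring
        · rw [hB hs', sideParam_sideParam]
          congr 1
          ring
      · refine ⟨a.1, _, _, _, _, sideParam a.2 ⟨4 - 4 * θ, by linarith [hθ.2], by linarith⟩,
          Or.inr ((h2 _ _ _).2 (Or.inr hs')), Or.inr ((h2 _ _ _).2 (Or.inl hs)), ?_, ?_⟩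
        · rw [hB hs', sideParam_sideParam]
          congr 1
          ring
        · rw [hA hs, sideParam_sideParam]
          congr 1
          ring
  · rintro l u v hl (h | h)
    · obtain ⟨u', v', h', he⟩ := h.map (by positivity) h1
      refine ⟨u', v', ?_, he⟩
      rw [polygon]
      convert h' using 1
      · norm_num
      · rw [one_div, one_div, mul_inv]; ring
    · rw [h2] at h
      rcases h with h | h
      · exact absurd ((seg_singleton _ _ _ _ _ _).1 h).1 hl
      · exact absurd ((seg_singleton _ _ _ _ _ _).1 h).1 hl
  · intro l u' v' h
    obtain ⟨u, v, h', he⟩ := seg.comap (w := X) (θ := 0) (δ := 1 / (2 * X.length)) (κ := 2) (s := 0)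
      (by positivity) h1 (u' := u') (v' := v') (l := l) (by
        rw [polygon] at h
        convert h using 1
        · norm_num
        · rw [one_div, one_div, mul_inv]; ring)
    exact ⟨u, v, Or.inl h', he⟩

end Moves

end

section

variable {L : Type*}

/-! ### The calculus of boundary words -/

/-- The family of regular polygons with the given boundary words. -/
def polygons (ws : List (List (L × Bool))) (i : Fin ws.length) : L → ℝ → ℝ → Prop :=
  polygon (ws.get i)

/-- Two lists of boundary words which describe homeomorphic surfaces. -/
def SameSurface (ws ws' : List (List (L × Bool))) : Prop :=
  Nonempty (DiscSurface (polygons ws) ≃ₜ DiscSurface (polygons ws'))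

namespace SameSurface

theorem refl (ws : List (List (L × Bool))) : SameSurface ws ws := ⟨Homeomorph.refl _⟩

theorem symm {ws ws' : List (List (L × Bool))} (h : SameSurface ws ws') : SameSurface ws' ws :=
  let ⟨e⟩ := h
  ⟨e.symm⟩

theorem trans {ws ws' ws'' : List (List (L × Bool))} (h : SameSurface ws ws')
    (h' : SameSurface ws' ws'') : SameSurface ws ws'' :=
  let ⟨e⟩ := h
  let ⟨e'⟩ := h'
  ⟨e.trans e'⟩

theorem of_perm {ws ws' : List (List (L × Bool))} (h : ws.Perm ws') : SameSurface ws ws' := by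
  have : ∃ e : Fin ws.length ≃ Fin ws'.length, ∀ i, ws.get i = ws'.get (e i) := by
    induction h with
    | nil => exact ⟨Equiv.refl _, fun i => rfl⟩
    | cons x h ih =>
      obtain ⟨e, he⟩ := ih
      refine ⟨(finSuccEquiv _).trans ((Equiv.optionCongr e).trans (finSuccEquiv _).symm), ?_⟩
      intro i
      refine Fin.cases ?_ (fun j => ?_) i
      · simp
      · simpa using he j
    | swap x y l =>
      refine ⟨Equiv.swap 0 1, fun i => ?_⟩
      refine Fin.cases ?_ (fun j => Fin.cases ?_ (fun j => ?_) j) i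
      · simp
      · simp
      · rw [Equiv.swap_apply_of_ne_of_ne]
        · rfl
        · exact Fin.succ_ne_zero _
        · exact fun h => Fin.succ_ne_zero _ (Fin.succ_injective _ h)
    | trans _ _ ih ih' =>
      obtain ⟨e, he⟩ := ih
      obtain ⟨e', he'⟩ := ih'
      exact ⟨e.trans e', fun i => (he i).trans (he' _)⟩
  obtain ⟨e, he⟩ := this
  exact DiscSurface.reindex e _ _ fun i => congrArg polygon (he i)

theorem cons_homeomorph (w : List (L × Bool)) (ws : List (List (L × Bool))) :
    Nonempty (DiscSurface (polygons (w :: ws)) ≃ₜ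
      DiscSurface (consDisc (polygon w) (polygons ws))) := by
  refine DiscSurface.reindex (finSuccEquiv _) _ _ fun i => ?_
  refine Fin.cases ?_ (fun j => ?_) i
  · rw [finSuccEquiv_zero]
    rfl
  · rw [finSuccEquiv_succ]
    rfl

theorem cons_of {w w' : List (L × Bool)} {ws ws' : List (List (L × Bool))}
    (h : Nonempty (DiscSurface (consDisc (polygon w) (polygons ws)) ≃ₜ
      DiscSurface (consDisc (polygon w') (polygons ws')))) :
    SameSurface (w :: ws) (w' :: ws') :=
  let ⟨e⟩ := h
  let ⟨e₁⟩ := cons_homeomorph w ws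
  let ⟨e₂⟩ := cons_homeomorph w' ws'
  ⟨(e₁.trans e).trans e₂.symm⟩

theorem rotate (X Y : List (L × Bool)) (ws : List (List (L × Bool))) :
    SameSurface ((X ++ Y) :: ws) ((Y ++ X) :: ws) := by
  by_cases hX : X = []
  · subst hX
    simpa using refl _
  by_cases hY : Y = []
  · subst hY
    simpa using refl _
  obtain ⟨e₁⟩ := polygon_append_homeomorph_bigon (polygons ws) hX hY
  obtain ⟨e₂⟩ := bigon_swap_homeomorph (polygons ws) (X := X) (Y := Y)
  obtain ⟨e₃⟩ := polygon_append_homeomorph_bigon (polygons ws) hY hX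
  exact cons_of ⟨(e₁.trans e₂).trans e₃.symm⟩

theorem cancel {X : List (L × Bool)} (hX : X ≠ []) (a : L × Bool) {ws : List (List (L × Bool))}
    (h : ∀ w ∈ X :: ws, ∀ x ∈ w, x.1 ≠ a.1) :
    SameSurface ((X ++ [a, inv a]) :: ws) (X :: ws) := by
  obtain ⟨e₁⟩ := polygon_append_homeomorph_bigon (polygons ws) hX (Y := [a, inv a]) (by simp)
  obtain ⟨e₂⟩ := cancel_homeomorph (polygons ws) (X := X) a
    (fun b hb => h X (by simp) _ hb rfl) (fun i u v hs => by
      obtain ⟨b, hb⟩ := seg.mem hs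
      exact h _ (List.mem_cons_of_mem _ (List.get_mem ws i)) _ hb rfl)
  exact cons_of ⟨e₁.trans e₂⟩

theorem consDisc_swap_homeomorph {ι : Type*} (a b : L → ℝ → ℝ → Prop)
    (m : ι → L → ℝ → ℝ → Prop) :
    Nonempty (DiscSurface (consDisc a (consDisc b m)) ≃ₜ
      DiscSurface (consDisc b (consDisc a m))) := by
  refine DiscSurface.reindex
    ⟨fun o => match o with
      | none => some none
      | some none => none
      | some (some i) => some (some i),
     fun o => match o with
      | none => some none
      | some none => none
      | some (some i) => some (some i), ?_, ?_⟩ _ _ ?_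
  · rintro (_ | _ | i) <;> rfl
  · rintro (_ | _ | i) <;> rfl
  · rintro (_ | _ | i) <;> rfl

theorem merge {X Y : List (L × Bool)} (hX : X ≠ []) (hY : Y ≠ []) (a : L × Bool)
    {ws : List (List (L × Bool))} (h : ∀ w ∈ X :: Y :: ws, ∀ x ∈ w, x.1 ≠ a.1) :
    SameSurface ((a :: X) :: (inv a :: Y) :: ws) ((X ++ Y) :: ws) := by
  -- The letter `a` has to sit on the lower half of the first bigon and its inverse on the upper
  -- half of the second.
  refine (rotate [a] X ((inv a :: Y) :: ws)).trans ?_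
  let m := polygons ws
  obtain ⟨e₁⟩ := cons_homeomorph (X ++ [a]) ((inv a :: Y) :: ws)
  have hre : Nonempty (DiscSurface (consDisc (polygon (X ++ [a])) (polygons ((inv a :: Y) :: ws)))
      ≃ₜ DiscSurface (consDisc (polygon (X ++ [a])) (consDisc (polygon (inv a :: Y)) m))) := by
    refine DiscSurface.reindex (Equiv.optionCongr (finSuccEquiv _)) _ _ ?_
    rintro (_ | i)
    · rfl
    · refine Fin.cases ?_ (fun j => ?_) i
      · rw [Equiv.optionCongr_apply, Option.map_some, finSuccEquiv_zero]
        rfl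
      · rw [Equiv.optionCongr_apply, Option.map_some, finSuccEquiv_succ]
        rfl
  obtain ⟨e₂⟩ := hre
  obtain ⟨e₃⟩ := polygon_append_homeomorph_bigon (consDisc (polygon (inv a :: Y)) m) hX
    (Y := [a]) (by simp)
  obtain ⟨e₄⟩ := consDisc_swap_homeomorph (bigon X [a]) (polygon (inv a :: Y)) m
  obtain ⟨e₅⟩ := polygon_append_homeomorph_bigon (consDisc (bigon X [a]) m) (X := [inv a])
    (by simp) hY
  obtain ⟨e₆⟩ := consDisc_swap_homeomorph (bigon [inv a] Y) (bigon X [a]) m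
  obtain ⟨e₇⟩ := merge_homeomorph m (X := X) (Y := Y) a
    (fun b hb => h X (by simp) _ hb rfl) (fun b hb => h Y (by simp) _ hb rfl)
    (fun i u v hs => by
      obtain ⟨b, hb⟩ := seg.mem hs
      exact h _ (List.mem_cons_of_mem _ (List.mem_cons_of_mem _ (List.get_mem ws i))) _ hb rfl)
  obtain ⟨e₈⟩ := polygon_append_homeomorph_bigon m hX hY
  obtain ⟨e₉⟩ := cons_homeomorph (X ++ Y) ws
  exact ⟨((((((((e₁.trans e₂).trans e₃).trans e₄).trans e₅).trans e₆).trans e₇).trans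
    e₈.symm).trans e₉.symm)⟩

theorem polygons_relabel_iff {L' : Type*} {f : L → L'} (hf : Function.Injective f)
    (w : List (L × Bool)) (θ δ : ℝ) (l : L) (u v : ℝ) :
    seg (w.map (Prod.map f id)) θ δ (f l) u v ↔ seg w θ δ l u v := by
  refine exists_congr fun j => exists_congr fun b => and_congr_left fun _ => ?_
  rw [List.getElem?_map]
  cases w[j]? with
  | none => simp
  | some x => simp [Prod.ext_iff, hf.eq_iff]

theorem relabel_homeomorph {L' : Type*} {f : L → L'} (hf : Function.Injective f)
    (ws : List (List (L × Bool))) :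
    Nonempty (DiscSurface (polygons ws) ≃ₜ
      DiscSurface (polygons (ws.map (List.map (Prod.map f id))))) := by
  let e : Fin ws.length ≃ Fin (ws.map (List.map (Prod.map f id))).length :=
    finCongr (by simp)
  have he : ∀ i l u v, polygons (ws.map (List.map (Prod.map f id))) (e i) (f l) u v ↔
      polygons ws i l u v := by
    intro i l u v
    have : (ws.map (List.map (Prod.map f id))).get (e i) = (ws.get i).map (Prod.map f id) := by
      simp [e]
    rw [polygons, this, polygon, polygons_relabel_iff hf, List.length_map]
    rfl
  have hr : ∀ i l' u v, polygons (ws.map (List.map (Prod.map f id))) (e i) l' u v →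
      ∃ l, f l = l' := by
    intro i l' u v h
    have : (ws.map (List.map (Prod.map f id))).get (e i) = (ws.get i).map (Prod.map f id) := by
      simp [e]
    rw [polygons, this] at h
    obtain ⟨b, hb⟩ := seg.mem h
    obtain ⟨x, -, hx⟩ := List.mem_map.1 hb
    exact ⟨x.1, congrArg Prod.fst hx⟩
  let E : Fin ws.length ≃ₜ Fin (ws.map (List.map (Prod.map f id))).length :=
    ⟨e, continuous_of_discreteTopology, continuous_of_discreteTopology⟩
  let F := E.prodCongr (Homeomorph.refl Disc)
  refine (nonempty_quot_homeomorph (μ := F) F.isQuotientMap ?_ ?_ ?_).nonempty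
  · rintro _ _ ⟨⟨i, u, v, h, rfl⟩, ⟨i', u', v', h', rfl⟩, t⟩
    exact discRel_of (m := polygons (ws.map (List.map (Prod.map f id))))
      ((he _ _ _ _).2 h) ((he _ _ _ _).2 h') t
  · intro x y h
    rw [F.injective h]
  · rintro _ _ ⟨⟨i, u, v, h, rfl⟩, ⟨i', u', v', h', rfl⟩, t⟩
    obtain ⟨i, rfl⟩ := e.surjective i
    obtain ⟨i', rfl⟩ := e.surjective i'
    obtain ⟨l, rfl⟩ := hr _ _ _ _ h
    refine ⟨(i, arc u v t), (i', arc u' v' t), rfl, rfl, ?_⟩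
    exact discRel_of (m := polygons ws) ((he _ _ _ _).1 h) ((he _ _ _ _).1 h') t

theorem map_swap_eq_self [DecidableEq L] {c d : L} {w : List (L × Bool)}
    (hc : ∀ x ∈ w, x.1 ≠ c) (hd : ∀ x ∈ w, x.1 ≠ d) :
    w.map (Prod.map (Equiv.swap c d) id) = w :=
  (List.map_congr_left (f := Prod.map (Equiv.swap c d) id) (g := id) fun x hx => Prod.ext
    (Equiv.swap_apply_of_ne_of_ne (hc x hx) (hd x hx)) rfl).trans (List.map_id w)

/-- The polygon is cut along a chord with a fresh label that separates `a` from its inverse, the two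
pieces are glued along `a`, and the fresh label is renamed. Infinitely many letters guarantee a
fresh one. -/
theorem slide [Infinite L] (X₁ X₂ Y₁ Y₂ : List (L × Bool)) (a : L × Bool)
    {ws : List (List (L × Bool))}
    (h : ∀ w ∈ X₁ :: X₂ :: Y₁ :: Y₂ :: ws, ∀ x ∈ w, x.1 ≠ a.1) :
    SameSurface ((X₁ ++ a :: X₂ ++ (Y₁ ++ inv a :: Y₂)) :: ws)
      ((X₂ ++ inv a :: X₁ ++ (Y₂ ++ a :: Y₁)) :: ws) := by
  classical
  obtain ⟨c, hc⟩ := Infinite.exists_notMem_finset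
    (insert a.1 ((X₁ :: X₂ :: Y₁ :: Y₂ :: ws).flatten.map Prod.fst).toFinset)
  have hca : a.1 ≠ c := fun h => hc (by simp [h])
  have hc' : ∀ w ∈ X₁ :: X₂ :: Y₁ :: Y₂ :: ws, ∀ x ∈ w, x.1 ≠ c := by
    rintro w hw x hx rfl
    refine hc (Finset.mem_insert_of_mem (List.mem_toFinset.2 (List.mem_map_of_mem ?_)))
    exact List.mem_flatten.2 ⟨w, hw, hx⟩
  clear hc
  simp only [List.forall_mem_cons] at h hc'
  obtain ⟨h1, h2, h3, h4, h5⟩ := h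
  obtain ⟨c1, c2, c3, c4, c5⟩ := hc'
  -- The sign is opposite to that of `a`, so that renaming turns `d` into `inv a`.
  let d : L × Bool := (c, !a.2)
  have e1 := merge (X := X₁ ++ a :: X₂) (Y := Y₁ ++ inv a :: Y₂) (by simp) (by simp) d (ws := ws) (by
    simp only [List.forall_mem_cons, List.forall_mem_append, inv]
    exact ⟨⟨c1, hca, c2⟩, ⟨c3, hca, c4⟩, c5⟩)
  have e2 := rotate (d :: X₁) (a :: X₂) ((inv d :: (Y₁ ++ inv a :: Y₂)) :: ws)
  have e3 := rotate (inv d :: Y₁) (inv a :: Y₂) ((a :: X₂ ++ d :: X₁) :: ws)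
  have e4 := merge (X := X₂ ++ d :: X₁) (Y := Y₂ ++ inv d :: Y₁) (by simp) (by simp) a (ws := ws) (by
    simp only [List.forall_mem_cons, List.forall_mem_append, inv]
    exact ⟨⟨h2, hca.symm, h1⟩, ⟨h4, hca.symm, h3⟩, h5⟩)
  have e5 : SameSurface _ _ := relabel_homeomorph (Equiv.swap c a.1).injective
    (((X₂ ++ d :: X₁) ++ (Y₂ ++ inv d :: Y₁)) :: ws)
  have hws : ws.map (List.map (Prod.map (Equiv.swap c a.1) id)) = ws :=
    (List.map_congr_left (g := id) fun w hw => map_swap_eq_self (c5 w hw) (h5 w hw)).trans (List.map_id ws)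
  have hd : Prod.map (Equiv.swap c a.1) id d = inv a := by simp [d, inv]
  have hd' : Prod.map (Equiv.swap c a.1) id (inv d) = a := by simp [d, inv]
  simp only [List.map_cons, List.map_append, hws, hd, hd', map_swap_eq_self c1 h1,
    map_swap_eq_self c2 h2, map_swap_eq_self c3 h3, map_swap_eq_self c4 h4] at e5
  refine e1.symm.trans (e2.trans ?_)
  refine (of_perm (List.Perm.swap _ _ _)).trans (e3.trans ?_)
  exact (of_perm (List.Perm.swap _ _ _)).trans (e4.trans e5)

/-- Two linked pairs of sides can be separated from the rest of the polygon. -/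
theorem handle [Infinite L] (a b : L × Bool) (Q R S U : List (L × Bool))
    {ws : List (List (L × Bool))} (hab : a.1 ≠ b.1)
    (ha : ∀ w ∈ Q :: R :: S :: U :: ws, ∀ x ∈ w, x.1 ≠ a.1)
    (hb : ∀ w ∈ Q :: R :: S :: U :: ws, ∀ x ∈ w, x.1 ≠ b.1) :
    SameSurface ((a :: (Q ++ b :: (R ++ inv a :: (S ++ inv b :: U)))) :: ws)
      ((commWord (a, b) ++ (Q ++ (U ++ (S ++ R)))) :: ws) := by
  simp only [List.forall_mem_cons] at ha hb
  obtain ⟨a1, a2, a3, a4, a5⟩ := ha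
  obtain ⟨b1, b2, b3, b4, b5⟩ := hb
  have e1 := rotate [a] (Q ++ b :: (R ++ inv a :: (S ++ inv b :: U))) ws
  -- Sliding along `b` makes `a`, `b`, `inv a` consecutive up to rotation. The slide along `a` in
  -- `e5` brings `inv b` next to them and completes the commutator.
  have e2 := slide Q R (inv a :: S) (U ++ [a]) b (ws := ws) (by
    simp only [List.forall_mem_cons, List.forall_mem_append, inv]
    simp only [List.not_mem_nil, false_imp_iff, implies_true, and_true]
    exact ⟨b1, b2, ⟨hab, b3⟩, ⟨b4, hab⟩, b5⟩)
  have e3 := rotate (R ++ inv b :: (Q ++ U)) (a :: b :: inv a :: S) ws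
  have e4 := rotate ([a, b] ++ (inv a :: (S ++ R))) (inv b :: (Q ++ U)) ws
  have e5 := slide (inv b :: (Q ++ U)) [b] [] (S ++ R) a (ws := ws) (by
    simp only [List.forall_mem_cons, List.forall_mem_append, inv]
    simp only [List.not_mem_nil, false_imp_iff, implies_true, and_true, true_and]
    exact ⟨⟨hab.symm, a1, a4⟩, hab.symm, ⟨a3, a2⟩, a5⟩)
  have e6 := rotate (b :: inv a :: inv b :: (Q ++ (U ++ (S ++ R)))) [a] ws
  simp only [commWord, List.append_assoc, List.cons_append, List.nil_append] at e1 e2 e3 e4 e5 e6 ⊢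
  exact e1.trans (e2.trans (e3.trans (e4.trans (e5.trans e6))))

end SameSurface

end

section

variable {L : Type*}

/-! ### Comparison with the standard surface -/

theorem boundaryPoint_eq_ang (g : ℕ) (x : ℝ) : boundaryPoint g x = ang (x * (1 / (4 * g))) := by
  apply Subtype.ext
  simp only [boundaryPoint, ang]
  congr 3
  ring

theorem seg_flatMap_comm (ps : List ((L × Bool) × (L × Bool))) (θ δ : ℝ) (l : L) (u v : ℝ) :
    seg (ps.flatMap commWord) θ δ l u v ↔
      ∃ j : Fin ps.length, seg (commWord (ps.get j)) (θ + 4 * (j : ℕ) * δ) δ l u v := by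
  induction ps generalizing θ with
  | nil =>
    constructor
    · rintro ⟨j, b, h, -⟩
      simp at h
    · rintro ⟨j, -⟩
      exact j.elim0
  | cons p ps ih =>
    rw [List.flatMap_cons, seg_append, ih]
    have hs : ∀ j : Fin ps.length, θ + 4 * (((j.succ : Fin (ps.length + 1)) : ℕ) : ℝ) * δ =
        θ + (commWord p).length * δ + 4 * (j : ℕ) * δ := fun j => by
      rw [show (commWord p).length = 4 from rfl, Fin.val_succ]
      push_cast
      ring
    constructor
    · rintro (h | ⟨j, h⟩)
      · exact ⟨⟨0, by simp⟩, by simpa using h⟩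
      · refine ⟨j.succ, ?_⟩
        rw [← hs] at h
        exact h
    · rintro ⟨j, h⟩
      revert h
      refine Fin.cases (fun h => Or.inl (by simpa using h)) (fun j h => Or.inr ⟨j, ?_⟩) j
      rw [← hs]
      exact h

theorem seg_comm (p : (L × Bool) × (L × Bool)) (θ δ : ℝ) (l : L) (u v : ℝ) :
    seg (commWord p) θ δ l u v ↔ seg [p.1] θ δ l u v ∨ seg [p.2] (θ + δ) δ l u v ∨
      seg [inv p.1] (θ + 2 * δ) δ l u v ∨ seg [inv p.2] (θ + 3 * δ) δ l u v := by
  have h1 := seg_append [p.1] [p.2, inv p.1, inv p.2] θ δ l u v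
  have h2 := seg_append [p.2] [inv p.1, inv p.2] (θ + δ) δ l u v
  have h3 := seg_append [inv p.1] [inv p.2] (θ + 2 * δ) δ l u v
  simp only [List.length_singleton, Nat.cast_one, one_mul, List.singleton_append] at h1 h2 h3
  rw [show θ + δ + δ = θ + 2 * δ by ring] at h2
  rw [show θ + 2 * δ + δ = θ + 3 * δ by ring] at h3
  rw [commWord, h1, h2, h3]

/-- The polygon whose boundary word is a product of commutators of distinct letters gives the
standard surface. -/
theorem nonempty_homeomorph_standardSurface (ps : List ((L × Bool) × (L × Bool)))
    (hnd : (ps.flatMap fun p => [p.1.1, p.2.1]).Nodup) :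
    Nonempty (DiscSurface (polygons [ps.flatMap commWord]) ≃ₜ StandardSurface ps.length) := by
  set g := ps.length with hg
  set δ : ℝ := 1 / (4 * g) with hδ
  let lett : Fin g × Fin 2 → L × Bool := fun x => if x.2 = 0 then (ps.get x.1).1 else (ps.get x.1).2
  have hinj : ∀ x y, (lett x).1 = (lett y).1 → x = y := by
    obtain ⟨h1, h2⟩ := List.nodup_flatMap.1 hnd
    rintro ⟨j, s⟩ ⟨j', s'⟩ h
    have hmem : ∀ j s, (lett (j, s)).1 ∈ [(ps.get j).1.1, (ps.get j).2.1] := by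
      intro j s
      fin_cases s <;> simp [lett]
    have hj : j = j' := by
      by_contra hne
      rcases lt_or_gt_of_ne hne with hlt | hlt
      · exact (List.pairwise_iff_get.1 h2 _ _ hlt) (hmem j s) (h ▸ hmem j' s')
      · exact (List.pairwise_iff_get.1 h2 _ _ hlt) (h ▸ hmem j' s') (hmem j s)
    subst hj
    have hn := h1 _ (List.get_mem ps j)
    simp only [List.nodup_cons, List.mem_singleton, List.not_mem_nil, not_false_eq_true,
      List.nodup_nil, and_true] at hn
    fin_cases s <;> fin_cases s' <;> simp_all [lett]
  have hlen : ((ps.flatMap commWord).length : ℝ) = 4 * g := by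
    have : (ps.flatMap commWord).length = 4 * g := by
      rw [List.length_flatMap, hg]
      simp [commWord, mul_comm]
    rw [this]
    push_cast
    ring
  have hpoly : ∀ i l u v, polygons [ps.flatMap commWord] i l u v ↔
      ∃ j : Fin g, seg (commWord (ps.get j)) (4 * (j : ℕ) * δ) δ l u v := by
    intro i l u v
    obtain rfl : i = 0 := Subsingleton.elim (α := Fin 1) _ _
    change seg (ps.flatMap commWord) 0 (1 / ((ps.flatMap commWord).length : ℝ)) l u v ↔ _
    rw [hlen, seg_flatMap_comm]
    simp only [zero_add]
    exact Iff.rfl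
  let P : Fin g × Fin 2 → unitInterval → Disc := fun x t =>
    boundaryPoint g (4 * (x.1 : ℕ) + (x.2 : ℕ) + t)
  let P' : Fin g × Fin 2 → unitInterval → Disc := fun x t =>
    boundaryPoint g (4 * (x.1 : ℕ) + (x.2 : ℕ) + 3 - t)
  -- Both sides with a given letter are reparametrised by the sign of the same signed letter, so
  -- that sign does not affect which points are identified.
  have harc : ∀ i l u v, polygons [ps.flatMap commWord] i l u v → ∃ x, l = (lett x).1 ∧
      ((∀ t, arc u v t = P x (sideParam (lett x).2 t)) ∨
        (∀ t, arc u v t = P' x (sideParam (lett x).2 t))) := by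
    intro i l u v h
    obtain ⟨j, h⟩ := (hpoly i l u v).1 h
    rw [seg_comm] at h
    rcases h with h | h | h | h <;> obtain rfl := ((seg_singleton _ _ _ _ _ _).1 h).1
    · refine ⟨(j, 0), rfl, Or.inl fun t => ?_⟩
      rw [seg_singleton_arc _ h]
      simp only [P, boundaryPoint_eq_ang, ← hδ, lett, if_true]
      congr 1
      simp
      ring
    · refine ⟨(j, 1), rfl, Or.inl fun t => ?_⟩
      rw [seg_singleton_arc _ h]
      simp only [P, boundaryPoint_eq_ang, ← hδ, lett, one_ne_zero, if_false]
      congr 1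
      simp
      ring
    · refine ⟨(j, 0), rfl, Or.inr fun t => ?_⟩
      rw [seg_singleton_arc _ h]
      simp only [P', boundaryPoint_eq_ang, ← hδ, lett, if_true, inv, sideParam_not]
      congr 1
      simp
      ring
    · refine ⟨(j, 1), rfl, Or.inr fun t => ?_⟩
      rw [seg_singleton_arc _ h]
      simp only [P', boundaryPoint_eq_ang, ← hδ, lett, one_ne_zero, if_false, inv, sideParam_not]
      congr 1
      simp
      ring
  have hPP' : ∀ x t, Quot.mk (SideRel g) (P x t) = Quot.mk (SideRel g) (P' x t) := fun x t =>
    Quot.sound (SideRel.glue x.1 x.2 t)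
  have hback : ∀ x, (∃ u v, polygons [ps.flatMap commWord] 0 (lett x).1 u v ∧
      ∀ t, arc u v (sideParam (lett x).2 t) = P x t) ∧
      (∃ u v, polygons [ps.flatMap commWord] 0 (lett x).1 u v ∧
      ∀ t, arc u v (sideParam (lett x).2 t) = P' x t) := by
    have hs : ∀ (x : L × Bool) θ δ, ∃ u v, seg [x] θ δ x.1 u v := fun x θ δ =>
      ⟨_, _, (seg_singleton _ _ _ _ _ _).2 ⟨rfl, rfl, rfl⟩⟩
    rintro ⟨j, s⟩
    fin_cases s
    · constructor
      · obtain ⟨u, v, h⟩ := hs (ps.get j).1 (4 * (j : ℕ) * δ) δ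
        refine ⟨u, v, (hpoly _ _ _ _).2 ⟨j, (seg_comm _ _ _ _ _ _).2 (Or.inl h)⟩, fun t => ?_⟩
        rw [seg_singleton_arc _ h]
        simp only [P, boundaryPoint_eq_ang, ← hδ, lett]
        congr 1
        simp [sideParam_sideParam]
        ring
      · obtain ⟨u, v, h⟩ := hs (inv (ps.get j).1) (4 * (j : ℕ) * δ + 2 * δ) δ
        refine ⟨u, v, (hpoly _ _ _ _).2
          ⟨j, (seg_comm _ _ _ _ _ _).2 (Or.inr (Or.inr (Or.inl h)))⟩, fun t => ?_⟩
        rw [seg_singleton_arc _ h]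
        simp only [P', boundaryPoint_eq_ang, ← hδ, lett, inv, sideParam_not]
        congr 1
        simp [sideParam_sideParam]
        ring
    · constructor
      · obtain ⟨u, v, h⟩ := hs (ps.get j).2 (4 * (j : ℕ) * δ + δ) δ
        refine ⟨u, v, (hpoly _ _ _ _).2
          ⟨j, (seg_comm _ _ _ _ _ _).2 (Or.inr (Or.inl h))⟩, fun t => ?_⟩
        rw [seg_singleton_arc _ h]
        simp only [P, boundaryPoint_eq_ang, ← hδ, lett]
        congr 1
        simp [sideParam_sideParam]
        ring
      · obtain ⟨u, v, h⟩ := hs (inv (ps.get j).2) (4 * (j : ℕ) * δ + 3 * δ) δ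
        refine ⟨u, v, (hpoly _ _ _ _).2
          ⟨j, (seg_comm _ _ _ _ _ _).2 (Or.inr (Or.inr (Or.inr h)))⟩, fun t => ?_⟩
        rw [seg_singleton_arc _ h]
        simp only [P', boundaryPoint_eq_ang, ← hδ, lett, inv, sideParam_not]
        congr 1
        simp [sideParam_sideParam]
        ring
  let F : Fin [ps.flatMap commWord].length × Disc → Disc := Prod.snd
  have hF : IsQuotientMap F :=
    .of_surjective_continuous (fun z => ⟨(0, z), rfl⟩) continuous_snd
  refine (nonempty_quot_homeomorph (μ := F) hF ?_ ?_ ?_).nonempty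
  · rintro _ _ ⟨⟨i, u, v, h, rfl⟩, ⟨i', u', v', h', rfl⟩, t⟩
    obtain ⟨x, hx, hx'⟩ := harc _ _ _ _ h
    obtain ⟨y, hy, hy'⟩ := harc _ _ _ _ h'
    obtain rfl := hinj x y (hx.symm.trans hy)
    have e : ∀ {u v}, ((∀ t, arc u v t = P x (sideParam (lett x).2 t)) ∨
        (∀ t, arc u v t = P' x (sideParam (lett x).2 t))) →
        Quot.mk (SideRel g) (arc u v t) = Quot.mk (SideRel g) (P x (sideParam (lett x).2 t)) := by
      rintro u v (h | h)
      · rw [h]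
      · rw [h, hPP']
    exact (e hx').trans (e hy').symm
  · rintro ⟨i, x⟩ ⟨i', y⟩ h
    obtain rfl : i = i' := Subsingleton.elim (α := Fin 1) _ _
    exact congrArg (fun z => Quot.mk _ (i, z)) h
  · rintro _ _ ⟨j, s, t⟩
    obtain ⟨⟨u, v, h, e⟩, ⟨u', v', h', e'⟩⟩ := hback (j, s)
    refine ⟨(0, P (j, s) t), (0, P' (j, s) t), rfl, rfl, ?_⟩
    rw [← e, ← e']
    exact discRel_of (m := polygons [ps.flatMap commWord]) h h' _

end

/-! ### Boundary words of the glued surfaces -/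

/-- A letter with positive sign. -/
def pos {L : Type*} (l : L) : L × Bool := (l, true)

/-- A letter with negative sign. -/
def neg {L : Type*} (l : L) : L × Bool := (l, false)

theorem fresh_append {L : Type*} {Xs ws : List (List (L × Bool))} {l : L}
    (hX : ∀ w ∈ Xs, ∀ x ∈ w, x.1 ≠ l) (h : ∀ w ∈ ws, ∀ x ∈ w, x.1 ≠ l) :
    ∀ w ∈ Xs ++ ws, ∀ x ∈ w, x.1 ≠ l :=
  List.forall_mem_append.2 ⟨hX, h⟩

/-- The boundary words of the six tiles of a copy in which both slits of `α` are closed up with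
themselves. -/
def closedCopy (i n : ℕ) : List (List ((ℕ × ℕ) × Bool)) :=
  -- In copy `i` the letters 0 to 2 and 3 to 5 name the left sides of the strips of the first and
  -- second square, and 6 to 8 and 9 to 11 their bottom sides. The letter of index `n` is the bottom
  -- of the first square of the next copy.
  [[pos (i, 6), pos (i, 3), neg (i, 7), neg (i, 0)],
    [pos (i, 7), pos (i, 1), neg (i, 8), neg (i, 1)],
    [pos (i, 8), pos (i, 5), neg (n, 6), neg (i, 2)],
    [pos (i, 9), pos (i, 0), neg (i, 10), neg (i, 3)],
    [pos (i, 10), pos (i, 4), neg (i, 11), neg (i, 4)],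
    [pos (i, 11), pos (i, 2), neg (i, 9), neg (i, 5)]]

/-- The boundary words of the tiles of the first two copies if their slits are glued cyclically. -/
def linkedCopies (n : ℕ) : List (List ((ℕ × ℕ) × Bool)) :=
  [[pos (0, 6), pos (0, 3), neg (0, 7), neg (0, 0)],
    -- This tile and its counterpart in copy 1 are the only ones that differ from closed copies: the
    -- right sides of the slit strips of the two first squares are exchanged.
    [pos (0, 7), pos (1, 1), neg (0, 8), neg (0, 1)],
    [pos (0, 8), pos (0, 5), neg (1, 6), neg (0, 2)],
    [pos (0, 9), pos (0, 0), neg (0, 10), neg (0, 3)],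
    [pos (0, 10), pos (0, 4), neg (0, 11), neg (0, 4)],
    [pos (0, 11), pos (0, 2), neg (0, 9), neg (0, 5)],
    [pos (1, 6), pos (1, 3), neg (1, 7), neg (1, 0)],
    [pos (1, 7), pos (0, 1), neg (1, 8), neg (1, 1)],
    [pos (1, 8), pos (1, 5), neg (n, 6), neg (1, 2)],
    [pos (1, 9), pos (1, 0), neg (1, 10), neg (1, 3)],
    [pos (1, 10), pos (1, 4), neg (1, 11), neg (1, 4)],
    [pos (1, 11), pos (1, 2), neg (1, 9), neg (1, 5)]]

/-! ### Reducing the tiles of one or two copies to a single polygon -/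

namespace SameSurface

theorem rot {L : Type*} (n : ℕ) (w : List (L × Bool)) (ws : List (List (L × Bool))) :
    SameSurface (w :: ws) (w.rotate n :: ws) := by
  rw [List.rotate_eq_drop_append_take_mod]
  have := rotate (w.take (n % w.length)) (w.drop (n % w.length)) ws
  rwa [List.take_append_drop] at this

/-- Three quadrilaterals stacked along horizontal sides form an octagon. -/
theorem stack {L : Type*} (b₀ b₃ l₀ l₁ l₂ r₀ r₁ r₂ : L × Bool) (b₁ b₂ : L)
    {ws : List (List (L × Bool))}
    (h₁ : ∀ w ∈ [[b₀, r₀, inv l₀], [r₁, inv l₁], [r₂, inv b₃, inv l₂], [pos b₂]] ++ ws,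
      ∀ x ∈ w, x.1 ≠ b₁)
    (h₂ : ∀ w ∈ [[b₀, r₀, inv l₀], [r₁, inv l₁], [r₂, inv b₃, inv l₂]] ++ ws,
      ∀ x ∈ w, x.1 ≠ b₂) :
    SameSurface ([b₀, r₀, neg b₁, inv l₀] :: [pos b₁, r₁, neg b₂, inv l₁] ::
        [pos b₂, r₂, inv b₃, inv l₂] :: ws)
      ([b₀, r₀, r₁, r₂, inv b₃, inv l₂, inv l₁, inv l₀] :: ws) := by
  simp only [List.forall_mem_append, List.forall_mem_cons, List.not_mem_nil, false_imp_iff,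
    implies_true, and_true] at h₁ h₂
  refine SameSurface.trans (rot 2 _ _) ?_
  refine SameSurface.trans (merge (X := [inv l₀, b₀, r₀]) (Y := [r₁, neg b₂, inv l₁]) (by simp)
    (by simp) (neg b₁) ?_) ?_
  · simp only [List.forall_mem_cons, List.not_mem_nil, false_imp_iff, implies_true, and_true]
    simp only [neg]
    tauto
  refine SameSurface.trans (rot 4 _ _) ?_
  refine SameSurface.trans (merge (X := [inv l₁, inv l₀, b₀, r₀, r₁]) (Y := [r₂, inv b₃, inv l₂])
    (by simp) (by simp) (neg b₂) ?_) ?_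
  · simp only [List.forall_mem_cons, List.not_mem_nil, false_imp_iff, implies_true, and_true]
    simp only [neg]
    tauto
  exact rot 2 _ _

/-- The two octagons are the squares of one copy. They share the wall `c₀`, on the left of the first
square and on the right of the second; gluing there leaves one 14-gon per copy. -/
theorem octagon_pair {L : Type*} (x x' c₀ a₀ a₀' d₀ c₁ a₁ a₁' d₁ b : L)
    {ws : List (List (L × Bool))}
    (h : ∀ w ∈ [[pos x, pos x', pos a₀, pos a₀', pos d₀, pos c₁, pos a₁, pos a₁', pos d₁, pos b]]
      ++ ws, ∀ y ∈ w, y.1 ≠ c₀) :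
    SameSurface ([pos x, pos c₁, pos a₀', pos d₁, neg x', neg d₀, neg a₀, neg c₀] ::
        [pos b, pos c₀, pos a₁', pos d₀, neg b, neg d₁, neg a₁, neg c₁] :: ws)
      ([pos x, pos c₁, pos a₀', pos d₁, neg x', neg d₀, neg a₀, pos a₁', pos d₀, neg b, neg d₁,
        neg a₁, neg c₁, pos b] :: ws) := by
  simp only [List.forall_mem_append, List.forall_mem_cons, List.not_mem_nil, false_imp_iff,
    implies_true, and_true] at h
  refine SameSurface.trans (rot 7 _ _) ?_
  refine (of_perm (List.Perm.swap _ _ _)).trans ?_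
  refine SameSurface.trans (rot 1 _ _) ?_
  refine (of_perm (List.Perm.swap _ _ _)).trans ?_
  refine merge (X := [pos x, pos c₁, pos a₀', pos d₁, neg x', neg d₀, neg a₀])
    (Y := [pos a₁', pos d₀, neg b, neg d₁, neg a₁, neg c₁, pos b]) (by simp) (by simp)
    (neg c₀) ?_
  simp only [List.forall_mem_cons, List.not_mem_nil, false_imp_iff, implies_true, and_true]
  simp only [neg, pos] at h ⊢
  tauto

/-- The six tiles become two octagons and then a 14-gon. Two commutators are split off, two pairs
cancel, and only the sides along which the copy is attached to its neighbours are left. -/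
theorem closedCopy_reduce (i n : ℕ) {ws : List (List ((ℕ × ℕ) × Bool))}
    (fr : ∀ c, c ≠ 6 → ∀ w ∈ ws, ∀ x ∈ w, x.1 ≠ (i, c)) :
    SameSurface (closedCopy i n ++ ws)
      ((pos (i, 6) :: (([(neg (i, 3), neg (i, 1)), (neg (i, 9), neg (i, 5))].flatMap commWord) ++
        [neg (n, 6)])) :: ws) := by
  refine SameSurface.trans (stack (pos (i, 6)) (pos (n, 6)) (pos (i, 0)) (pos (i, 1)) (pos (i, 2))
    (pos (i, 3)) (pos (i, 1)) (pos (i, 5)) (i, 7) (i, 8)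
    (fresh_append (Xs := [_, _, _, _, _, _, _]) (by simp [pos, neg, inv, -List.mem_cons, -Prod.forall, List.forall_mem_cons]) (fr _ (by simp)))
    (fresh_append (Xs := [_, _, _, _, _, _]) (by simp [pos, neg, inv, -List.mem_cons, -Prod.forall, List.forall_mem_cons]) (fr _ (by simp)))) ?_
  refine SameSurface.trans (of_perm (List.perm_append_comm_assoc [_] [_, _, _] _)) ?_
  refine SameSurface.trans (stack (pos (i, 9)) (pos (i, 9)) (pos (i, 3)) (pos (i, 4)) (pos (i, 5))
    (pos (i, 0)) (pos (i, 4)) (pos (i, 2)) (i, 10) (i, 11)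
    (fresh_append (Xs := [_, _, _, _, _]) (by simp [pos, inv, -List.mem_cons, -Prod.forall, List.forall_mem_cons]) (fr _ (by simp)))
    (fresh_append (Xs := [_, _, _, _]) (by simp [pos, inv, -List.mem_cons, -Prod.forall, List.forall_mem_cons]) (fr _ (by simp)))) ?_
  refine (of_perm (List.Perm.swap _ _ _)).trans ?_
  refine SameSurface.trans (octagon_pair (i, 6) (n, 6) (i, 0) (i, 1) (i, 1) (i, 2) (i, 3) (i, 4)
    (i, 4) (i, 5) (i, 9) (fresh_append (by simp [pos, -List.mem_cons, -Prod.forall, List.forall_mem_cons]) (fr _ (by simp)))) ?_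
  -- The letters 9 and 5 are linked; the rotation puts 9 in front, as `handle` expects. The next
  -- rotation does the same for the linked letters 3 and 1.
  refine SameSurface.trans (rot 9 [pos (i, 6), pos (i, 3), pos (i, 1), pos (i, 5), neg (n, 6), neg (i, 2), neg (i, 1), pos (i, 4), pos (i, 2), neg (i, 9), neg (i, 5), neg (i, 4), neg (i, 3), pos (i, 9)] _) ?_
  refine SameSurface.trans (handle (neg (i, 9)) (neg (i, 5))
      []
      [neg (i, 4), neg (i, 3)]
      [pos (i, 6), pos (i, 3), pos (i, 1)]
      [neg (n, 6), neg (i, 2), neg (i, 1), pos (i, 4), pos (i, 2)] (by simp [neg, -List.mem_cons, -Prod.forall])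
      (fresh_append (Xs := [_, _, _, _]) (by simp [pos, neg, -List.mem_cons, -Prod.forall, List.forall_mem_cons]) (fr _ (by simp))) (fresh_append (Xs := [_, _, _, _]) (by simp [pos, neg, -List.mem_cons, -Prod.forall, List.forall_mem_cons]) (fr _ (by simp)))) ?_
  refine SameSurface.trans (rot 13 [neg (i, 9), neg (i, 5), pos (i, 9), pos (i, 5), neg (n, 6), neg (i, 2), neg (i, 1), pos (i, 4), pos (i, 2), pos (i, 6), pos (i, 3), pos (i, 1), neg (i, 4), neg (i, 3)] _) ?_
  refine SameSurface.trans (handle (neg (i, 3)) (neg (i, 1))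
      [neg (i, 9), neg (i, 5), pos (i, 9), pos (i, 5), neg (n, 6), neg (i, 2)]
      [pos (i, 4), pos (i, 2), pos (i, 6)]
      []
      [neg (i, 4)] (by simp [neg, -List.mem_cons, -Prod.forall])
      (fresh_append (Xs := [_, _, _, _]) (by simp [pos, neg, -List.mem_cons, -Prod.forall, List.forall_mem_cons]) (fr _ (by simp))) (fresh_append (Xs := [_, _, _, _]) (by simp [pos, neg, -List.mem_cons, -Prod.forall, List.forall_mem_cons]) (fr _ (by simp)))) ?_
  refine SameSurface.trans (rot 12 [neg (i, 3), neg (i, 1), pos (i, 3), pos (i, 1), neg (i, 9), neg (i, 5), pos (i, 9), pos (i, 5), neg (n, 6), neg (i, 2), neg (i, 4), pos (i, 4), pos (i, 2), pos (i, 6)] _) ?_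
  -- The letter 4 is now adjacent to its inverse; once it is gone, so is the letter 2 up to
  -- rotation.
  refine SameSurface.trans (cancel (X := [pos (i, 2), pos (i, 6), neg (i, 3), neg (i, 1), pos (i, 3), pos (i, 1), neg (i, 9), neg (i, 5), pos (i, 9), pos (i, 5), neg (n, 6), neg (i, 2)])
      (by simp) (neg (i, 4)) (fresh_append (Xs := [_]) (by simp [pos, neg, -List.mem_cons, -Prod.forall, List.forall_mem_cons]) (fr _ (by simp)))) ?_
  refine SameSurface.trans (rot 1 [pos (i, 2), pos (i, 6), neg (i, 3), neg (i, 1), pos (i, 3), pos (i, 1), neg (i, 9), neg (i, 5), pos (i, 9), pos (i, 5), neg (n, 6), neg (i, 2)] _) ?_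
  exact (cancel (X := [pos (i, 6), neg (i, 3), neg (i, 1), pos (i, 3), pos (i, 1), neg (i, 9), neg (i, 5), pos (i, 9), pos (i, 5), neg (n, 6)])
      (by simp) (neg (i, 2)) (fresh_append (Xs := [_]) (by simp [pos, neg, -List.mem_cons, -Prod.forall, List.forall_mem_cons]) (fr _ (by simp))))

/-- Each copy becomes a 14-gon and the two are merged along the letter (1, 6). The resulting 26-gon
contains five linked pairs of letters and two cancelling letters: one commutator more than two
closed copies, because of the exchanged slit walls. -/
theorem linkedCopies_reduce (n : ℕ) {ws : List (List ((ℕ × ℕ) × Bool))}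
    (fr : ∀ i c, i < 2 → c ≠ 6 → ∀ w ∈ ws, ∀ x ∈ w, x.1 ≠ (i, c))
    (fr' : n ≠ 1 ∧ ∀ w ∈ ws, ∀ x ∈ w, x.1 ≠ (1, 6)) :
    SameSurface (linkedCopies n ++ ws)
      ((pos (0, 6) :: (([(neg (0, 3), neg (0, 1)), (neg (0, 9), pos (1, 3)),
        (pos (0, 5), neg (1, 4)), (neg (1, 9), neg (1, 2)), (pos (1, 5), neg (1, 1))].flatMap
          commWord) ++ [neg (n, 6)])) :: ws) := by
  refine SameSurface.trans (stack (pos (0, 6)) (pos (1, 6)) (pos (0, 0)) (pos (0, 1)) (pos (0, 2))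
    (pos (0, 3)) (pos (1, 1)) (pos (0, 5)) (0, 7) (0, 8)
    (fresh_append (Xs := [_, _, _, _, _, _, _, _, _, _, _, _, _]) (by simp [pos, neg, inv, -List.mem_cons, -Prod.forall, List.forall_mem_cons])
      (fr _ _ (by simp) (by simp)))
    (fresh_append (Xs := [_, _, _, _, _, _, _, _, _, _, _, _]) (by simp [pos, neg, inv, -List.mem_cons, -Prod.forall, List.forall_mem_cons])
      (fr _ _ (by simp) (by simp)))) ?_
  refine SameSurface.trans (of_perm (List.perm_append_comm_assoc [_] [_, _, _] _)) ?_
  refine SameSurface.trans (stack (pos (0, 9)) (pos (0, 9)) (pos (0, 3)) (pos (0, 4)) (pos (0, 5))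
    (pos (0, 0)) (pos (0, 4)) (pos (0, 2)) (0, 10) (0, 11)
    (fresh_append (Xs := [_, _, _, _, _, _, _, _, _, _, _]) (by simp [pos, neg, inv, -List.mem_cons, -Prod.forall, List.forall_mem_cons])
      (fr _ _ (by simp) (by simp)))
    (fresh_append (Xs := [_, _, _, _, _, _, _, _, _, _]) (by simp [pos, neg, inv, -List.mem_cons, -Prod.forall, List.forall_mem_cons])
      (fr _ _ (by simp) (by simp)))) ?_
  refine (of_perm (List.Perm.swap _ _ _)).trans ?_
  refine SameSurface.trans (octagon_pair (0, 6) (1, 6) (0, 0) (0, 1) (1, 1) (0, 2) (0, 3) (0, 4)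
    (0, 4) (0, 5) (0, 9) (fresh_append (Xs := [_, _, _, _, _, _, _]) (by simp [pos, neg, -List.mem_cons, -Prod.forall, List.forall_mem_cons])
      (fr _ _ (by simp) (by simp)))) ?_
  refine SameSurface.trans (of_perm (List.perm_append_comm_assoc [_] [_, _, _] _)) ?_
  refine SameSurface.trans (stack (pos (1, 6)) (pos (n, 6)) (pos (1, 0)) (pos (1, 1)) (pos (1, 2))
    (pos (1, 3)) (pos (0, 1)) (pos (1, 5)) (1, 7) (1, 8)
    (fresh_append (Xs := [_, _, _, _, _, _, _, _]) (by simp [pos, neg, inv, -List.mem_cons, -Prod.forall, List.forall_mem_cons])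
      (fr _ _ (by simp) (by simp)))
    (fresh_append (Xs := [_, _, _, _, _, _, _]) (by simp [pos, neg, inv, -List.mem_cons, -Prod.forall, List.forall_mem_cons])
      (fr _ _ (by simp) (by simp)))) ?_
  refine SameSurface.trans (of_perm (List.perm_append_comm_assoc [_, _] [_, _, _] _)) ?_
  refine SameSurface.trans (stack (pos (1, 9)) (pos (1, 9)) (pos (1, 3)) (pos (1, 4)) (pos (1, 5))
    (pos (1, 0)) (pos (1, 4)) (pos (1, 2)) (1, 10) (1, 11)
    (fresh_append (Xs := [_, _, _, _, _, _]) (by simp [pos, neg, inv, -List.mem_cons, -Prod.forall, List.forall_mem_cons])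
      (fr _ _ (by simp) (by simp)))
    (fresh_append (Xs := [_, _, _, _, _]) (by simp [pos, neg, inv, -List.mem_cons, -Prod.forall, List.forall_mem_cons])
      (fr _ _ (by simp) (by simp)))) ?_
  refine (of_perm (List.Perm.swap _ _ _)).trans ?_
  refine SameSurface.trans (octagon_pair (1, 6) (n, 6) (1, 0) (1, 1) (0, 1) (1, 2) (1, 3) (1, 4)
    (1, 4) (1, 5) (1, 9) (fresh_append (Xs := [_, _]) (by simp [pos, neg, -List.mem_cons, -Prod.forall, List.forall_mem_cons])
      (fr _ _ (by simp) (by simp)))) ?_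
  refine (of_perm (List.Perm.swap _ _ _)).trans ?_
  refine SameSurface.trans (rot 4 _ _) ?_
  -- The merge along (1, 6) needs this letter to occur nowhere else, hence `fr'`.
  refine SameSurface.trans (merge (X := [neg (0, 2), neg (0, 1), pos (0, 4), pos (0, 2), neg (0, 9),
      neg (0, 5), neg (0, 4), neg (0, 3), pos (0, 9), pos (0, 6), pos (0, 3), pos (1, 1),
      pos (0, 5)])
    (Y := [pos (1, 3), pos (0, 1), pos (1, 5), neg (n, 6), neg (1, 2), neg (1, 1), pos (1, 4),
      pos (1, 2), neg (1, 9), neg (1, 5), neg (1, 4), neg (1, 3), pos (1, 9)])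
    (by simp) (by simp) (neg (1, 6))
    (fresh_append (Xs := [_, _]) (by simp [pos, neg, fr'.1, -List.mem_cons, -Prod.forall, List.forall_mem_cons]) fr'.2)) ?_
  refine SameSurface.trans (rot 15 [neg (0, 2), neg (0, 1), pos (0, 4), pos (0, 2), neg (0, 9), neg (0, 5), neg (0, 4), neg (0, 3), pos (0, 9), pos (0, 6), pos (0, 3), pos (1, 1), pos (0, 5), pos (1, 3), pos (0, 1), pos (1, 5), neg (n, 6), neg (1, 2), neg (1, 1), pos (1, 4), pos (1, 2), neg (1, 9), neg (1, 5), neg (1, 4), neg (1, 3), pos (1, 9)] _) ?_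
  refine SameSurface.trans (handle (pos (1, 5)) (neg (1, 1))
      [neg (n, 6), neg (1, 2)]
      [pos (1, 4), pos (1, 2), neg (1, 9)]
      [neg (1, 4), neg (1, 3), pos (1, 9), neg (0, 2), neg (0, 1), pos (0, 4), pos (0, 2), neg (0, 9), neg (0, 5), neg (0, 4), neg (0, 3), pos (0, 9), pos (0, 6), pos (0, 3)]
      [pos (0, 5), pos (1, 3), pos (0, 1)] (by simp [pos, neg, -List.mem_cons, -Prod.forall])
      (fresh_append (Xs := [_, _, _, _]) (by simp [pos, neg, -List.mem_cons, -Prod.forall, List.forall_mem_cons]) (fr _ _ (by simp) (by simp))) (fresh_append (Xs := [_, _, _, _]) (by simp [pos, neg, -List.mem_cons, -Prod.forall, List.forall_mem_cons]) (fr _ _ (by simp) (by simp)))) ?_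
  refine SameSurface.trans (rot 6 [pos (1, 5), neg (1, 1), neg (1, 5), pos (1, 1), neg (n, 6), neg (1, 2), pos (0, 5), pos (1, 3), pos (0, 1), neg (1, 4), neg (1, 3), pos (1, 9), neg (0, 2), neg (0, 1), pos (0, 4), pos (0, 2), neg (0, 9), neg (0, 5), neg (0, 4), neg (0, 3), pos (0, 9), pos (0, 6), pos (0, 3), pos (1, 4), pos (1, 2), neg (1, 9)] _) ?_
  refine SameSurface.trans (handle (pos (0, 5)) (neg (1, 4))
      [pos (1, 3), pos (0, 1)]
      [neg (1, 3), pos (1, 9), neg (0, 2), neg (0, 1), pos (0, 4), pos (0, 2), neg (0, 9)]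
      [neg (0, 4), neg (0, 3), pos (0, 9), pos (0, 6), pos (0, 3)]
      [pos (1, 2), neg (1, 9), pos (1, 5), neg (1, 1), neg (1, 5), pos (1, 1), neg (n, 6), neg (1, 2)] (by simp [pos, neg, -List.mem_cons, -Prod.forall])
      (fresh_append (Xs := [_, _, _, _]) (by simp [pos, neg, -List.mem_cons, -Prod.forall, List.forall_mem_cons]) (fr _ _ (by simp) (by simp))) (fresh_append (Xs := [_, _, _, _]) (by simp [pos, neg, -List.mem_cons, -Prod.forall, List.forall_mem_cons]) (fr _ _ (by simp) (by simp)))) ?_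
  refine SameSurface.trans (rot 7 [pos (0, 5), neg (1, 4), neg (0, 5), pos (1, 4), pos (1, 3), pos (0, 1), pos (1, 2), neg (1, 9), pos (1, 5), neg (1, 1), neg (1, 5), pos (1, 1), neg (n, 6), neg (1, 2), neg (0, 4), neg (0, 3), pos (0, 9), pos (0, 6), pos (0, 3), neg (1, 3), pos (1, 9), neg (0, 2), neg (0, 1), pos (0, 4), pos (0, 2), neg (0, 9)] _) ?_
  refine SameSurface.trans (handle (neg (1, 9)) (neg (1, 2))
      [pos (1, 5), neg (1, 1), neg (1, 5), pos (1, 1), neg (n, 6)]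
      [neg (0, 4), neg (0, 3), pos (0, 9), pos (0, 6), pos (0, 3), neg (1, 3)]
      [neg (0, 2), neg (0, 1), pos (0, 4), pos (0, 2), neg (0, 9), pos (0, 5), neg (1, 4), neg (0, 5), pos (1, 4), pos (1, 3), pos (0, 1)]
      [] (by simp [neg, -List.mem_cons, -Prod.forall])
      (fresh_append (Xs := [_, _, _, _]) (by simp [pos, neg, -List.mem_cons, -Prod.forall, List.forall_mem_cons]) (fr _ _ (by simp) (by simp))) (fresh_append (Xs := [_, _, _, _]) (by simp [pos, neg, -List.mem_cons, -Prod.forall, List.forall_mem_cons]) (fr _ _ (by simp) (by simp)))) ?_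
  refine SameSurface.trans (rot 13 [neg (1, 9), neg (1, 2), pos (1, 9), pos (1, 2), pos (1, 5), neg (1, 1), neg (1, 5), pos (1, 1), neg (n, 6), neg (0, 2), neg (0, 1), pos (0, 4), pos (0, 2), neg (0, 9), pos (0, 5), neg (1, 4), neg (0, 5), pos (1, 4), pos (1, 3), pos (0, 1), neg (0, 4), neg (0, 3), pos (0, 9), pos (0, 6), pos (0, 3), neg (1, 3)] _) ?_
  refine SameSurface.trans (handle (neg (0, 9)) (pos (1, 3))
      [pos (0, 5), neg (1, 4), neg (0, 5), pos (1, 4)]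
      [pos (0, 1), neg (0, 4), neg (0, 3)]
      [pos (0, 6), pos (0, 3)]
      [neg (1, 9), neg (1, 2), pos (1, 9), pos (1, 2), pos (1, 5), neg (1, 1), neg (1, 5), pos (1, 1), neg (n, 6), neg (0, 2), neg (0, 1), pos (0, 4), pos (0, 2)] (by simp [pos, neg, -List.mem_cons, -Prod.forall])
      (fresh_append (Xs := [_, _, _, _]) (by simp [pos, neg, -List.mem_cons, -Prod.forall, List.forall_mem_cons]) (fr _ _ (by simp) (by simp))) (fresh_append (Xs := [_, _, _, _]) (by simp [pos, neg, -List.mem_cons, -Prod.forall, List.forall_mem_cons]) (fr _ _ (by simp) (by simp)))) ?_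
  refine SameSurface.trans (rot 25 [neg (0, 9), pos (1, 3), pos (0, 9), neg (1, 3), pos (0, 5), neg (1, 4), neg (0, 5), pos (1, 4), neg (1, 9), neg (1, 2), pos (1, 9), pos (1, 2), pos (1, 5), neg (1, 1), neg (1, 5), pos (1, 1), neg (n, 6), neg (0, 2), neg (0, 1), pos (0, 4), pos (0, 2), pos (0, 6), pos (0, 3), pos (0, 1), neg (0, 4), neg (0, 3)] _) ?_
  refine SameSurface.trans (handle (neg (0, 3)) (neg (0, 1))
      [neg (0, 9), pos (1, 3), pos (0, 9), neg (1, 3), pos (0, 5), neg (1, 4), neg (0, 5), pos (1, 4), neg (1, 9), neg (1, 2), pos (1, 9), pos (1, 2), pos (1, 5), neg (1, 1), neg (1, 5), pos (1, 1), neg (n, 6), neg (0, 2)]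
      [pos (0, 4), pos (0, 2), pos (0, 6)]
      []
      [neg (0, 4)] (by simp [neg, -List.mem_cons, -Prod.forall])
      (fresh_append (Xs := [_, _, _, _]) (by simp [pos, neg, -List.mem_cons, -Prod.forall, List.forall_mem_cons]) (fr _ _ (by simp) (by simp))) (fresh_append (Xs := [_, _, _, _]) (by simp [pos, neg, -List.mem_cons, -Prod.forall, List.forall_mem_cons]) (fr _ _ (by simp) (by simp)))) ?_
  refine SameSurface.trans (rot 24 [neg (0, 3), neg (0, 1), pos (0, 3), pos (0, 1), neg (0, 9), pos (1, 3), pos (0, 9), neg (1, 3), pos (0, 5), neg (1, 4), neg (0, 5), pos (1, 4), neg (1, 9), neg (1, 2), pos (1, 9), pos (1, 2), pos (1, 5), neg (1, 1), neg (1, 5), pos (1, 1), neg (n, 6), neg (0, 2), neg (0, 4), pos (0, 4), pos (0, 2), pos (0, 6)] _) ?_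
  refine SameSurface.trans (cancel (X := [pos (0, 2), pos (0, 6), neg (0, 3), neg (0, 1), pos (0, 3), pos (0, 1), neg (0, 9), pos (1, 3), pos (0, 9), neg (1, 3), pos (0, 5), neg (1, 4), neg (0, 5), pos (1, 4), neg (1, 9), neg (1, 2), pos (1, 9), pos (1, 2), pos (1, 5), neg (1, 1), neg (1, 5), pos (1, 1), neg (n, 6), neg (0, 2)])
      (by simp) (neg (0, 4)) (fresh_append (Xs := [_]) (by simp [pos, neg, -List.mem_cons, -Prod.forall, List.forall_mem_cons]) (fr _ _ (by simp) (by simp)))) ?_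
  refine SameSurface.trans (rot 1 [pos (0, 2), pos (0, 6), neg (0, 3), neg (0, 1), pos (0, 3), pos (0, 1), neg (0, 9), pos (1, 3), pos (0, 9), neg (1, 3), pos (0, 5), neg (1, 4), neg (0, 5), pos (1, 4), neg (1, 9), neg (1, 2), pos (1, 9), pos (1, 2), pos (1, 5), neg (1, 1), neg (1, 5), pos (1, 1), neg (n, 6), neg (0, 2)] _) ?_
  exact (cancel (X := [pos (0, 6), neg (0, 3), neg (0, 1), pos (0, 3), pos (0, 1), neg (0, 9), pos (1, 3), pos (0, 9), neg (1, 3), pos (0, 5), neg (1, 4), neg (0, 5), pos (1, 4), neg (1, 9), neg (1, 2), pos (1, 9), pos (1, 2), pos (1, 5), neg (1, 1), neg (1, 5), pos (1, 1), neg (n, 6)])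
      (by simp) (neg (0, 2)) (fresh_append (Xs := [_]) (by simp [pos, neg, -List.mem_cons, -Prod.forall, List.forall_mem_cons]) (fr _ _ (by simp) (by simp))))

end SameSurface

/-- The letters which occur in a product of commutators. -/
def letters {L : Type*} (ps : List ((L × Bool) × (L × Bool))) : List L :=
  ps.flatMap fun p => [p.1.1, p.2.1]

theorem mem_letters_of_mem_flatMap_commWord {L : Type*} {ps : List ((L × Bool) × (L × Bool))}
    {x : L × Bool} (hx : x ∈ ps.flatMap commWord) : x.1 ∈ letters ps := by
  obtain ⟨p, hp, hx⟩ := List.mem_flatMap.1 hx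
  refine List.mem_flatMap.2 ⟨p, hp, ?_⟩
  simp only [commWord, List.mem_cons, List.not_mem_nil, or_false] at hx
  rcases hx with rfl | rfl | rfl | rfl <;> simp [inv]

theorem mem_closedCopy {i n : ℕ} {w : List ((ℕ × ℕ) × Bool)} (hw : w ∈ closedCopy i n)
    {x : (ℕ × ℕ) × Bool} (hx : x ∈ w) : x.1.1 = i ∨ x.1 = (n, 6) := by
  simp only [closedCopy, List.mem_cons, List.not_mem_nil, or_false] at hw
  rcases hw with rfl | rfl | rfl | rfl | rfl | rfl <;>
    · simp only [List.mem_cons, List.not_mem_nil, or_false] at hx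
      rcases hx with rfl | rfl | rfl | rfl <;> simp [pos, neg]

/-! ### Cyclic chains of copies -/

namespace SameSurface

/-- Induction on the number of copies not yet attached. The polygon built so far begins with the
bottom letter of copy 0, continues with commutators and ends with the inverse bottom letter of copy
j, along which the next copy is merged, adding two commutators. After the last copy the index wraps
around to 0 and the two outer letters cancel. -/
theorem exists_chain_reduce (k m : ℕ) : ∀ (j : ℕ) (ps : List (((ℕ × ℕ) × Bool) × ((ℕ × ℕ) × Bool))),
    j + m = k → 1 ≤ j → ps ≠ [] → (letters ps).Nodup →
    (∀ l ∈ letters ps, l.1 < j ∧ l.2 ≠ 6) →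
    ∃ ps' : List (((ℕ × ℕ) × Bool) × ((ℕ × ℕ) × Bool)), ps'.length = ps.length + 2 * m ∧
      (letters ps').Nodup ∧
      SameSurface ((pos (0, 6) :: (ps.flatMap commWord ++ [neg (j % k, 6)])) ::
        (List.range' j m).flatMap fun i => closedCopy i ((i + 1) % k)) [ps'.flatMap commWord] := by
  induction m with
  | zero =>
    intro j ps hjk hj hne hnd hlt
    refine ⟨ps, rfl, hnd, ?_⟩
    obtain rfl : j = k := hjk
    rw [Nat.mod_self]
    have h := rotate [pos (0, 6)] (ps.flatMap commWord ++ [neg (0, 6)]) []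
    rw [List.append_assoc] at h
    refine SameSurface.trans h (cancel ?_ (neg (0, 6)) ?_)
    · cases ps with
      | nil => exact absurd rfl hne
      | cons p ps => simp [commWord]
    · intro w hw x hx
      obtain rfl := List.mem_singleton.1 hw
      exact fun h => (hlt _ (mem_letters_of_mem_flatMap_commWord hx)).2 (by rw [h]; rfl)
  | succ m ih =>
    intro j ps hjk hj hne hnd hlt
    have hk : j % k = j := Nat.mod_eq_of_lt (by omega)
    -- A copy is not attached to itself. If the index wraps to 0, this uses j ≥ 1.
    have hk' : (j + 1) % k ≠ j := by
      rcases eq_or_ne (j + 1) k with h | h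
      · rw [h, Nat.mod_self]; omega
      · rw [Nat.mod_eq_of_lt (by omega)]; omega
    set qs : List (((ℕ × ℕ) × Bool) × ((ℕ × ℕ) × Bool)) :=
      [(neg (j, 3), neg (j, 1)), (neg (j, 9), neg (j, 5))] with hqs
    have hq : ∀ l ∈ letters qs, l.1 = j ∧ l.2 ≠ 6 := by
      intro l hl
      simp only [letters, qs, List.flatMap_cons, List.flatMap_nil, List.mem_append, List.mem_cons,
        List.not_mem_nil, or_false] at hl
      rcases hl with (rfl | rfl) | (rfl | rfl) <;> simp [neg]
    have hqnd : (letters qs).Nodup := by simp [letters, qs, neg]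
    obtain ⟨ps', hl, hnd', h'⟩ := ih (j + 1) (ps ++ qs) (by omega) (by omega) (by simp [hne])
      (by
        rw [letters, List.flatMap_append]
        refine List.nodup_append'.2 ⟨hnd, hqnd, fun l h₁ h₂ => ?_⟩
        exact absurd (hq l h₂).1 (hlt l h₁).1.ne)
      (by
        intro l hl
        rw [letters, List.flatMap_append] at hl
        rcases List.mem_append.1 hl with h | h
        · exact ⟨(hlt l h).1.trans (Nat.lt_succ_self j), (hlt l h).2⟩
        · exact ⟨(hq l h).1.trans_lt (Nat.lt_succ_self j), (hq l h).2⟩)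
    refine ⟨ps', by rw [hl]; simp [qs]; omega, hnd', SameSurface.trans ?_ h'⟩
    rw [List.range'_succ, List.flatMap_cons, hk]
    set rest := (List.range' (j + 1) m).flatMap fun i => closedCopy i ((i + 1) % k)
    -- The letters of a later copy have its own, larger index, or the index of the copy after it,
    -- which is larger still or wraps to 0.
    have hrest : ∀ w ∈ rest, ∀ x ∈ w, x.1.1 ≠ j := by
      intro w hw x hx
      obtain ⟨i, hi, hw⟩ := List.mem_flatMap.1 hw
      rw [List.mem_range'_1] at hi
      rcases mem_closedCopy hw hx with h | h
      · omega
      · rw [h]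
        show (i + 1) % k ≠ j
        rcases eq_or_ne (i + 1) k with h | h
        · rw [h, Nat.mod_self]; omega
        · rw [Nat.mod_eq_of_lt (by omega)]; omega
    refine SameSurface.trans (of_perm (List.perm_append_comm_assoc
      [pos (0, 6) :: (ps.flatMap commWord ++ [neg (j, 6)])] (closedCopy j ((j + 1) % k)) rest)) ?_
    refine (closedCopy_reduce j ((j + 1) % k) ?_).trans ?_
    · intro c hc w hw x hx h
      rcases List.mem_append.1 hw with hw | hw
      · obtain rfl := List.mem_singleton.1 hw
        rcases List.mem_cons.1 hx with rfl | hx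
        · exact hc (congrArg Prod.snd h).symm
        · rcases List.mem_append.1 hx with hx | hx
          · have := (hlt _ (mem_letters_of_mem_flatMap_commWord hx)).1
            rw [h] at this
            exact lt_irrefl _ this
          · rw [List.mem_singleton.1 hx] at h
            exact hc (congrArg Prod.snd h).symm
      · exact hrest w hw x hx (by rw [h])
    refine (of_perm (List.Perm.swap _ _ _)).trans ?_
    refine SameSurface.trans (rotate (pos (0, 6) :: ps.flatMap commWord) [neg (j, 6)] _) ?_
    refine (merge (X := pos (0, 6) :: ps.flatMap commWord)
      (Y := qs.flatMap commWord ++ [neg ((j + 1) % k, 6)]) (by simp) (by simp) (neg (j, 6)) ?_).trans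
      ?_
    · simp only [List.forall_mem_cons, List.forall_mem_append, List.not_mem_nil, false_imp_iff,
        implies_true, and_true]
      refine ⟨⟨?_, ?_⟩, ⟨?_, ?_⟩, fun w hw x hx h => hrest w hw x hx (by rw [h]; rfl)⟩
      · exact fun h => absurd (congrArg Prod.fst h) (by simp only [pos, neg]; omega)
      · exact fun x hx h => (hlt _ (mem_letters_of_mem_flatMap_commWord hx)).2 (by rw [h]; rfl)
      · exact fun x hx h => (hq _ (mem_letters_of_mem_flatMap_commWord hx)).2 (by rw [h]; rfl)
      · exact fun h => hk' (congrArg Prod.fst h)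
    · rw [List.flatMap_append, List.cons_append, List.append_assoc]
      exact refl _

/-- A cyclic chain of `k` copies without links has genus `2 k`. -/
theorem exists_closedCopies {k : ℕ} (hk : 2 ≤ k) :
    ∃ ps : List (((ℕ × ℕ) × Bool) × ((ℕ × ℕ) × Bool)), ps.length = 2 * k ∧
      (letters ps).Nodup ∧
      SameSurface ((List.range k).flatMap fun i => closedCopy i ((i + 1) % k))
        [ps.flatMap commWord] := by
  obtain ⟨ps, hl, hnd, h⟩ := exists_chain_reduce k (k - 1) 1
    [(neg (0, 3), neg (0, 1)), (neg (0, 9), neg (0, 5))] (by omega) le_rfl (by simp)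
    (by simp [letters, neg])
    (by
      intro l hl
      simp only [letters, List.flatMap_cons, List.flatMap_nil, List.mem_append, List.mem_cons,
        List.not_mem_nil, or_false] at hl
      rcases hl with (rfl | rfl) | (rfl | rfl) <;> simp [neg])
  refine ⟨ps, by rw [hl]; simp; omega, hnd, SameSurface.trans ?_ h⟩
  have hr : List.range k = 0 :: List.range' 1 (k - 1) := by
    obtain ⟨k, rfl⟩ : ∃ m, k = m + 1 := ⟨k - 1, by omega⟩
    rw [List.range_eq_range', List.range'_succ, Nat.add_sub_cancel]
  rw [hr, List.flatMap_cons]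
  refine closedCopy_reduce 0 _ fun c hc w hw x hx h => ?_
  obtain ⟨i, hi, hw⟩ := List.mem_flatMap.1 hw
  rw [List.mem_range'_1] at hi
  rcases mem_closedCopy hw hx with h' | h'
  · rw [h] at h'
    simp only at h'
    omega
  · rw [h] at h'
    exact hc (congrArg Prod.snd h')

/-- A cyclic chain of `k` copies, the first two of which are linked, has genus `2 k + 1`. -/
theorem exists_linkedCopies {k : ℕ} (hk : 2 ≤ k) :
    ∃ ps : List (((ℕ × ℕ) × Bool) × ((ℕ × ℕ) × Bool)), ps.length = 2 * k + 1 ∧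
      (letters ps).Nodup ∧
      SameSurface (linkedCopies (2 % k) ++
        (List.range' 2 (k - 2)).flatMap fun i => closedCopy i ((i + 1) % k))
        [ps.flatMap commWord] := by
  obtain ⟨ps, hl, hnd, h⟩ := exists_chain_reduce k (k - 2) 2
    [(neg (0, 3), neg (0, 1)), (neg (0, 9), pos (1, 3)),
        (pos (0, 5), neg (1, 4)), (neg (1, 9), neg (1, 2)), (pos (1, 5), neg (1, 1))]
    (by omega) (by omega) (by simp)
    (by simp [letters, neg, pos])
    (by
      intro l hl
      simp only [letters, List.flatMap_cons, List.flatMap_nil, List.mem_append, List.mem_cons,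
        List.not_mem_nil, or_false] at hl
      rcases hl with (rfl | rfl) | (rfl | rfl) | (rfl | rfl) | (rfl | rfl) | (rfl | rfl) <;>
        simp [neg, pos])
  refine ⟨ps, by rw [hl]; simp; omega, hnd, SameSurface.trans ?_ h⟩
  -- The later copies touch the linked ones only where the last copy returns to copy 0.
  have key : ∀ w ∈ (List.range' 2 (k - 2)).flatMap fun i => closedCopy i ((i + 1) % k),
      ∀ x ∈ w, x.1.1 < 2 → x.1 = (0, 6) := by
    intro w hw x hx h
    obtain ⟨i, hi, hw⟩ := List.mem_flatMap.1 hw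
    rw [List.mem_range'_1] at hi
    rcases mem_closedCopy hw hx with h' | h'
    · omega
    · rw [h'] at h ⊢
      rcases eq_or_ne (i + 1) k with hik | hik
      · rw [hik, Nat.mod_self]
      · rw [Nat.mod_eq_of_lt (by omega)] at h
        simp only at h
        omega
  refine linkedCopies_reduce _ ?_ ⟨?_, ?_⟩
  · intro i c hi hc w hw x hx h
    have := key w hw x hx (by rw [h]; exact hi)
    rw [h] at this
    exact hc (congrArg Prod.snd this)
  · rcases eq_or_ne k 2 with rfl | h
    · decide
    · rw [Nat.mod_eq_of_lt (by omega)]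
      decide
  · intro w hw x hx h
    have := key w hw x hx (by rw [h]; decide)
    rw [h] at this
    exact absurd this (by decide)

end SameSurface

/-! ### Squares as polygons -/

/-- The map from the disc to the square which carries the quarters of the unit circle, starting with
`[0, 1 / 4]`, to the bottom, right, top and left sides. -/
def squareMap (z : ℂ) : ℝ × ℝ :=
  ((1 - ‖z‖ / (|z.re| + |z.im|) * z.re + ‖z‖ / (|z.re| + |z.im|) * z.im) / 2,
    (1 - ‖z‖ / (|z.re| + |z.im|) * z.re - ‖z‖ / (|z.re| + |z.im|) * z.im) / 2)

theorem abs_re_add_abs_im_pos {z : ℂ} (hz : z ≠ 0) : 0 < |z.re| + |z.im| :=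
  (norm_pos_iff.2 hz).trans_le (Complex.norm_le_abs_re_add_abs_im z)

/-- The quotient of the Euclidean norm by the ℓ¹ norm has no limit at the origin, but it is bounded
by one, and `f` vanishes there. -/
theorem continuous_norm_div_mul {f : ℂ → ℝ} (hf : Continuous f) (hf' : ∀ z, |f z| ≤ ‖z‖) :
    Continuous fun z : ℂ => ‖z‖ / (|z.re| + |z.im|) * f z := by
  rw [continuous_iff_continuousAt]
  intro z
  rcases eq_or_ne z 0 with rfl | hz
  · have h0 : f 0 = 0 := abs_nonpos_iff.1 (by simpa using hf' 0)
    rw [ContinuousAt, h0, mul_zero]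
    refine squeeze_zero_norm (a := fun z : ℂ => ‖z‖) (fun z => ?_) ?_
    · rw [norm_mul, Real.norm_eq_abs, Real.norm_eq_abs, abs_of_nonneg (by positivity)]
      have h1 : ‖z‖ / (|z.re| + |z.im|) ≤ 1 :=
        div_le_one_of_le₀ (Complex.norm_le_abs_re_add_abs_im z) (by positivity)
      calc _ ≤ 1 * |f z| := mul_le_mul_of_nonneg_right h1 (abs_nonneg _)
        _ ≤ ‖z‖ := by rw [one_mul]; exact hf' z
    · simpa using (continuous_norm (E := ℂ)).tendsto 0
  · have := (abs_re_add_abs_im_pos hz).ne'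
    have h1 : ContinuousAt (fun z : ℂ => |z.re| + |z.im|) z := by fun_prop
    exact ((continuous_norm.continuousAt).div h1 this).mul hf.continuousAt

theorem continuous_squareMap : Continuous squareMap := by
  have h1 := continuous_norm_div_mul Complex.continuous_re Complex.abs_re_le_norm
  have h2 := continuous_norm_div_mul Complex.continuous_im Complex.abs_im_le_norm
  exact Continuous.prodMk (by fun_prop) (by fun_prop)

/-- Up to an affine map, `squareMap` rescales z along its ray so that the ℓ¹ norm of the image is
the Euclidean norm of z. The image therefore determines both the norm and the ray. -/
theorem squareMap_injective : Function.Injective squareMap := by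
  intro z w h
  have h1 := congrArg Prod.fst h
  have h2 := congrArg Prod.snd h
  simp only [squareMap] at h1 h2
  set c := ‖z‖ / (|z.re| + |z.im|) with hc
  set d := ‖w‖ / (|w.re| + |w.im|) with hd
  have hre : c * z.re = d * w.re := by linarith
  have him : c * z.im = d * w.im := by linarith
  have hc0 : 0 ≤ c := by positivity
  have hd0 : 0 ≤ d := by positivity
  have key : ∀ u : ℂ, ‖u‖ / (|u.re| + |u.im|) * (|u.re| + |u.im|) = ‖u‖ := by
    intro u
    rcases eq_or_ne u 0 with rfl | hu
    · simp
    · exact div_mul_cancel₀ _ (abs_re_add_abs_im_pos hu).ne'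
  have hn : ‖z‖ = ‖w‖ := by
    have h3 : ∀ {r : ℝ}, 0 ≤ r → ∀ a, r * |a| = |r * a| := fun hr a => by
      rw [abs_mul, abs_of_nonneg hr]
    rw [← key z, ← key w, ← hc, ← hd, mul_add, mul_add, h3 hc0, h3 hc0, h3 hd0, h3 hd0, hre, him]
  rcases eq_or_ne z 0 with rfl | hz
  · rw [norm_zero] at hn
    exact (norm_eq_zero.1 hn.symm).symm
  · have hw : w ≠ 0 := by
      rintro rfl
      exact hz (norm_eq_zero.1 (by simpa using hn))
    have hcp : 0 < c := div_pos (norm_pos_iff.2 hz) (abs_re_add_abs_im_pos hz)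
    have hdp : 0 < d := div_pos (norm_pos_iff.2 hw) (abs_re_add_abs_im_pos hw)
    have hzw : (c : ℂ) * z = d * w := Complex.ext (by simpa using hre) (by simpa using him)
    have hcd : c = d := by
      have := congrArg norm hzw
      rw [norm_mul, norm_mul, Complex.norm_real, Complex.norm_real, Real.norm_of_nonneg hc0,
        Real.norm_of_nonneg hd0, hn] at this
      exact mul_right_cancel₀ (norm_pos_iff.2 hw).ne' this
    rw [← hcd] at hzw
    exact mul_left_cancel₀ (by exact_mod_cast hcp.ne') hzw

theorem squareMap_mem {z : ℂ} (hz : ‖z‖ ≤ 1) :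
    squareMap z ∈ Icc (0 : ℝ) 1 ×ˢ Icc (0 : ℝ) 1 := by
  have key : |‖z‖ / (|z.re| + |z.im|) * z.re| + |‖z‖ / (|z.re| + |z.im|) * z.im| ≤ 1 := by
    rw [abs_mul, abs_mul, ← mul_add, abs_of_nonneg (by positivity)]
    rcases eq_or_ne z 0 with rfl | hu
    · simp
    · rwa [div_mul_cancel₀ _ (abs_re_add_abs_im_pos hu).ne']
  simp only [squareMap, mem_prod, mem_Icc]
  have h1 := abs_le.1 (le_refl |‖z‖ / (|z.re| + |z.im|) * z.re|)
  have h2 := abs_le.1 (le_refl |‖z‖ / (|z.re| + |z.im|) * z.im|)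
  refine ⟨⟨?_, ?_⟩, ?_, ?_⟩ <;> linarith [h1.1, h1.2, h2.1, h2.2]

theorem exists_squareMap_eq {p : ℝ × ℝ} (hp : p ∈ Icc (0 : ℝ) 1 ×ˢ Icc (0 : ℝ) 1) :
    ∃ z : ℂ, ‖z‖ ≤ 1 ∧ squareMap z = p := by
  obtain ⟨⟨h1, h2⟩, h3, h4⟩ := hp
  -- The inverse of the affine map from the ℓ¹ unit ball to the square.
  set w : ℂ := ⟨1 - p.1 - p.2, p.1 - p.2⟩ with hw
  have hN : |w.re| + |w.im| ≤ 1 := by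
    simp only [hw]
    rcases abs_cases (1 - p.1 - p.2) with ⟨h, -⟩ | ⟨h, -⟩ <;>
      rcases abs_cases (p.1 - p.2) with ⟨h', -⟩ | ⟨h', -⟩ <;> rw [h, h'] <;> linarith
  rcases eq_or_ne w 0 with h0 | h0
  · refine ⟨0, by simp, ?_⟩
    have hr : w.re = 0 := by rw [h0]; rfl
    have hi : w.im = 0 := by rw [h0]; rfl
    simp only [hw] at hr hi
    simp only [squareMap, norm_zero, zero_div, zero_mul]
    ext <;> simp <;> linarith
  · have hNp := abs_re_add_abs_im_pos h0
    have hnp := norm_pos_iff.2 h0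
    -- The reciprocal of the radial scaling factor, which is constant on rays.
    set r := (|w.re| + |w.im|) / ‖w‖ with hr
    have hrp : 0 < r := div_pos hNp hnp
    refine ⟨r * w, ?_, ?_⟩
    · rw [norm_mul, Complex.norm_real, Real.norm_of_nonneg hrp.le, hr, div_mul_cancel₀ _ hnp.ne']
      exact hN
    · have h5 : ‖(r : ℂ) * w‖ / (|((r : ℂ) * w).re| + |((r : ℂ) * w).im|) = ‖w‖ / (|w.re| + |w.im|) := by
        rw [norm_mul, Complex.norm_real, Real.norm_of_nonneg hrp.le, Complex.re_ofReal_mul,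
          Complex.im_ofReal_mul, abs_mul, abs_mul, abs_of_pos hrp, ← mul_add,
          mul_div_mul_left _ _ hrp.ne']
      have h6 : ‖w‖ / (|w.re| + |w.im|) * r = 1 := by
        rw [hr]; field_simp
      simp only [squareMap, h5]
      rw [Complex.re_ofReal_mul, Complex.im_ofReal_mul, ← mul_assoc, ← mul_assoc, h6]
      ext <;> simp [hw] <;> ring

/-- The disc is a square, with the same parametrisation of all four sides. -/
theorem exists_discSquare : ∃ (e : Disc → unitInterval × unitInterval) (τ : unitInterval → unitInterval),
    Continuous e ∧ Function.Bijective e ∧ Function.Surjective τ ∧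
    (∀ t, e (arc 0 (1 / 4) t) = (τ t, 0)) ∧ (∀ t, e (arc (1 / 4) (1 / 2) t) = (1, τ t)) ∧
    (∀ t, e (arc (3 / 4) (1 / 2) t) = (τ t, 1)) ∧ (∀ t, e (arc 1 (3 / 4) t) = (0, τ t)) := by
  have hz : ∀ z : Disc, ‖(z : ℂ)‖ ≤ 1 := fun z => mem_closedBall_zero_iff.1 z.2
  let e : Disc → unitInterval × unitInterval := fun z =>
    (⟨(squareMap z).1, (squareMap_mem (hz z)).1⟩, ⟨(squareMap z).2, (squareMap_mem (hz z)).2⟩)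
  have hc : Continuous fun z : Disc => squareMap z := continuous_squareMap.comp continuous_subtype_val
  -- The fraction of a side of the square reached after the fraction t of a quarter circle. Quarter
  -- turns and reflections make it the same for all four sides with the chosen directions.
  let f : ℝ → ℝ := fun t => Real.sin (Real.pi / 2 * t) /
    (Real.cos (Real.pi / 2 * t) + Real.sin (Real.pi / 2 * t))
  have hs : ∀ t : unitInterval, 0 ≤ Real.sin (Real.pi / 2 * t) := fun t =>
    Real.sin_nonneg_of_nonneg_of_le_pi (mul_nonneg (by positivity) t.2.1)
      (by nlinarith [Real.pi_pos, t.2.2, t.2.1])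
  have hcs : ∀ t : unitInterval, 0 ≤ Real.cos (Real.pi / 2 * t) := fun t =>
    Real.cos_nonneg_of_mem_Icc ⟨by nlinarith [Real.pi_pos, t.2.2, t.2.1],
      by nlinarith [Real.pi_pos, t.2.2, t.2.1]⟩
  have hp : ∀ t : unitInterval, 0 < Real.cos (Real.pi / 2 * t) + Real.sin (Real.pi / 2 * t) := by
    intro t
    refine lt_of_le_of_ne (add_nonneg (hcs t) (hs t)) fun h => ?_
    have := Real.sin_sq_add_cos_sq (Real.pi / 2 * t)
    have h1 : Real.cos (Real.pi / 2 * t) = 0 := by linarith [hs t, hcs t]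
    have h2 : Real.sin (Real.pi / 2 * t) = 0 := by linarith [hs t, hcs t]
    rw [h1, h2] at this
    norm_num at this
  let τ : unitInterval → unitInterval := fun t => ⟨f t, div_nonneg (hs t) (hp t).le,
    div_le_one_of_le₀ (by linarith [hcs t]) (hp t).le⟩
  have hang : ∀ x : ℝ, squareMap (ang x) = ((1 - Real.cos (2 * Real.pi * x) /
      (|Real.cos (2 * Real.pi * x)| + |Real.sin (2 * Real.pi * x)|) + Real.sin (2 * Real.pi * x) /
      (|Real.cos (2 * Real.pi * x)| + |Real.sin (2 * Real.pi * x)|)) / 2,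
      (1 - Real.cos (2 * Real.pi * x) /
      (|Real.cos (2 * Real.pi * x)| + |Real.sin (2 * Real.pi * x)|) - Real.sin (2 * Real.pi * x) /
      (|Real.cos (2 * Real.pi * x)| + |Real.sin (2 * Real.pi * x)|)) / 2) := by
    intro x
    simp only [squareMap, norm_ang]
    rw [coe_ang]
    ext <;> simp only <;> ring
  have key : ∀ t : unitInterval, Real.cos (Real.pi / 2 * t) /
      (Real.cos (Real.pi / 2 * t) + Real.sin (Real.pi / 2 * t)) = 1 - f t := fun t => by
    rw [eq_sub_iff_add_eq, ← add_div, div_self (hp t).ne']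
  refine ⟨e, τ, Continuous.prodMk ?_ ?_, ⟨?_, ?_⟩, ?_, ?_, ?_, ?_, ?_⟩
  · exact Continuous.subtype_mk (continuous_fst.comp hc) _
  · exact Continuous.subtype_mk (continuous_snd.comp hc) _
  · intro z w h
    refine Subtype.ext (squareMap_injective (Prod.ext ?_ ?_))
    · exact congrArg (fun p => (p.1 : ℝ)) h
    · exact congrArg (fun p => (p.2 : ℝ)) h
  · rintro ⟨a, b⟩
    obtain ⟨z, hz, h⟩ := exists_squareMap_eq (p := (a, b)) ⟨a.2, b.2⟩
    refine ⟨⟨z, by simpa using hz⟩, Prod.ext (Subtype.ext ?_) (Subtype.ext ?_)⟩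
    · exact congrArg Prod.fst h
    · exact congrArg Prod.snd h
  · intro u
    have hcf : ContinuousOn f (Icc 0 1) := by
      refine ContinuousOn.div (by fun_prop) (by fun_prop) fun t ht => (hp ⟨t, ht⟩).ne'
    obtain ⟨t, ht, h⟩ := intermediate_value_Icc zero_le_one hcf (show (u : ℝ) ∈ _ by
      simp [f])
    exact ⟨⟨t, ht⟩, Subtype.ext h⟩
  · intro t
    have h := hang (0 + t * (1 / 4 - 0))
    rw [show 2 * Real.pi * (0 + (t : ℝ) * (1 / 4 - 0)) = Real.pi / 2 * t by ring,
      abs_of_nonneg (hs t), abs_of_nonneg (hcs t)] at h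
    refine Prod.ext (Subtype.ext ?_) (Subtype.ext ?_)
    · refine (congrArg Prod.fst h).trans ?_
      simp only [τ]
      linarith [key t, show f t = Real.sin (Real.pi / 2 * t) /
        (Real.cos (Real.pi / 2 * t) + Real.sin (Real.pi / 2 * t)) from rfl]
    · refine (congrArg Prod.snd h).trans ?_
      simp only [Set.Icc.coe_zero]
      linarith [key t, show f t = Real.sin (Real.pi / 2 * t) /
        (Real.cos (Real.pi / 2 * t) + Real.sin (Real.pi / 2 * t)) from rfl]
  · intro t
    have h := hang (1 / 4 + t * (1 / 2 - 1 / 4))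
    rw [show 2 * Real.pi * (1 / 4 + (t : ℝ) * (1 / 2 - 1 / 4)) = Real.pi / 2 * t + Real.pi / 2 by
      ring, Real.cos_add_pi_div_two, Real.sin_add_pi_div_two, abs_neg,
      abs_of_nonneg (hs t), abs_of_nonneg (hcs t), add_comm (Real.sin _) (Real.cos _)] at h
    refine Prod.ext (Subtype.ext ?_) (Subtype.ext ?_)
    · refine (congrArg Prod.fst h).trans ?_
      simp only [neg_div, Set.Icc.coe_one]
      linarith [key t, show f t = Real.sin (Real.pi / 2 * t) /
        (Real.cos (Real.pi / 2 * t) + Real.sin (Real.pi / 2 * t)) from rfl]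
    · refine (congrArg Prod.snd h).trans ?_
      simp only [neg_div, τ]
      linarith [key t, show f t = Real.sin (Real.pi / 2 * t) /
        (Real.cos (Real.pi / 2 * t) + Real.sin (Real.pi / 2 * t)) from rfl]
  · intro t
    have h := hang (3 / 4 + t * (1 / 2 - 3 / 4))
    rw [show 2 * Real.pi * (3 / 4 + (t : ℝ) * (1 / 2 - 3 / 4)) =
      Real.pi / 2 - Real.pi / 2 * t + Real.pi by ring, Real.cos_add_pi, Real.sin_add_pi,
      Real.cos_pi_div_two_sub, Real.sin_pi_div_two_sub, abs_neg, abs_neg,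
      abs_of_nonneg (hs t), abs_of_nonneg (hcs t), add_comm (Real.sin _) (Real.cos _)] at h
    refine Prod.ext (Subtype.ext ?_) (Subtype.ext ?_)
    · refine (congrArg Prod.fst h).trans ?_
      simp only [neg_div, τ]
      linarith [key t, show f t = Real.sin (Real.pi / 2 * t) /
        (Real.cos (Real.pi / 2 * t) + Real.sin (Real.pi / 2 * t)) from rfl]
    · refine (congrArg Prod.snd h).trans ?_
      simp only [neg_div, Set.Icc.coe_one]
      linarith [key t, show f t = Real.sin (Real.pi / 2 * t) /
        (Real.cos (Real.pi / 2 * t) + Real.sin (Real.pi / 2 * t)) from rfl]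
  · intro t
    have h := hang (1 + t * (3 / 4 - 1))
    rw [show 2 * Real.pi * (1 + (t : ℝ) * (3 / 4 - 1)) =
      2 * Real.pi - Real.pi / 2 * t by ring, Real.cos_two_pi_sub, Real.sin_two_pi_sub, abs_neg,
      abs_of_nonneg (hs t), abs_of_nonneg (hcs t)] at h
    refine Prod.ext (Subtype.ext ?_) (Subtype.ext ?_)
    · refine (congrArg Prod.fst h).trans ?_
      simp only [neg_div, Set.Icc.coe_zero]
      linarith [key t, show f t = Real.sin (Real.pi / 2 * t) /
        (Real.cos (Real.pi / 2 * t) + Real.sin (Real.pi / 2 * t)) from rfl]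
    · refine (congrArg Prod.snd h).trans ?_
      simp only [neg_div, τ]
      linarith [key t, show f t = Real.sin (Real.pi / 2 * t) /
        (Real.cos (Real.pi / 2 * t) + Real.sin (Real.pi / 2 * t)) from rfl]

section

/-! ### Square-tiled surfaces with slits -/

/-- Gluing unit squares: the top side is glued to the bottom side of the square given by `τ`, the
right side is glued to the left side of the square given by `σ'` along the slit `[2 / 5, 3 / 5]`,
and of the square given by `σ` elsewhere. -/
inductive SquareRel {Sh : Type*} (τ σ σ' : Equiv.Perm Sh) :
    Sh × unitInterval × unitInterval → Sh × unitInterval × unitInterval → Prop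
  | right (s : Sh) (y : unitInterval) (hy : (y : ℝ) ≤ 2 / 5 ∨ 3 / 5 ≤ (y : ℝ)) :
      SquareRel τ σ σ' (s, 1, y) (σ s, 0, y)
  | slit (s : Sh) (y : unitInterval) (hy : 2 / 5 ≤ (y : ℝ)) (hy' : (y : ℝ) ≤ 3 / 5) :
      SquareRel τ σ σ' (s, 1, y) (σ' s, 0, y)
  | top (s : Sh) (x : unitInterval) : SquareRel τ σ σ' (s, x, 1) (τ s, x, 0)

/-- The surface obtained by gluing squares. -/
abbrev SquareSurface {Sh : Type*} (τ σ σ' : Equiv.Perm Sh) : Type _ := Quot (SquareRel τ σ σ')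

/-- The three horizontal strips of the square. -/
def strip : Fin 3 → unitInterval → unitInterval
  | 0, y => ⟨2 / 5 * y, by linarith [y.2.1], by linarith [y.2.2]⟩
  | 1, y => ⟨2 / 5 + 1 / 5 * y, by linarith [y.2.1], by linarith [y.2.2]⟩
  | 2, y => ⟨3 / 5 + 2 / 5 * y, by linarith [y.2.1], by linarith [y.2.2]⟩

theorem continuous_strip (v : Fin 3) : Continuous (strip v) := by
  fin_cases v <;> exact Continuous.subtype_mk (by fun_prop) _

theorem strip_injective (v : Fin 3) : Function.Injective (strip v) := by
  intro y y' h
  have h' := congrArg Subtype.val h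
  fin_cases v <;> (simp only [strip] at h'; exact Subtype.ext (by linarith))

theorem exists_strip_zero {y : unitInterval} (hy : (y : ℝ) ≤ 2 / 5) : ∃ u, strip 0 u = y :=
  ⟨⟨5 / 2 * y, by linarith [y.2.1], by linarith⟩, Subtype.ext (by simp only [strip]; ring)⟩

theorem exists_strip_one {y : unitInterval} (hy : 2 / 5 ≤ (y : ℝ)) (hy' : (y : ℝ) ≤ 3 / 5) :
    ∃ u, strip 1 u = y :=
  ⟨⟨5 * y - 2, by linarith, by linarith⟩, Subtype.ext (by simp only [strip]; ring)⟩

theorem exists_strip_two {y : unitInterval} (hy : 3 / 5 ≤ (y : ℝ)) : ∃ u, strip 2 u = y :=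
  ⟨⟨5 / 2 * y - 3 / 2, by linarith, by linarith [y.2.2]⟩,
    Subtype.ext (by simp only [strip]; ring)⟩

theorem strip_zero_one : strip 0 1 = strip 1 0 := Subtype.ext (by simp [strip])

theorem strip_one_one : strip 1 1 = strip 2 0 := Subtype.ext (by simp [strip]; norm_num)

theorem strip_two_one : strip 2 1 = 1 := Subtype.ext (by simp [strip]; norm_num)

theorem strip_zero_zero : strip 0 0 = 0 := Subtype.ext (by simp [strip])

theorem polygon_quad {L : Type*} (a b c d l : L) (u v : ℝ) :
    polygon [pos a, pos b, neg c, neg d] l u v ↔ (l = a ∧ u = 0 ∧ v = 1 / 4) ∨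
      (l = b ∧ u = 1 / 4 ∧ v = 1 / 2) ∨ (l = c ∧ u = 3 / 4 ∧ v = 1 / 2) ∨
      (l = d ∧ u = 1 ∧ v = 3 / 4) := by
  constructor
  · rintro ⟨j, b, h, rfl, rfl⟩
    have hj : j < 4 := (List.getElem?_eq_some_iff.1 h).1
    interval_cases j <;> simp only [List.getElem?_cons_zero, List.getElem?_cons_succ, pos, neg,
      Option.some.injEq, Prod.mk.injEq] at h <;> obtain ⟨rfl, rfl⟩ := h <;> norm_num
  · rintro (⟨rfl, rfl, rfl⟩ | ⟨rfl, rfl, rfl⟩ | ⟨rfl, rfl, rfl⟩ | ⟨rfl, rfl, rfl⟩)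
    · exact ⟨0, true, rfl, by norm_num, by norm_num⟩
    · exact ⟨1, true, rfl, by norm_num, by norm_num⟩
    · exact ⟨2, false, rfl, by norm_num, by norm_num⟩
    · exact ⟨3, false, rfl, by norm_num, by norm_num⟩

section Tiles

variable {Sh L : Type*} (f : Sh × Fin 3 × Bool → L) (τ σ σ' : Equiv.Perm Sh)

/-- The boundary words of the strips of the squares; the letters are `f (s, v, true)` for the left
side and `f (s, v, false)` for the bottom side of the strip `v` of the square `s`. -/
def tileWord : Sh × Fin 3 → List (L × Bool)
  | (s, 0) => [pos (f (s, 0, false)), pos (f (σ s, 0, true)), neg (f (s, 1, false)),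
      neg (f (s, 0, true))]
  | (s, 1) => [pos (f (s, 1, false)), pos (f (σ' s, 1, true)), neg (f (s, 2, false)),
      neg (f (s, 1, true))]
  | (s, 2) => [pos (f (s, 2, false)), pos (f (σ s, 2, true)), neg (f (τ s, 0, false)),
      neg (f (s, 2, true))]

variable {f}

/-- Each disc is mapped onto a strip of its square. This already identifies the common sides of
neighbouring strips, which carry the bottom letter of the upper strip; the other letters reproduce
the gluing of the squares. Injectivity of `f` prevents further coincidences of letters. -/
theorem nonempty_tiles_homeomorph [Finite Sh] [TopologicalSpace Sh] [DiscreteTopology Sh]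
    (hf : Function.Injective f) :
    Nonempty (DiscSurface (fun i => polygon (tileWord f τ σ σ' i)) ≃ₜ SquareSurface τ σ σ') := by
  obtain ⟨e, ρ, he, heb, hρ, h0, h1, h2, h3⟩ := exists_discSquare
  let μ : (Sh × Fin 3) × Disc → Sh × unitInterval × unitInterval := fun p =>
    (p.1.1, (e p.2).1, strip p.1.2 (e p.2).2)
  have hμc : Continuous μ := by
    rw [continuous_prod_of_discrete_left]
    rintro ⟨s, v⟩
    exact continuous_const.prodMk ((continuous_fst.comp he).prodMk
      ((continuous_strip v).comp (continuous_snd.comp he)))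
  have hμs : Function.Surjective μ := by
    rintro ⟨s, x, y⟩
    have : ∃ v u, strip v u = y := by
      rcases le_total (y : ℝ) (2 / 5) with h | h
      · exact ⟨0, exists_strip_zero h⟩
      rcases le_total (y : ℝ) (3 / 5) with h' | h'
      · exact ⟨1, exists_strip_one h h'⟩
      · exact ⟨2, exists_strip_two h'⟩
    obtain ⟨v, u, rfl⟩ := this
    obtain ⟨z, hz⟩ := heb.2 (x, u)
    exact ⟨((s, v), z), by simp [μ, hz]⟩
  have hμ : IsQuotientMap μ := hμc.isClosedMap.isQuotientMap hμc hμs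
  let R := SquareRel τ σ σ'
  let m := fun i => polygon (tileWord f τ σ σ' i)
  -- The left or bottom side named by a letter, in the glued surface. Every arc with that letter is
  -- shown to have this image, whichever tile it bounds.
  let P : Sh × Fin 3 × Bool → unitInterval → Quot R := fun q t =>
    if q.2.2 then Quot.mk R (q.1, 0, strip q.2.1 (ρ t)) else Quot.mk R (q.1, ρ t, strip q.2.1 0)
  have hP : ∀ i l u v, m i l u v → ∃ q, l = f q ∧ ∀ t, Quot.mk R (μ (i, arc u v t)) = P q t := by
    rintro ⟨s, w⟩ l u v h
    fin_cases w <;> rcases (polygon_quad _ _ _ _ _ _ _).1 h with ⟨rfl, rfl, rfl⟩ |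
      ⟨rfl, rfl, rfl⟩ | ⟨rfl, rfl, rfl⟩ | ⟨rfl, rfl, rfl⟩ <;> refine ⟨_, rfl, fun t => ?_⟩ <;>
      simp only [μ, h0, h1, h2, h3, P, Bool.false_eq_true, if_true, if_false]
    · rfl
    · refine Quot.sound (.right _ _ (Or.inl ?_))
      show 2 / 5 * (ρ t : ℝ) ≤ 2 / 5
      linarith [(ρ t).2.2]
    · exact congrArg (fun y => Quot.mk R (s, ρ t, y)) strip_zero_one
    · rfl
    · rfl
    · refine Quot.sound (.slit _ _ ?_ ?_)
      · show 2 / 5 ≤ 2 / 5 + 1 / 5 * (ρ t : ℝ)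
        linarith [(ρ t).2.1]
      · show 2 / 5 + 1 / 5 * (ρ t : ℝ) ≤ 3 / 5
        linarith [(ρ t).2.2]
    · exact congrArg (fun y => Quot.mk R (s, ρ t, y)) strip_one_one
    · rfl
    · rfl
    · refine Quot.sound (.right _ _ (Or.inr ?_))
      show 3 / 5 ≤ 3 / 5 + 2 / 5 * (ρ t : ℝ)
      linarith [(ρ t).2.1]
    · refine Eq.trans ?_ ((Quot.sound (r := R) (.top s (ρ t))).trans ?_)
      · exact congrArg (fun y => Quot.mk R (s, ρ t, y)) strip_two_one
      · exact congrArg (fun y => Quot.mk R (τ s, ρ t, y)) strip_zero_zero.symm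
    · rfl
  have stackEq : ∀ s x v v', strip v 1 = strip v' 0 → ∀ z z', e z = (x, 1) → e z' = (x, 0) →
 ∀ l, m (s, v) l (3 / 4) (1 / 2) →
      m (s, v') l 0 (1 / 4) →
      Quot.mk (MarkRel (discMarks m)) ((s, v), z) = Quot.mk (MarkRel (discMarks m)) ((s, v'), z') := by
    intro s x v v' h z z' hz hz' l hl hl'
    obtain ⟨t, rfl⟩ := hρ x
    rw [heb.1 (hz.trans (h2 t).symm), heb.1 (hz'.trans (h0 t).symm)]
    exact discRel_of hl hl' t
  have m0 : ∀ s, m (s, 0) (f (s, 1, false)) (3 / 4) (1 / 2) := fun s =>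
    (polygon_quad _ _ _ _ _ _ _).2 (Or.inr (Or.inr (Or.inl ⟨rfl, rfl, rfl⟩)))
  have m0' : ∀ s v, m (s, v) (f (s, v, false)) 0 (1 / 4) := by
    intro s v
    fin_cases v <;> exact (polygon_quad _ _ _ _ _ _ _).2 (Or.inl ⟨rfl, rfl, rfl⟩)
  have m1 : ∀ s, m (s, 1) (f (s, 2, false)) (3 / 4) (1 / 2) := fun s =>
    (polygon_quad _ _ _ _ _ _ _).2 (Or.inr (Or.inr (Or.inl ⟨rfl, rfl, rfl⟩)))
  have m2 : ∀ s, m (s, 2) (f (τ s, 0, false)) (3 / 4) (1 / 2) := fun s =>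
    (polygon_quad _ _ _ _ _ _ _).2 (Or.inr (Or.inr (Or.inl ⟨rfl, rfl, rfl⟩)))
  have m3 : ∀ s v, m (s, v) (f (s, v, true)) 1 (3 / 4) := by
    intro s v
    fin_cases v <;> exact (polygon_quad _ _ _ _ _ _ _).2 (Or.inr (Or.inr (Or.inr ⟨rfl, rfl, rfl⟩)))
  have r0 : ∀ s, m (s, 0) (f (σ s, 0, true)) (1 / 4) (1 / 2) := fun s =>
    (polygon_quad _ _ _ _ _ _ _).2 (Or.inr (Or.inl ⟨rfl, rfl, rfl⟩))
  have r1 : ∀ s, m (s, 1) (f (σ' s, 1, true)) (1 / 4) (1 / 2) := fun s =>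
    (polygon_quad _ _ _ _ _ _ _).2 (Or.inr (Or.inl ⟨rfl, rfl, rfl⟩))
  have r2 : ∀ s, m (s, 2) (f (σ s, 2, true)) (1 / 4) (1 / 2) := fun s =>
    (polygon_quad _ _ _ _ _ _ _).2 (Or.inr (Or.inl ⟨rfl, rfl, rfl⟩))
  refine (nonempty_quot_homeomorph (R := MarkRel (discMarks m)) (R' := R) hμ ?_ ?_ ?_).nonempty
  · rintro _ _ ⟨⟨i, u, v, h, rfl⟩, ⟨i', u', v', h', rfl⟩, t⟩
    obtain ⟨q, hq, hq'⟩ := hP _ _ _ _ h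
    obtain ⟨r, hr, hr'⟩ := hP _ _ _ _ h'
    obtain rfl := hf (hq.symm.trans hr)
    exact (hq' t).trans (hr' t).symm
  -- Two strips of a square meet only if they are neighbours, the lower one at its top and the upper
  -- one at its bottom.
  · have key : ∀ s v v' z z', v ≤ v' → μ ((s, v), z) = μ ((s, v'), z') →
        Quot.mk (MarkRel (discMarks m)) ((s, v), z) =
          Quot.mk (MarkRel (discMarks m)) ((s, v'), z') := by
      intro s v v' z z' hv h
      simp only [μ, Prod.mk.injEq, true_and] at h
      obtain ⟨hx, hy⟩ := h
      rcases hv.eq_or_lt with rfl | hv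
      · rw [heb.1 (Prod.ext hx (strip_injective _ hy))]
      have hz := (e z).2.2
      have hz' := (e z').2.2
      have hy' := congrArg Subtype.val hy
      have ez : (e z).2 = 1 → e z = ((e z).1, 1) := fun h => Prod.ext rfl h
      have ez' : (e z').2 = 0 → e z' = ((e z).1, 0) := fun h => Prod.ext hx.symm h
      fin_cases v <;> fin_cases v' <;> simp only [Fin.mk_zero', Fin.mk_one, Fin.reduceFinMk,
        lt_irrefl, Fin.reduceLT, strip] at hv hy'
      · exact stackEq s (e z).1 0 1 strip_zero_one z z' (ez (Subtype.ext (by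
          simp only [Set.Icc.coe_one]; linarith [hz.2, hz'.1])))
          (ez' (Subtype.ext (by simp only [Set.Icc.coe_zero]; linarith [hz.2, hz'.1]))) _ (m0 s) (m0' s 1)
      · exfalso
        linarith [hz.2, hz'.1]
      · exact stackEq s (e z).1 1 2 strip_one_one z z' (ez (Subtype.ext (by
          simp only [Set.Icc.coe_one]; linarith [hz.2, hz'.1])))
          (ez' (Subtype.ext (by simp only [Set.Icc.coe_zero]; linarith [hz.2, hz'.1]))) _ (m1 s) (m0' s 2)
    rintro ⟨⟨s, v⟩, z⟩ ⟨⟨s', v'⟩, z'⟩ h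
    obtain rfl : s = s' := congrArg Prod.fst h
    rcases le_total v v' with hv | hv
    · exact key s v v' z z' hv h
    · exact (key s v' v z' z hv h.symm).symm
  · have right : ∀ (s s' : Sh) v (u : unitInterval) l, m (s, v) l (1 / 4) (1 / 2) →
        m (s', v) l 1 (3 / 4) →
        ∃ x y, μ x = (s, 1, strip v u) ∧ μ y = (s', 0, strip v u) ∧
          Quot.mk (MarkRel (discMarks m)) x = Quot.mk (MarkRel (discMarks m)) y := by
      intro s s' v u l hl hl'
      obtain ⟨t, rfl⟩ := hρ u
      exact ⟨_, _, by simp only [μ, h1], by simp only [μ, h3], discRel_of hl hl' t⟩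
    rintro _ _ (⟨s, y, hy | hy⟩ | ⟨s, y, hy, hy'⟩ | ⟨s, x⟩)
    · obtain ⟨u, rfl⟩ := exists_strip_zero hy
      exact right _ _ _ _ _ (r0 s) (m3 _ _)
    · obtain ⟨u, rfl⟩ := exists_strip_two hy
      exact right _ _ _ _ _ (r2 s) (m3 _ _)
    · obtain ⟨u, rfl⟩ := exists_strip_one hy hy'
      exact right _ _ _ _ _ (r1 s) (m3 _ _)
    · obtain ⟨t, rfl⟩ := hρ x
      exact ⟨_, _, by simp only [μ, h2, strip_two_one], by simp only [μ, h0, strip_zero_zero],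
        discRel_of (m2 s) (m0' _ _) t⟩

end Tiles

/-- A family of words may be listed in any order. -/
theorem nonempty_polygons_homeomorph {ι L : Type*} [TopologicalSpace ι] [DiscreteTopology ι]
    [DecidableEq ι] (m : ι → List (L × Bool)) {l : List ι} (hl : l.Nodup) (hl' : ∀ i, i ∈ l) :
    Nonempty (DiscSurface (polygons (l.map m)) ≃ₜ DiscSurface fun i => polygon (m i)) := by
  refine DiscSurface.reindex ((finCongr (by simp)).trans (hl.getEquivOfForallMemList l hl')) _ _
    fun i => ?_
  simp [polygons]

end

/-! ### The gluing instructions -/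

/-- Exchange the two sheets of every copy. -/
def otherSheet (k : ℕ) : Equiv.Perm (Fin k × Fin 2) :=
  (Equiv.refl _).prodCongr (Equiv.addRight 1)

theorem otherSheet_apply {k : ℕ} (x : Fin k × Fin 2) : otherSheet k x = (x.1, x.2 + 1) := rfl

theorem add_one_ne_self (e : Fin 2) : e + 1 ≠ e := by
  fin_cases e <;> decide

/-- The `n + 2` copies are chained cyclically along the lifts of `β`, and both slits of each copy
are glued to each other. -/
def closedGluing (n : ℕ) : Gluing where
  k := n + 2
  a := otherSheet (n + 2)
  a_ne x h := add_one_ne_self x.2 (congrArg Prod.snd h)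
  b := Equiv.addRight 1
  b_ne i h := by simp at h

/-- Transposing two slits with the same sheet number preserves sheet numbers, so composing with it
leaves `otherSheet` without fixed points. -/
theorem swap_snd {k : ℕ} (i j : Fin k) (e : Fin 2) (x : Fin k × Fin 2) :
    (Equiv.swap (i, e) (j, e) x).2 = x.2 := by
  rw [Equiv.swap_apply_def]
  split_ifs with h h' <;> simp_all

/-- The same as `closedGluing`, except that the four slits of the first two copies are glued
cyclically. -/
def linkedGluing (n : ℕ) : Gluing where
  k := n + 2
  a := (otherSheet (n + 2)).trans (Equiv.swap (0, 0) (1, 0))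
  a_ne x h := by
    have h' := congrArg Prod.snd h
    rw [Equiv.trans_apply, swap_snd] at h'
    exact add_one_ne_self x.2 h'
  b := Equiv.addRight 1
  b_ne i h := by simp at h

/-- The gluing of the top sides of the squares. -/
def Gluing.top (G : Gluing) : Equiv.Perm (Fin G.k × Fin 2) where
  -- Only the bottom of the first square is cut, as it is the chosen lift of β; the second square
  -- stays glued to itself.
  toFun x := (if x.2 = 0 then G.b x.1 else x.1, x.2)
  invFun x := (if x.2 = 0 then G.b.symm x.1 else x.1, x.2)
  left_inv x := by
    by_cases h : x.2 = 0 <;> simp [h, Prod.ext_iff]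
  right_inv x := by
    by_cases h : x.2 = 0 <;> simp [h, Prod.ext_iff]

/-- The gluing of the slits of the squares. -/
def Gluing.slit (G : Gluing) : Equiv.Perm (Fin G.k × Fin 2) := (otherSheet G.k).trans G.a

/-- The squares of the glued surface. -/
abbrev Gluing.Squares (G : Gluing) : Type := SquareSurface G.top (otherSheet G.k) G.slit

/-- The letters of the sides of the strips. -/
def tileLetter {k : ℕ} (q : (Fin k × Fin 2) × Fin 3 × Bool) : ℕ × ℕ :=
  (q.1.1, (if q.2.2 then 0 else 6) + 3 * (q.1.2 : ℕ) + (q.2.1 : ℕ))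

theorem tileLetter_injective {k : ℕ} : Function.Injective (tileLetter (k := k)) := by
  rintro ⟨⟨i, e⟩, v, b⟩ ⟨⟨i', e'⟩, v', b'⟩ h
  simp only [tileLetter, Prod.mk.injEq] at h
  obtain ⟨h1, h2⟩ := h
  obtain rfl := Fin.ext h1
  have := e.2; have := e'.2; have := v.2; have := v'.2
  cases b <;> cases b' <;> simp only [if_true, Bool.false_eq_true, if_false] at h2 <;>
    simp only [Prod.mk.injEq, true_and, Fin.ext_iff, and_true] <;> omega

/-- The tiles of one copy. -/
def copyTiles {k : ℕ} (i : Fin k) : List ((Fin k × Fin 2) × Fin 3) :=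
  [((i, 0), 0), ((i, 0), 1), ((i, 0), 2), ((i, 1), 0), ((i, 1), 1), ((i, 1), 2)]

theorem nodup_flatMap_copyTiles (k : ℕ) : ((List.finRange k).flatMap copyTiles).Nodup := by
  rw [List.nodup_flatMap]
  refine ⟨fun i _ => by simp [copyTiles], ?_⟩
  refine (List.nodup_finRange k).imp fun {i j} hij x hx hx' => hij ?_
  simp only [copyTiles, List.mem_cons, List.not_mem_nil, or_false] at hx hx'
  have h1 : x.1.1 = i := by rcases hx with rfl | rfl | rfl | rfl | rfl | rfl <;> rfl
  have h2 : x.1.1 = j := by rcases hx' with rfl | rfl | rfl | rfl | rfl | rfl <;> rfl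
  exact h1.symm.trans h2

theorem mem_flatMap_copyTiles {k : ℕ} (x : (Fin k × Fin 2) × Fin 3) :
    x ∈ (List.finRange k).flatMap copyTiles := by
  obtain ⟨⟨i, e⟩, v⟩ := x
  refine List.mem_flatMap.2 ⟨i, List.mem_finRange i, ?_⟩
  fin_cases e <;> fin_cases v <;> simp [copyTiles]

/-- The boundary words of the tiles of a copy. -/
def Gluing.copyWords (G : Gluing) (i : Fin G.k) : List (List ((ℕ × ℕ) × Bool)) :=
  (copyTiles i).map (tileWord tileLetter G.top (otherSheet G.k) G.slit)

theorem Gluing.nonempty_squares_homeomorph (G : Gluing) :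
    Nonempty (DiscSurface (polygons ((List.finRange G.k).flatMap G.copyWords)) ≃ₜ G.Squares) := by
  obtain ⟨e₁⟩ := nonempty_tiles_homeomorph G.top (otherSheet G.k) G.slit
    (tileLetter_injective (k := G.k))
  obtain ⟨e₂⟩ := nonempty_polygons_homeomorph
    (tileWord tileLetter G.top (otherSheet G.k) G.slit) (nodup_flatMap_copyTiles G.k)
    mem_flatMap_copyTiles
  have h : ((List.finRange G.k).flatMap copyTiles).map
      (tileWord tileLetter G.top (otherSheet G.k) G.slit) =
      (List.finRange G.k).flatMap G.copyWords := List.map_flatMap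
  rw [h] at e₂
  exact ⟨e₂.trans e₁⟩

/-- Here the slit permutation applies `otherSheet` twice and is the identity, so the middle strip of
each square closes up with itself. -/
theorem closedGluing_copyWords (n : ℕ) (i : Fin (n + 2)) :
    (closedGluing n).copyWords i = closedCopy i ((i + 1) % (n + 2)) := by
  have h : ((i + 1 : Fin (n + 2)) : ℕ) = (i + 1) % (n + 2) := by
    rw [Fin.val_add, Fin.val_one]
  rw [← h]
  rfl

theorem linkedGluing_copyWords (n : ℕ) (i : Fin (n + 2)) (hi : 2 ≤ (i : ℕ)) :
    (linkedGluing n).copyWords i = closedCopy i ((i + 1) % (n + 2)) := by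
  rw [← closedGluing_copyWords]
  have hs : ∀ e, (linkedGluing n).slit (i, e) = (closedGluing n).slit (i, e) := by
    intro e
    refine Equiv.swap_apply_of_ne_of_ne ?_ ?_
    · intro h
      obtain rfl : i = 0 := congrArg Prod.fst h
      simp at hi
    · intro h
      obtain rfl : i = 1 := congrArg Prod.fst h
      simp at hi
  simp only [Gluing.copyWords, copyTiles, List.map_cons, List.map_nil, tileWord, hs]
  rfl

/-- Here the slit permutation is the transposition of the first squares of copies 0 and 1. -/
theorem linkedGluing_copyWords_zero_append (n : ℕ) :
    (linkedGluing n).copyWords (0 : Fin (n + 2)) ++ (linkedGluing n).copyWords (1 : Fin (n + 2)) =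
      linkedCopies (2 % (n + 2)) := by
  have h2 : ((1 + 1 : Fin (n + 2)) : ℕ) = 2 % (n + 2) := by
    rw [Fin.val_add, Fin.val_one]
  have h1 : (0 + 1 : Fin (n + 2)) = 1 := zero_add 1
  have hn : ((1 : Fin (n + 2)), (0 : Fin 2)) ≠ (0, 0) := by simp
  have s00 : (linkedGluing n).slit ((0 : Fin (n + 2)), 0) = ((1 : Fin (n + 2)), 0) :=
    Equiv.swap_apply_left ((0 : Fin (n + 2)), (0 : Fin 2)) (1, 0)
  have s01 : (linkedGluing n).slit ((0 : Fin (n + 2)), 1) = ((0 : Fin (n + 2)), 1) :=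
    Equiv.swap_apply_of_ne_of_ne (a := ((0 : Fin (n + 2)), (0 : Fin 2))) (b := (1, 0))
      (x := (0, 1)) (by simp) (by simp)
  have s10 : (linkedGluing n).slit ((1 : Fin (n + 2)), 0) = ((0 : Fin (n + 2)), 0) :=
    Equiv.swap_apply_right ((0 : Fin (n + 2)), (0 : Fin 2)) (1, 0)
  have s11 : (linkedGluing n).slit ((1 : Fin (n + 2)), 1) = ((1 : Fin (n + 2)), 1) :=
    Equiv.swap_apply_of_ne_of_ne (a := ((0 : Fin (n + 2)), (0 : Fin 2))) (b := (1, 0))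
      (x := (1, 1)) (by simp) (by simp)
  simp only [Gluing.copyWords, copyTiles, List.map_cons, List.map_nil, tileWord, s00, s01, s10, s11]
  rw [← h2]
  rfl

/-- Even and odd genera come from the closed and the linked gluing with ⌊g / 2⌋ copies. The bound on
g provides at least two copies, without which `b` would have a fixed point. -/
theorem exists_squares_homeomorph {g : ℕ} (hg : 4 ≤ g) :
    ∃ G : Gluing, Nonempty (G.Squares ≃ₜ StandardSurface g) := by
  have key : ∀ (G : Gluing) (ps : List (((ℕ × ℕ) × Bool) × ((ℕ × ℕ) × Bool))), ps.length = g →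
      (letters ps).Nodup →
      SameSurface ((List.finRange G.k).flatMap G.copyWords) [ps.flatMap commWord] →
      Nonempty (G.Squares ≃ₜ StandardSurface g) := by
    rintro G ps rfl hnd ⟨e⟩
    obtain ⟨e₁⟩ := G.nonempty_squares_homeomorph
    obtain ⟨e₂⟩ := nonempty_homeomorph_standardSurface ps hnd
    exact ⟨(e₁.symm.trans e).trans e₂⟩
  rcases Nat.even_or_odd' g with ⟨k, rfl | rfl⟩
  · obtain ⟨n, rfl⟩ : ∃ n, k = n + 2 := ⟨k - 2, by omega⟩
    obtain ⟨ps, hl, hnd, h⟩ := SameSurface.exists_closedCopies (k := n + 2) (by omega)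
    refine ⟨closedGluing n, key _ ps hl hnd ?_⟩
    convert h using 1
    rw [← List.map_coe_finRange_eq_range, List.flatMap_map]
    exact List.flatMap_congr fun i _ => closedGluing_copyWords n i
  · obtain ⟨n, rfl⟩ : ∃ n, k = n + 2 := ⟨k - 2, by omega⟩
    obtain ⟨ps, hl, hnd, h⟩ := SameSurface.exists_linkedCopies (k := n + 2) (by omega)
    refine ⟨linkedGluing n, key _ ps hl hnd ?_⟩
    convert h using 1
    rw [← linkedGluing_copyWords_zero_append]
    have h1 : List.finRange (n + 2) = (0 : Fin (n + 2)) :: (1 : Fin (n + 2)) ::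
        (List.finRange n).map (fun i => i.succ.succ) := by
      rw [List.finRange_succ, List.finRange_succ, List.map_cons, List.map_map]
      rfl
    have h2 : List.range' 2 (n + 2 - 2) = (List.finRange n).map fun i : Fin n => (i : ℕ) + 2 := by
      rw [Nat.add_sub_cancel, List.range'_eq_map_range, ← List.map_coe_finRange_eq_range,
        List.map_map]
      exact List.map_congr_left fun i _ => add_comm _ _
    let F : Fin (n + 2) → List (List ((ℕ × ℕ) × Bool)) := (linkedGluing n).copyWords
    show (List.finRange (n + 2)).flatMap F = F 0 ++ F 1 ++ _
    rw [h1, h2, List.flatMap_cons, List.flatMap_cons, List.flatMap_map, List.flatMap_map,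
      List.append_assoc]
    have h3 : ∀ i : Fin n, F i.succ.succ = closedCopy (i + 2) ((i + 2 + 1) % (n + 2)) := fun i =>
      linkedGluing_copyWords n i.succ.succ (by simp)
    simp only [h3]

section

/-! ### The torus in coordinates -/

/-- The point of the torus with the given real coordinates. -/
def torusPt (x y : ℝ) : Torus := ((x : UnitAddCircle), (y : UnitAddCircle))

theorem coe_unitAddCircle_eq_iff {x y : ℝ} :
    (x : UnitAddCircle) = (y : UnitAddCircle) ↔ ∃ n : ℤ, x = y + n := by
  rw [eq_comm, QuotientAddGroup.eq, AddSubgroup.mem_zmultiples_iff]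
  refine exists_congr fun n => ?_
  simp only [zsmul_eq_mul, mul_one]
  constructor <;> intro h <;> linarith

theorem coe_unitAddCircle_injOn : InjOn (fun x : ℝ => (x : UnitAddCircle)) (Ico 0 1) := by
  intro x hx y hy h
  obtain ⟨n, hn⟩ := coe_unitAddCircle_eq_iff.1 h
  have h1 : (n : ℝ) < 1 := by linarith [hx.2, hy.1]
  have h2 : (-1 : ℝ) < n := by linarith [hx.1, hy.2]
  have : n = 0 := by
    have h1 : n < 1 := by exact_mod_cast h1
    have h2 : -1 < n := by exact_mod_cast h2
    omega
  simpa [this] using hn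

theorem torusPt_inj {a b : ℝ × ℝ} (ha : a ∈ Ico (0 : ℝ) 1 ×ˢ Ico (0 : ℝ) 1)
    (hb : b ∈ Ico (0 : ℝ) 1 ×ˢ Ico (0 : ℝ) 1) : torusPt a.1 a.2 = torusPt b.1 b.2 ↔ a = b := by
  refine ⟨fun h => ?_, fun h => h ▸ rfl⟩
  exact Prod.ext (coe_unitAddCircle_injOn ha.1 hb.1 (congrArg Prod.fst h))
    (coe_unitAddCircle_injOn ha.2 hb.2 (congrArg Prod.snd h))

theorem exists_torusPt_eq (b : Torus) :
    ∃ a ∈ Ico (0 : ℝ) 1 ×ˢ Ico (0 : ℝ) 1, torusPt a.1 a.2 = b := by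
  obtain ⟨b₁, b₂⟩ := b
  obtain ⟨x, rfl⟩ := QuotientAddGroup.mk_surjective b₁
  obtain ⟨y, rfl⟩ := QuotientAddGroup.mk_surjective b₂
  refine ⟨(Int.fract x, Int.fract y), ⟨⟨Int.fract_nonneg _, Int.fract_lt_one _⟩,
    Int.fract_nonneg _, Int.fract_lt_one _⟩, Prod.ext ?_ ?_⟩
  · exact coe_unitAddCircle_eq_iff.2 ⟨-⌊x⌋, by rw [← Int.self_sub_floor x]; push_cast; ring⟩
  · exact coe_unitAddCircle_eq_iff.2 ⟨-⌊y⌋, by rw [← Int.self_sub_floor y]; push_cast; ring⟩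

theorem continuous_torusPt : Continuous fun p : ℝ × ℝ => torusPt p.1 p.2 :=
  ((AddCircle.continuous_mk' 1).comp continuous_fst).prodMk
    ((AddCircle.continuous_mk' 1).comp continuous_snd)

/-- The coordinate of a wall, seen from the left or from below. -/
def lowCoord (c : ℝ) : ℝ := if c = 0 then 1 else c

theorem lowCoord_zero : lowCoord 0 = 1 := if_pos rfl

theorem lowCoord_of_ne {c : ℝ} (hc : c ≠ 0) : lowCoord c = c := if_neg hc

theorem coe_lowCoord (c ξ : ℝ) : ((lowCoord c + ξ : ℝ) : UnitAddCircle) = ((c + ξ : ℝ) :) := by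
  by_cases hc : c = 0
  · subst hc
    rw [lowCoord_zero]
    exact coe_unitAddCircle_eq_iff.2 ⟨1, by push_cast; ring⟩
  · rw [lowCoord_of_ne hc]

/-- Admissible radius around a coordinate. -/
def SmallRadius (c ε : ℝ) : Prop := c = 0 ∨ ε < c ∧ c + ε < 1

/-- Near a wall the unit interval has two ends to offer, distinguished by the sign of the offset;
elsewhere `lowCoord c` is c and both descriptions coincide. The products of these two cases are the
four quadrants. -/
theorem SmallRadius.cases {c ε ξ : ℝ} (h : SmallRadius c ε) (hε : ε < 1 / 4) (hξ : |ξ| ≤ ε)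
    {x : unitInterval} (hx : ((x : ℝ) : UnitAddCircle) = ((c + ξ : ℝ) :)) :
    0 ≤ ξ ∧ (x : ℝ) = c + ξ ∨ ξ ≤ 0 ∧ (x : ℝ) = lowCoord c + ξ := by
  obtain ⟨n, hn⟩ := coe_unitAddCircle_eq_iff.1 hx
  obtain ⟨h1, h2⟩ := abs_le.1 hξ
  have hx0 := x.2.1
  have hx1 := x.2.2
  rcases h with rfl | ⟨h3, h4⟩
  · have h5 : n = 0 ∨ n = 1 := by
      have h6 : (-1 : ℝ) < n := by linarith
      have h7 : (n : ℝ) < 2 := by linarith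
      have h6 : -1 < n := by exact_mod_cast h6
      have h7 : n < 2 := by exact_mod_cast h7
      omega
    rcases h5 with rfl | rfl
    · left
      push_cast at hn
      exact ⟨by linarith, by linarith⟩
    · right
      push_cast at hn
      rw [lowCoord_zero]
      exact ⟨by linarith, by linarith⟩
  · have h5 : n = 0 := by
      have h6 : (-1 : ℝ) < n := by linarith
      have h7 : (n : ℝ) < 1 := by linarith
      have h6 : -1 < n := by exact_mod_cast h6
      have h7 : n < 1 := by exact_mod_cast h7
      omega
    subst h5
    push_cast at hn
    have hc : c ≠ 0 := fun h => by linarith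
    rw [lowCoord_of_ne hc]
    rcases le_total 0 ξ with h | h
    · exact Or.inl ⟨h, by linarith⟩
    · exact Or.inr ⟨h, by linarith⟩

/-! ### Local structure of square-tiled surfaces -/

/-- The corners and the end points of the slits. -/
def slitEnds : Set Torus := {torusPt 0 0, torusPt 0 (2 / 5), torusPt 0 (3 / 5)}

variable {Sh : Type*} {τ σ σ' : Equiv.Perm Sh}

/-- The identifications of the left and right sides near the height `c`. -/
structure ColumnData (σ σ' : Equiv.Perm Sh) (c ε : ℝ) (Hp Hm : Equiv.Perm Sh) : Prop where
  above : ∀ y : ℝ, c ≤ y → y ≤ c + ε →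
    Hp = σ ∧ (y ≤ 2 / 5 ∨ 3 / 5 ≤ y) ∨ Hp = σ' ∧ 2 / 5 ≤ y ∧ y ≤ 3 / 5
  below : ∀ y : ℝ, lowCoord c - ε ≤ y → y ≤ lowCoord c →
    Hm = σ ∧ (y ≤ 2 / 5 ∨ 3 / 5 ≤ y) ∨ Hm = σ' ∧ 2 / 5 ≤ y ∧ y ≤ 3 / 5
  outer : ∀ y : ℝ, (|y - c| < ε ∨ c = 0 ∧ 1 - ε < y) → (y ≤ 2 / 5 ∨ 3 / 5 ≤ y) → σ = Hp ∨ σ = Hm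
  inner : ∀ y : ℝ, (|y - c| < ε ∨ c = 0 ∧ 1 - ε < y) → 2 / 5 ≤ y → y ≤ 3 / 5 → σ' = Hp ∨ σ' = Hm

theorem ColumnData.mono {c ε ε' : ℝ} {Hp Hm : Equiv.Perm Sh} (h : ColumnData σ σ' c ε Hp Hm)
    (hε : ε' ≤ ε) : ColumnData σ σ' c ε' Hp Hm where
  above y h1 h2 := h.above y h1 (by linarith)
  below y h1 h2 := h.below y (by linarith) h2
  outer y h1 := h.outer y (h1.imp (fun h => h.trans_le hε) fun h => ⟨h.1, by linarith [h.2]⟩)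
  inner y h1 := h.inner y (h1.imp (fun h => h.trans_le hε) fun h => ⟨h.1, by linarith [h.2]⟩)

/-- The gluing of a vertical wall changes only at the heights 2/5 and 3/5. Elsewhere a radius that
avoids them lets one permutation serve above and below; for c = 0, below means close to height 1,
where the permutation is again `σ`. -/
theorem exists_columnData (σ σ' : Equiv.Perm Sh) {c : ℝ} (hc : c ∈ Ico (0 : ℝ) 1) :
    ∃ ε > 0, ∃ Hp Hm, ColumnData σ σ' c ε Hp Hm ∧ (c ≠ 2 / 5 → c ≠ 3 / 5 → Hp = Hm) ∧
      (c = 0 → Hp = σ) ∧ (c = 2 / 5 → Hp = σ' ∧ Hm = σ) ∧ (c = 3 / 5 → Hp = σ ∧ Hm = σ') := by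
  have hlow : c ≠ 0 → lowCoord c = c := lowCoord_of_ne
  rcases lt_trichotomy c (2 / 5) with h | h | h
  · refine ⟨(2 / 5 - c) / 2, by linarith, σ, σ, ⟨?_, ?_, fun _ _ _ => Or.inl rfl, ?_⟩,
      fun _ _ => rfl, fun _ => rfl, fun h' => by linarith, fun h' => by linarith⟩
    · exact fun y h1 h2 => Or.inl ⟨rfl, Or.inl (by linarith)⟩
    · intro y h1 h2
      by_cases hc0 : c = 0
      · subst hc0
        rw [lowCoord_zero] at h1
        exact Or.inl ⟨rfl, Or.inr (by linarith)⟩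
      · rw [hlow hc0] at h2
        exact Or.inl ⟨rfl, Or.inl (by linarith)⟩
    · rintro y (h1 | ⟨rfl, h1⟩) h2 h3
      · linarith [(abs_lt.1 h1).2]
      · linarith
  · subst h
    refine ⟨1 / 5, by norm_num, σ', σ, ⟨?_, ?_, fun _ _ _ => Or.inr rfl, fun _ _ _ _ => Or.inl rfl⟩,
      fun h => (h rfl).elim, fun h' => by norm_num at h', fun _ => ⟨rfl, rfl⟩, fun h' => by norm_num at h'⟩
    · exact fun y h1 h2 => Or.inr ⟨rfl, h1, by linarith⟩
    · intro y h1 h2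
      rw [hlow (by norm_num)] at h2
      exact Or.inl ⟨rfl, Or.inl h2⟩
  have hc0 : c ≠ 0 := by linarith
  rcases lt_trichotomy c (3 / 5) with h' | h' | h'
  · have e1 := min_le_left ((c - 2 / 5) / 2) ((3 / 5 - c) / 2)
    have e2 := min_le_right ((c - 2 / 5) / 2) ((3 / 5 - c) / 2)
    refine ⟨min ((c - 2 / 5) / 2) ((3 / 5 - c) / 2), lt_min (by linarith) (by linarith), σ', σ',
      ⟨?_, ?_, ?_, fun _ _ _ _ => Or.inl rfl⟩, fun _ _ => rfl, fun h => (hc0 h).elim,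
      fun h => by linarith, fun h => by linarith⟩
    · exact fun y h1 h2 => Or.inr ⟨rfl, by linarith, by linarith⟩
    · intro y h1 h2
      rw [hlow hc0] at h1 h2
      exact Or.inr ⟨rfl, by linarith, by linarith⟩
    · rintro y (h1 | ⟨h0, -⟩) h2
      · obtain ⟨h3, h4⟩ := abs_lt.1 h1
        rcases h2 with h2 | h2 <;> linarith
      · exact (hc0 h0).elim
  · subst h'
    refine ⟨1 / 5, by norm_num, σ, σ', ⟨?_, ?_, fun _ _ _ => Or.inl rfl, fun _ _ _ _ => Or.inr rfl⟩,
      fun _ h => (h rfl).elim, fun h' => rfl, fun h' => by norm_num at h', fun _ => ⟨rfl, rfl⟩⟩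
    · exact fun y h1 h2 => Or.inl ⟨rfl, Or.inr h1⟩
    · intro y h1 h2
      rw [hlow hc0] at h1 h2
      exact Or.inr ⟨rfl, by linarith, h2⟩
  · refine ⟨(c - 3 / 5) / 2, by linarith, σ, σ, ⟨?_, ?_, fun _ _ _ => Or.inl rfl, ?_⟩,
      fun _ _ => rfl, fun _ => rfl, fun h' => by linarith, fun h' => by linarith⟩
    · exact fun y h1 h2 => Or.inl ⟨rfl, Or.inr (by linarith)⟩
    · intro y h1 h2
      rw [hlow hc0] at h1
      exact Or.inl ⟨rfl, Or.inr (by linarith)⟩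
    · rintro y (h1 | ⟨h0, -⟩) h2 h3
      · linarith [(abs_lt.1 h1).1]
      · exact (hc0 h0).elim

/-- The identifications of the sides of squares near the point `a`: crossing the vertical wall from
left to right above and below `a` is described by `Hp` and `Hm`, crossing the horizontal wall
upwards is described by `V`. -/
structure LocalGluing (τ σ σ' : Equiv.Perm Sh) (a : ℝ × ℝ) where
  ε : ℝ
  V : Equiv.Perm Sh
  Hp : Equiv.Perm Sh
  Hm : Equiv.Perm Sh
  ε_pos : 0 < ε
  ε_lt : ε < 1 / 4
  hx : SmallRadius a.1 ε
  hy : SmallRadius a.2 ε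
  V_eq : a.2 = 0 → V = τ
  V_one : a.2 ≠ 0 → V = 1
  Hp_one : a.1 ≠ 0 → Hp = 1
  Hm_one : a.1 ≠ 0 → Hm = 1
  H_eq : a.2 = 0 → Hp = Hm
  column : a.1 = 0 → ColumnData σ σ' a.2 ε Hp Hm
  isolated : ∀ b ∈ slitEnds, b ∈ Metric.closedBall (torusPt a.1 a.2) ε → b = torusPt a.1 a.2

/-- The monodromy around the point. -/
def LocalGluing.ρ {a : ℝ × ℝ} (D : LocalGluing τ σ σ' a) : Equiv.Perm Sh :=
  D.V * D.Hm * D.V⁻¹ * D.Hp⁻¹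

theorem exists_smallRadius {c : ℝ} (hc : c ∈ Ico (0 : ℝ) 1) : ∃ δ > 0, ∀ ε ≤ δ, SmallRadius c ε := by
  rcases hc.1.eq_or_lt with rfl | h
  · exact ⟨1, one_pos, fun _ _ => Or.inl rfl⟩
  · have e1 := min_le_left (c / 2) ((1 - c) / 2)
    have e2 := min_le_right (c / 2) ((1 - c) / 2)
    exact ⟨min (c / 2) ((1 - c) / 2), lt_min (by linarith) (by linarith [hc.2]),
      fun ε hε => Or.inr ⟨by linarith, by linarith [hc.2]⟩⟩

/-- On a single wall the factors of the monodromy cancel. At the corner it is the commutator of `τ`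
and `σ`, at the ends of the slit it is `σ * σ'⁻¹` and `σ' * σ⁻¹`; the two inequalities say that
these have no fixed points. -/
theorem exists_localGluing (τ σ σ' : Equiv.Perm Sh) {a : ℝ × ℝ}
    (ha : a ∈ Ico (0 : ℝ) 1 ×ˢ Ico (0 : ℝ) 1) :
    ∃ D : LocalGluing τ σ σ' a, (torusPt a.1 a.2 ∉ slitEnds → D.ρ = 1) ∧
      ((∀ s, σ s ≠ σ' s) → (∀ s, τ (σ s) ≠ σ (τ s)) → torusPt a.1 a.2 ∈ slitEnds →
        ∀ w, D.ρ w ≠ w) := by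
  obtain ⟨δ₁, hδ₁, h₁⟩ := exists_smallRadius ha.1
  obtain ⟨δ₂, hδ₂, h₂⟩ := exists_smallRadius ha.2
  obtain ⟨δ₃, hδ₃, Hp, Hm, hc, he, h0, h25, h35⟩ := exists_columnData σ σ' ha.2
  have hfin : (slitEnds \ {torusPt a.1 a.2}).Finite := Set.Finite.sdiff (by simp [slitEnds])
  obtain ⟨δ₄, hδ₄, h₄⟩ := Metric.isOpen_iff.1 hfin.isClosed.isOpen_compl (torusPt a.1 a.2) (by simp)
  obtain ⟨ε, hε, hε'⟩ := exists_between (show 0 < min (min δ₁ δ₂) (min (min δ₃ δ₄) (1 / 4)) by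
    simp [hδ₁, hδ₂, hδ₃, hδ₄])
  simp only [lt_min_iff] at hε'
  obtain ⟨⟨l1, l2⟩, ⟨l3, l4⟩, l5⟩ := hε'
  classical
  have hmem : ∀ y : ℝ, y ∈ Ico (0 : ℝ) 1 → ((0 : ℝ), y) ∈ Ico (0 : ℝ) 1 ×ˢ Ico (0 : ℝ) 1 :=
    fun y hy => ⟨⟨le_rfl, one_pos⟩, hy⟩
  have hends : torusPt a.1 a.2 ∈ slitEnds ↔ a = (0, 0) ∨ a = (0, 2 / 5) ∨ a = (0, 3 / 5) := by
    simp only [slitEnds, mem_insert_iff, mem_singleton_iff]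
    rw [← torusPt_inj ha (hmem 0 ⟨le_rfl, one_pos⟩), ← torusPt_inj ha (hmem (2 / 5) (by norm_num)),
      ← torusPt_inj ha (hmem (3 / 5) (by norm_num))]
  refine ⟨⟨ε, if a.2 = 0 then τ else 1, if a.1 = 0 then Hp else 1, if a.1 = 0 then Hm else 1,
    hε, l5, h₁ ε l1.le, h₂ ε l2.le, fun h => if_pos h, fun h => if_neg h, fun h => if_neg h,
    fun h => if_neg h, fun h => ?_, fun h => ?_, fun b hb hb' => ?_⟩, fun h => ?_, fun f1 f2 h => ?_⟩
  · rw [he (by rw [h]; norm_num) (by rw [h]; norm_num)]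
  · rw [if_pos h, if_pos h]
    exact hc.mono l3.le
  · by_contra hne
    exact h₄ (Metric.closedBall_subset_ball l4 hb') ⟨hb, hne⟩
  · rw [hends, not_or, not_or] at h
    simp only [LocalGluing.ρ]
    by_cases ha1 : a.1 = 0
    · have h1 : a.2 ≠ 0 := fun h' => h.1 (Prod.ext ha1 h')
      have h2 : a.2 ≠ 2 / 5 := fun h' => h.2.1 (Prod.ext ha1 h')
      have h3 : a.2 ≠ 3 / 5 := fun h' => h.2.2 (Prod.ext ha1 h')
      rw [if_neg h1, he h2 h3]
      simp
    · rw [if_neg ha1, if_neg ha1]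
      simp
  · rw [hends] at h
    intro w hw
    rcases h with rfl | rfl | rfl
    · simp only [LocalGluing.ρ, if_true, ← he (by norm_num) (by norm_num), h0 rfl] at hw
      -- A point w fixed by the commutator is the common value of `τ * σ` and `σ * τ` at this
      -- square.
      refine f2 (τ⁻¹ (σ⁻¹ w)) ?_
      simpa using hw
    · simp only [LocalGluing.ρ, if_true] at hw
      rw [(h25 rfl).1, (h25 rfl).2] at hw
      refine f1 (σ'⁻¹ w) ?_
      norm_num at hw
      simpa using hw
    · simp only [LocalGluing.ρ, if_true] at hw
      rw [(h35 rfl).1, (h35 rfl).2] at hw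
      refine f1 (σ⁻¹ w) ?_
      norm_num at hw
      simpa using hw.symm

end

section

/-! ### Quadrants around a point of the torus -/

section Local

variable {Sh : Type*} {τ σ σ' : Equiv.Perm Sh}

/-- The projection of a square-tiled surface to the torus. -/
def squareProj (τ σ σ' : Equiv.Perm Sh) : SquareSurface τ σ σ' → Torus :=
  Quot.lift (fun t => torusPt t.2.1 t.2.2) (by
    have h : ((1 : ℝ) : UnitAddCircle) = ((0 : ℝ) : UnitAddCircle) :=
      coe_unitAddCircle_eq_iff.2 ⟨1, by simp⟩
    rintro _ _ (⟨s, y, hy⟩ | ⟨s, y, hy, hy'⟩ | ⟨s, x⟩) <;> simp [torusPt, h])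

namespace LocalGluing

variable {a : ℝ × ℝ} (D : LocalGluing τ σ σ' a)

/-- The position of `a` in the squares of the four quadrants, counterclockwise. -/
def corner (a : ℝ × ℝ) : Fin 4 → ℝ × ℝ
  | 0 => a
  | 1 => (lowCoord a.1, a.2)
  | 2 => (lowCoord a.1, lowCoord a.2)
  | 3 => (a.1, lowCoord a.2)

/-- The closed quadrants. -/
def quad : Fin 4 → Set ℂ
  | 0 => {ζ | 0 ≤ ζ.re ∧ 0 ≤ ζ.im}
  | 1 => {ζ | ζ.re ≤ 0 ∧ 0 ≤ ζ.im}
  | 2 => {ζ | ζ.re ≤ 0 ∧ ζ.im ≤ 0}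
  | 3 => {ζ | 0 ≤ ζ.re ∧ ζ.im ≤ 0}

/-- The squares met when going once around `a`. -/
def sheet : Fin 4 → Equiv.Perm Sh
  | 0 => 1
  | 1 => D.Hp⁻¹
  | 2 => D.V⁻¹ * D.Hp⁻¹
  | 3 => D.Hm * D.V⁻¹ * D.Hp⁻¹

/-- The point with offset `ζ` in the quadrant `j`. -/
def sq (j : Fin 4) (w : Sh) (ζ : ℂ) : Sh × unitInterval × unitInterval :=
  (D.sheet j w, projIcc 0 1 zero_le_one ((corner a j).1 + ζ.re),
    projIcc 0 1 zero_le_one ((corner a j).2 + ζ.im))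

/-- The projection to the unit interval only makes `sq` total and continuous; within the admissible
radius and on the correct side it changes nothing. -/
theorem _root_.TorusGluing.SmallRadius.coe_projIcc {c ε ξ : ℝ} (h : SmallRadius c ε) (h0 : 0 < ε)
    (hε : ε < 1 / 4) (hξ : |ξ| ≤ ε) (hs : 0 ≤ ξ) :
    (projIcc (0 : ℝ) 1 zero_le_one (c + ξ) : ℝ) = c + ξ := by
  obtain ⟨h1, h2⟩ := abs_le.1 hξ
  rw [projIcc_of_mem]
  rcases h with rfl | ⟨h3, h4⟩
  · exact ⟨by linarith, by linarith⟩
  · exact ⟨by linarith, by linarith⟩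

theorem _root_.TorusGluing.SmallRadius.coe_projIcc_low {c ε ξ : ℝ} (h : SmallRadius c ε)
    (h0 : 0 < ε) (hε : ε < 1 / 4) (hξ : |ξ| ≤ ε) (hs : ξ ≤ 0) :
    (projIcc (0 : ℝ) 1 zero_le_one (lowCoord c + ξ) : ℝ) = lowCoord c + ξ := by
  obtain ⟨h1, h2⟩ := abs_le.1 hξ
  rw [projIcc_of_mem]
  rcases h with rfl | ⟨h3, h4⟩
  · rw [lowCoord_zero]
    exact ⟨by linarith, by linarith⟩
  · rw [lowCoord_of_ne (by linarith)]
    exact ⟨by linarith, by linarith⟩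

variable {D} in
theorem abs_re_le {ζ : ℂ} (h : ‖ζ‖ ≤ D.ε) : |ζ.re| ≤ D.ε := (Complex.abs_re_le_norm ζ).trans h

variable {D} in
theorem abs_im_le {ζ : ℂ} (h : ‖ζ‖ ≤ D.ε) : |ζ.im| ≤ D.ε := (Complex.abs_im_le_norm ζ).trans h

theorem coe_sq {j : Fin 4} {ζ : ℂ} (hj : ζ ∈ quad j) (h : ‖ζ‖ ≤ D.ε) (w : Sh) :
    ((D.sq j w ζ).2.1 : ℝ) = (corner a j).1 + ζ.re ∧
      ((D.sq j w ζ).2.2 : ℝ) = (corner a j).2 + ζ.im := by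
  have h1 := D.hx.coe_projIcc D.ε_pos D.ε_lt (abs_re_le h)
  have h2 := D.hy.coe_projIcc D.ε_pos D.ε_lt (abs_im_le h)
  have h1' := D.hx.coe_projIcc_low D.ε_pos D.ε_lt (abs_re_le h)
  have h2' := D.hy.coe_projIcc_low D.ε_pos D.ε_lt (abs_im_le h)
  fin_cases j
  · exact ⟨h1 hj.1, h2 hj.2⟩
  · exact ⟨h1' hj.1, h2 hj.2⟩
  · exact ⟨h1' hj.1, h2' hj.2⟩
  · exact ⟨h1 hj.1, h2' hj.2⟩

theorem squareProj_sq {j : Fin 4} {ζ : ℂ} (hj : ζ ∈ quad j) (h : ‖ζ‖ ≤ D.ε) (w : Sh) :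
    squareProj τ σ σ' (Quot.mk _ (D.sq j w ζ)) = torusPt (a.1 + ζ.re) (a.2 + ζ.im) := by
  obtain ⟨h1, h2⟩ := D.coe_sq hj h w
  show torusPt _ _ = _
  rw [h1, h2]
  fin_cases j
  · rfl
  · exact Prod.ext (coe_lowCoord _ _) rfl
  · exact Prod.ext (coe_lowCoord _ _) (coe_lowCoord _ _)
  · exact Prod.ext rfl (coe_lowCoord _ _)

/-- The ends of the unit interval near which the coordinates lie determine the quadrant, and the
starting square is recovered by undoing `sheet`. -/
theorem exists_sq {t : Sh × unitInterval × unitInterval} {ζ : ℂ} (h : ‖ζ‖ ≤ D.ε)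
    (ht : torusPt t.2.1 t.2.2 = torusPt (a.1 + ζ.re) (a.2 + ζ.im)) :
    ∃ j w, ζ ∈ quad j ∧ t = D.sq j w ζ := by
  have key : ∀ j, ζ ∈ quad j → (t.2.1 : ℝ) = (corner a j).1 + ζ.re →
      (t.2.2 : ℝ) = (corner a j).2 + ζ.im → ∃ j w, ζ ∈ quad j ∧ t = D.sq j w ζ := by
    intro j hj h1 h2
    refine ⟨j, (D.sheet j)⁻¹ t.1, hj, ?_⟩
    obtain ⟨h3, h4⟩ := D.coe_sq hj h ((D.sheet j)⁻¹ t.1)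
    refine Prod.ext ?_ (Prod.ext (Subtype.ext (h1.trans h3.symm)) (Subtype.ext (h2.trans h4.symm)))
    exact ((D.sheet j).apply_symm_apply t.1).symm
  have h1 := D.hx.cases D.ε_lt (abs_re_le h) (congrArg Prod.fst ht)
  have h2 := D.hy.cases D.ε_lt (abs_im_le h) (congrArg Prod.snd ht)
  rcases h1 with ⟨h1, h1'⟩ | ⟨h1, h1'⟩ <;> rcases h2 with ⟨h2, h2'⟩ | ⟨h2, h2'⟩
  · exact key 0 ⟨h1, h2⟩ h1' h2'
  · exact key 3 ⟨h1, h2⟩ h1' h2'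
  · exact key 1 ⟨h1, h2⟩ h1' h2'
  · exact key 2 ⟨h1, h2⟩ h1' h2'

theorem above_rel (h0 : a.1 = 0) (s : Sh) {y : unitInterval} (h1 : a.2 ≤ y) (h2 : y ≤ a.2 + D.ε) :
    SquareRel τ σ σ' (s, 1, y) (D.Hp s, 0, y) := by
  rcases (D.column h0).above y h1 h2 with ⟨h, h'⟩ | ⟨h, h', h''⟩
  · rw [h]; exact .right s y h'
  · rw [h]; exact .slit s y h' h''

theorem below_rel (h0 : a.1 = 0) (s : Sh) {y : unitInterval} (h1 : lowCoord a.2 - D.ε ≤ y)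
    (h2 : y ≤ lowCoord a.2) : SquareRel τ σ σ' (s, 1, y) (D.Hm s, 0, y) := by
  rcases (D.column h0).below y h1 h2 with ⟨h, h'⟩ | ⟨h, h', h''⟩
  · rw [h]; exact .right s y h'
  · rw [h]; exact .slit s y h' h''

theorem top_rel (h0 : a.2 = 0) (s : Sh) (x : unitInterval) :
    SquareRel τ σ σ' (s, x, 1) (D.V s, x, 0) := by
  rw [D.V_eq h0]
  exact .top s x

/-- Crossing a wall. -/
theorem mk_sq_add_one {j : Fin 4} {ζ : ℂ} (hj : ζ ∈ quad j) (hj' : ζ ∈ quad (j + 1))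
    (h : ‖ζ‖ ≤ D.ε) (w : Sh) :
    Quot.mk (SquareRel τ σ σ') (D.sq j w ζ) =
      Quot.mk _ (D.sq (j + 1) (if j = 3 then D.ρ w else w) ζ) := by
  obtain ⟨hre1, hre2⟩ := abs_le.1 (abs_re_le h)
  obtain ⟨him1, him2⟩ := abs_le.1 (abs_im_le h)
  have p0 : projIcc (0 : ℝ) 1 zero_le_one 0 = 0 := projIcc_left zero_le_one
  have p1 : projIcc (0 : ℝ) 1 zero_le_one 1 = 1 := projIcc_right zero_le_one
  fin_cases j
  -- A common point of neighbouring quadrants lies on their common ray. If the ray lies in a wall,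
  -- the two points are glued there; if not, the permutation is trivial and the two points are the
  -- same.
  · have hz : ζ.re = 0 := le_antisymm hj'.1 hj.1
    change Quot.mk _ (w, projIcc 0 1 zero_le_one (a.1 + ζ.re), _) =
      Quot.mk _ (D.Hp⁻¹ w, projIcc 0 1 zero_le_one (lowCoord a.1 + ζ.re), _)
    by_cases h0 : a.1 = 0
    · have hc := (D.coe_sq (j := 0) hj h w).2
      have hr := D.above_rel h0 (D.Hp⁻¹ w) (y := (D.sq 0 w ζ).2.2)
        (by rw [hc]; exact le_add_of_nonneg_right hj.2)
        (by rw [hc]; exact add_le_add_right him2 _)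
      simp only [show ∀ x, D.Hp (D.Hp⁻¹ x) = x from fun x => D.Hp.apply_symm_apply x] at hr
      rw [h0, lowCoord_zero, hz, add_zero, add_zero, p0, p1]
      exact (Quot.sound hr).symm
    · rw [lowCoord_of_ne h0, D.Hp_one h0]
      rfl
  · have hz : ζ.im = 0 := le_antisymm hj'.2 hj.2
    change Quot.mk _ (D.Hp⁻¹ w, _, projIcc 0 1 zero_le_one (a.2 + ζ.im)) =
      Quot.mk _ (D.V⁻¹ (D.Hp⁻¹ w), _, projIcc 0 1 zero_le_one (lowCoord a.2 + ζ.im))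
    by_cases h0 : a.2 = 0
    · have hr := D.top_rel h0 (D.V⁻¹ (D.Hp⁻¹ w)) (D.sq 1 w ζ).2.1
      simp only [show ∀ x, D.V (D.V⁻¹ x) = x from fun x => D.V.apply_symm_apply x] at hr
      rw [h0, lowCoord_zero, hz, add_zero, add_zero, p0, p1]
      exact (Quot.sound hr).symm
    · rw [lowCoord_of_ne h0, D.V_one h0]
      rfl
  · have hz : ζ.re = 0 := le_antisymm hj.1 hj'.1
    change Quot.mk _ (D.V⁻¹ (D.Hp⁻¹ w), projIcc 0 1 zero_le_one (lowCoord a.1 + ζ.re), _) =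
      Quot.mk _ (D.Hm (D.V⁻¹ (D.Hp⁻¹ w)), projIcc 0 1 zero_le_one (a.1 + ζ.re), _)
    by_cases h0 : a.1 = 0
    · have hc := (D.coe_sq (j := 2) hj h w).2
      have hr := D.below_rel h0 (D.V⁻¹ (D.Hp⁻¹ w)) (y := (D.sq 2 w ζ).2.2)
        (by rw [hc]; show _ ≤ lowCoord a.2 + ζ.im; linarith)
        (by rw [hc]; exact add_le_of_nonpos_right hj.2)
      rw [h0, lowCoord_zero, hz, add_zero, add_zero, p0, p1]
      exact Quot.sound hr
    · rw [lowCoord_of_ne h0, D.Hm_one h0]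
      rfl
  -- The fourth crossing closes the loop, so the starting square is replaced by its image under `ρ`.
  · have hz : ζ.im = 0 := le_antisymm hj.2 hj'.2
    change Quot.mk _ (D.Hm (D.V⁻¹ (D.Hp⁻¹ w)), _, projIcc 0 1 zero_le_one (lowCoord a.2 + ζ.im)) =
      Quot.mk _ (D.V (D.Hm (D.V⁻¹ (D.Hp⁻¹ w))), _, projIcc 0 1 zero_le_one (a.2 + ζ.im))
    by_cases h0 : a.2 = 0
    · have hr := D.top_rel h0 (D.Hm (D.V⁻¹ (D.Hp⁻¹ w))) (D.sq 3 w ζ).2.1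
      rw [h0, lowCoord_zero, hz, add_zero, add_zero, p0, p1]
      exact Quot.sound hr
    · rw [lowCoord_of_ne h0, D.V_one h0]
      rfl

/-- The label of a point near the fibre of `a`: the square which one reaches by moving into the
first quadrant. -/
def label (t : Sh × unitInterval × unitInterval) : Sh :=
  (if 1 / 2 < (t.2.2 : ℝ) then D.V else 1) ((if 1 / 2 < (t.2.1 : ℝ) then D.Hp else 1) t.1)

/-- The coordinate `x` is close to `c`, modulo one. -/
def NearCoord (c ε x : ℝ) : Prop := |x - c| < ε ∨ c = 0 ∧ 1 - ε < x

theorem _root_.TorusGluing.SmallRadius.nearCoord {c ε ξ : ℝ} (h : SmallRadius c ε)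
    (hε : ε < 1 / 4) (hξ : |ξ| < ε) {x : unitInterval}
    (hx : ((x : ℝ) : UnitAddCircle) = ((c + ξ : ℝ) :)) : NearCoord c ε x := by
  rcases h.cases hε hξ.le hx with ⟨-, h1⟩ | ⟨-, h1⟩
  · exact Or.inl (by rwa [h1, add_sub_cancel_left])
  · by_cases hc : c = 0
    · refine Or.inr ⟨hc, ?_⟩
      rw [h1, hc, lowCoord_zero]
      linarith [(abs_lt.1 hξ).1]
    · rw [lowCoord_of_ne hc] at h1
      exact Or.inl (by rwa [h1, add_sub_cancel_left])

/-- The open disc around `a`. -/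
def disc : Set Torus := {b | ∃ ζ : ℂ, ‖ζ‖ < D.ε ∧ b = torusPt (a.1 + ζ.re) (a.2 + ζ.im)}

theorem nearCoord_of_mem_disc {t : Sh × unitInterval × unitInterval}
    (ht : torusPt t.2.1 t.2.2 ∈ D.disc) :
    NearCoord a.1 D.ε t.2.1 ∧ NearCoord a.2 D.ε t.2.2 := by
  obtain ⟨ζ, hζ, h⟩ := ht
  exact ⟨D.hx.nearCoord D.ε_lt ((Complex.abs_re_le_norm ζ).trans_lt hζ) (congrArg Prod.fst h),
    D.hy.nearCoord D.ε_lt ((Complex.abs_im_le_norm ζ).trans_lt hζ) (congrArg Prod.snd h)⟩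

theorem eq_zero_of_nearCoord_one {c ε : ℝ} (h : SmallRadius c ε)
    (h1 : NearCoord c ε 1) : c = 0 := by
  rcases h with h | ⟨h2, h3⟩
  · exact h
  · rcases h1 with h1 | h1
    · linarith [(abs_lt.1 h1).2]
    · exact h1.1

theorem sameCycle_of_Hm {s : Sh} (h2 : a.2 ≠ 0) : D.ρ.SameCycle (D.Hp s) (D.Hm s) :=
  ⟨1, by simp [ρ, D.V_one h2]⟩

/-- Gluing across one wall near `a` either keeps the label or moves it by one turn, so the cycle of
the label under `ρ` is well defined on the surface. -/
theorem label_rel {t t' : Sh × unitInterval × unitInterval} (h : SquareRel τ σ σ' t t')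
    (ht : torusPt t.2.1 t.2.2 ∈ D.disc) : D.ρ.SameCycle (D.label t) (D.label t') := by
  obtain ⟨n1, n2⟩ := D.nearCoord_of_mem_disc ht
  have i1 : (1 : ℝ) / 2 < 1 := by norm_num
  have i0 : ¬ (1 : ℝ) / 2 < 0 := by norm_num
  have key : ∀ (s s' : Sh) (y : unitInterval), (s' = D.Hp s ∨ s' = D.Hm s) →
      D.ρ.SameCycle (D.label (s, 1, y)) (D.label (s', 0, y)) := by
    intro s s' y hs
    simp only [label, Set.Icc.coe_one, Set.Icc.coe_zero, if_pos i1, if_neg i0, Equiv.Perm.one_apply]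
    by_cases h2 : a.2 = 0
    · rw [← D.H_eq h2, or_self] at hs
      rw [hs]
    · rw [D.V_one h2, ite_self, Equiv.Perm.one_apply, Equiv.Perm.one_apply]
      rcases hs with rfl | rfl
      · exact Equiv.Perm.SameCycle.refl _ _
      · exact D.sameCycle_of_Hm h2
  rcases h with ⟨s, y, hy⟩ | ⟨s, y, hy, hy'⟩ | ⟨s, x⟩
  · have h1 := eq_zero_of_nearCoord_one D.hx n1
    refine key s _ y ?_
    rcases (D.column h1).outer y n2 hy with h | h
    · exact Or.inl (DFunLike.congr_fun h s)
    · exact Or.inr (DFunLike.congr_fun h s)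
  · have h1 := eq_zero_of_nearCoord_one D.hx n1
    refine key s _ y ?_
    rcases (D.column h1).inner y n2 hy hy' with h | h
    · exact Or.inl (DFunLike.congr_fun h s)
    · exact Or.inr (DFunLike.congr_fun h s)
  · have h2 := eq_zero_of_nearCoord_one D.hy n2
    rw [← DFunLike.congr_fun (D.V_eq h2) s]
    simp only [label, Set.Icc.coe_one, Set.Icc.coe_zero, if_pos i1, if_neg i0, Equiv.Perm.one_apply]
    by_cases h1 : 1 / 2 < (x : ℝ)
    · rw [if_pos h1]
      refine Equiv.Perm.SameCycle.symm ⟨1, ?_⟩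
      simp [ρ, D.H_eq h2]
    · rw [if_neg h1]
      exact Equiv.Perm.SameCycle.refl _ _

/-- The label is `w` or `D.ρ w`, depending on the quadrant and on the walls through `a`. -/
theorem label_sq {j : Fin 4} {ζ : ℂ} (hj : ζ ∈ quad j) (h : ‖ζ‖ ≤ D.ε) (w : Sh) :
    D.ρ.SameCycle (D.label (D.sq j w ζ)) w := by
  obtain ⟨h1, h2⟩ := D.coe_sq hj h w
  obtain ⟨hre1, hre2⟩ := abs_le.1 (abs_re_le h)
  obtain ⟨him1, him2⟩ := abs_le.1 (abs_im_le h)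
  have hε := D.ε_lt
  have hlow : ∀ {c ξ : ℝ}, -D.ε ≤ ξ → c = 0 → 1 / 2 < lowCoord c + ξ := by
    rintro c ξ hξ rfl
    rw [lowCoord_zero]
    linarith
  have hhigh : ∀ {c ξ : ℝ}, ξ ≤ D.ε → c = 0 → ¬ 1 / 2 < c + ξ := by
    rintro c ξ hξ rfl
    linarith
  have eH : ∀ x : ℝ, a.1 ≠ 0 → (if 1 / 2 < x then D.Hp else 1) = D.Hp := fun x hx => by
    rw [D.Hp_one hx, ite_self]
  have eV : ∀ x : ℝ, a.2 ≠ 0 → (if 1 / 2 < x then D.V else 1) = D.V := fun x hx => by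
    rw [D.V_one hx, ite_self]
  have H1 : (if 1 / 2 < lowCoord a.1 + ζ.re then D.Hp else 1) = D.Hp := by
    by_cases hx : a.1 = 0
    · exact if_pos (hlow hre1 hx)
    · exact eH _ hx
  have H0 : (if 1 / 2 < a.1 + ζ.re then D.Hp else 1) = 1 := by
    by_cases hx : a.1 = 0
    · exact if_neg (hhigh hre2 hx)
    · rw [D.Hp_one hx, ite_self]
  have V1 : (if 1 / 2 < lowCoord a.2 + ζ.im then D.V else 1) = D.V := by
    by_cases hx : a.2 = 0
    · exact if_pos (hlow him1 hx)
    · exact eV _ hx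
  have V0 : (if 1 / 2 < a.2 + ζ.im then D.V else 1) = 1 := by
    by_cases hx : a.2 = 0
    · exact if_neg (hhigh him2 hx)
    · rw [D.V_one hx, ite_self]
  rw [label, h1, h2]
  fin_cases j
  · change D.ρ.SameCycle ((if 1 / 2 < a.2 + ζ.im then D.V else 1)
      ((if 1 / 2 < a.1 + ζ.re then D.Hp else 1) w)) w
    rw [V0, H0]
    exact Equiv.Perm.SameCycle.refl _ _
  · change D.ρ.SameCycle ((if 1 / 2 < a.2 + ζ.im then D.V else 1)
      ((if 1 / 2 < lowCoord a.1 + ζ.re then D.Hp else 1) (D.Hp⁻¹ w))) w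
    rw [V0, H1, show D.Hp (D.Hp⁻¹ w) = w from D.Hp.apply_symm_apply w]
    exact Equiv.Perm.SameCycle.refl _ _
  · change D.ρ.SameCycle ((if 1 / 2 < lowCoord a.2 + ζ.im then D.V else 1)
      ((if 1 / 2 < lowCoord a.1 + ζ.re then D.Hp else 1) (D.V⁻¹ (D.Hp⁻¹ w)))) w
    rw [V1, H1]
    by_cases hx : a.2 = 0
    · refine Equiv.Perm.SameCycle.symm ⟨1, ?_⟩
      simp [ρ, D.H_eq hx]
    · simp [D.V_one hx, Equiv.Perm.SameCycle.refl]
  · change D.ρ.SameCycle ((if 1 / 2 < lowCoord a.2 + ζ.im then D.V else 1)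
      ((if 1 / 2 < a.1 + ζ.re then D.Hp else 1) (D.Hm (D.V⁻¹ (D.Hp⁻¹ w))))) w
    rw [V1, H0]
    exact Equiv.Perm.SameCycle.symm ⟨1, rfl⟩

/-- If `a` lies on a wall, the corresponding coordinate stays away from the threshold 1/2; if it
does not, the permutation that is switched on there is trivial. -/
theorem eventually_label_eq [TopologicalSpace Sh] [DiscreteTopology Sh]
    {t : Sh × unitInterval × unitInterval} (ht : torusPt t.2.1 t.2.2 ∈ D.disc) :
    ∀ᶠ t' in 𝓝 t, D.label t' = D.label t := by
  have key : ∀ (f : Sh × unitInterval × unitInterval → ℝ) (c : ℝ) (P : Equiv.Perm Sh),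
      Continuous f → SmallRadius c D.ε → NearCoord c D.ε (f t) → (c ≠ 0 → P = 1) →
      ∀ᶠ t' in 𝓝 t, (if 1 / 2 < f t' then P else 1) = (if 1 / 2 < f t then P else 1) := by
    intro f c P hf hc hn hP
    by_cases h0 : c = 0
    · have hε := D.ε_lt
      rcases hn with h | h
      · have h1 : f t < 1 / 2 := by
          rw [h0, sub_zero] at h
          linarith [(abs_lt.1 h).2]
        filter_upwards [hf.continuousAt.eventually_lt continuousAt_const h1] with t' h2
        rw [if_neg h1.not_gt, if_neg h2.not_gt]
      · have h1 : 1 / 2 < f t := by linarith [h.2]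
        filter_upwards [continuousAt_const.eventually_lt hf.continuousAt h1] with t' h2
        rw [if_pos h1, if_pos h2]
    · simp [hP h0]
  obtain ⟨n1, n2⟩ := D.nearCoord_of_mem_disc ht
  have e1 := key (fun t => t.2.1) a.1 D.Hp (by fun_prop) D.hx n1 D.Hp_one
  have e2 := key (fun t => t.2.2) a.2 D.V (by fun_prop) D.hy n2 D.V_one
  have e3 : ∀ᶠ t' in 𝓝 t, t'.1 = t.1 :=
    continuous_fst.continuousAt.eventually_mem (show {t.1} ∈ 𝓝 t.1 by simp)
  filter_upwards [e1, e2, e3] with t' h1 h2 h3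
  rw [label, label, h1, h2, h3]

end LocalGluing

end Local

end

section

/-- The period of a square under the monodromy will be the local degree. -/
theorem exists_period {α : Type*} [Finite α] (f : Equiv.Perm α) (w : α) :
    ∃ d > 0, ∀ k : ℕ, (f ^ k) w = w ↔ d ∣ k := by
  refine ⟨Function.minimalPeriod f w,
    Function.minimalPeriod_pos_of_mem_periodicPts (f.injective.mem_periodicPts w), fun k => ?_⟩
  rw [← Function.isPeriodicPt_iff_minimalPeriod_dvd, Function.IsPeriodicPt, Function.IsFixedPt,
    Equiv.Perm.iterate_eq_pow]

/-! ### Sectors of the disc -/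

/-- The quadrant number `n`, counted counterclockwise. -/
def quadIndex (n : ℕ) : Fin 4 := Fin.ofNat 4 n

theorem quadIndex_add (j : Fin 4) (m : ℕ) : quadIndex (4 * m + j) = j := by
  ext
  simp [quadIndex, Nat.add_mod]

theorem quadIndex_succ (n : ℕ) : quadIndex (n + 1) = quadIndex n + 1 := by
  ext
  simp [quadIndex, Fin.val_add]

theorem quadIndex_eq_three_iff (n : ℕ) : quadIndex n = 3 ↔ (n + 1) / 4 = n / 4 + 1 := by
  rw [Fin.ext_iff]
  simp only [quadIndex, Fin.val_ofNat, Fin.isValue]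
  show n % 4 = 3 ↔ _
  omega

namespace LocalGluing

theorem ang_mem_quad_of_le {j : Fin 4} {y : ℝ} (h1 : (j : ℝ) ≤ 4 * y) (h2 : 4 * y ≤ j + 1) :
    (ang y : ℂ) ∈ quad j := by
  have hπ := Real.pi_pos
  have c1 : ∀ x : ℝ, -1 ≤ 4 * x → 4 * x ≤ 1 → 0 ≤ Real.cos (2 * Real.pi * x) := fun x h h' =>
    Real.cos_nonneg_of_mem_Icc ⟨by nlinarith, by nlinarith⟩
  have s1 : ∀ x : ℝ, 0 ≤ 4 * x → 4 * x ≤ 2 → 0 ≤ Real.sin (2 * Real.pi * x) := fun x h h' =>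
    Real.sin_nonneg_of_nonneg_of_le_pi (by nlinarith) (by nlinarith)
  have c2 : ∀ x : ℝ, 1 ≤ 4 * x → 4 * x ≤ 3 → Real.cos (2 * Real.pi * x) ≤ 0 := fun x h h' =>
    Real.cos_nonpos_of_pi_div_two_le_of_le (by nlinarith) (by nlinarith)
  have s2 : ∀ x : ℝ, 2 ≤ 4 * x → 4 * x ≤ 4 → Real.sin (2 * Real.pi * x) ≤ 0 := fun x h h' => by
    rw [← Real.sin_sub_two_pi]
    exact Real.sin_nonpos_of_nonpos_of_neg_pi_le (by nlinarith) (by nlinarith)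
  have c3 : ∀ x : ℝ, 3 ≤ 4 * x → 4 * x ≤ 4 → 0 ≤ Real.cos (2 * Real.pi * x) := fun x h h' => by
    rw [← Real.cos_sub_two_pi]
    exact Real.cos_nonneg_of_mem_Icc ⟨by nlinarith, by nlinarith⟩
  fin_cases j
  · have h1 : 0 ≤ 4 * y := by simpa using h1
    have h2 : 4 * y ≤ 1 := by simpa using h2
    exact ⟨by rw [ang_re]; exact c1 y (by linarith) h2, by rw [ang_im]; exact s1 y h1 (by linarith)⟩
  · have h1 : 1 ≤ 4 * y := by simpa using h1
    have h2 : 4 * y ≤ 2 := by norm_num at h2; linarith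
    exact ⟨by rw [ang_re]; exact c2 y h1 (by linarith), by rw [ang_im]; exact s1 y (by linarith) h2⟩
  · have h1 : 2 ≤ 4 * y := by simpa using h1
    have h2 : 4 * y ≤ 3 := by norm_num at h2; linarith
    exact ⟨by rw [ang_re]; exact c2 y (by linarith) h2, by rw [ang_im]; exact s2 y h1 (by linarith)⟩
  · have h1 : 3 ≤ 4 * y := by simpa using h1
    have h2 : 4 * y ≤ 4 := by norm_num at h2; linarith
    exact ⟨by rw [ang_re]; exact c3 y h1 h2, by rw [ang_im]; exact s2 y (by linarith) h2⟩

theorem ang_mem_quad {n : ℕ} {x : ℝ} (h1 : (n : ℝ) ≤ 4 * x) (h2 : 4 * x ≤ n + 1) :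
    (ang x : ℂ) ∈ quad (quadIndex n) := by
  have hn : (n : ℝ) = 4 * (n / 4 : ℕ) + (quadIndex n : ℕ) := by
    have : n = 4 * (n / 4) + (quadIndex n : ℕ) := (Nat.div_add_mod n 4).symm
    exact_mod_cast this
  have h := ang_add_intCast (x - (n / 4 : ℕ)) ((n / 4 : ℕ) : ℤ)
  rw [Int.cast_natCast, sub_add_cancel] at h
  rw [h]
  exact ang_mem_quad_of_le (by linarith) (by linarith)

theorem smul_mem_quad {j : Fin 4} {ζ : ℂ} (h : ζ ∈ quad j) {c : ℝ} (hc : 0 ≤ c) :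
    (c : ℂ) * ζ ∈ quad j := by
  fin_cases j
  · exact ⟨by rw [Complex.re_ofReal_mul]; exact mul_nonneg hc h.1,
      by rw [Complex.im_ofReal_mul]; exact mul_nonneg hc h.2⟩
  · exact ⟨by rw [Complex.re_ofReal_mul]; exact mul_nonpos_of_nonneg_of_nonpos hc h.1,
      by rw [Complex.im_ofReal_mul]; exact mul_nonneg hc h.2⟩
  · exact ⟨by rw [Complex.re_ofReal_mul]; exact mul_nonpos_of_nonneg_of_nonpos hc h.1,
      by rw [Complex.im_ofReal_mul]; exact mul_nonpos_of_nonneg_of_nonpos hc h.2⟩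
  · exact ⟨by rw [Complex.re_ofReal_mul]; exact mul_nonneg hc h.1,
      by rw [Complex.im_ofReal_mul]; exact mul_nonpos_of_nonneg_of_nonpos hc h.2⟩

theorem exists_ang_of_mem_quad_zero {ζ : ℂ} (h : ζ ∈ quad 0) :
    ∃ x : ℝ, 0 ≤ 4 * x ∧ 4 * x ≤ 1 ∧ ζ = ‖ζ‖ * ang x := by
  have hπ := Real.pi_pos
  have h1 : 0 ≤ Complex.arg ζ := Complex.arg_nonneg_iff.2 h.2
  have h2 : Complex.arg ζ ≤ Real.pi / 2 := Complex.arg_le_pi_div_two_iff.2 (Or.inl h.1)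
  refine ⟨Complex.arg ζ / (2 * Real.pi), by positivity, ?_, ?_⟩
  · rw [mul_div_assoc', div_le_one (by positivity)]
    linarith
  · have h3 : 2 * Real.pi * (Complex.arg ζ / (2 * Real.pi)) = Complex.arg ζ := by field_simp
    simp only [ang, h3]
    exact (Complex.norm_mul_exp_arg_mul_I ζ).symm

theorem ang_add_quarter (x : ℝ) : (ang (x + 1 / 4) : ℂ) = Complex.I * ang x := by
  refine Complex.ext ?_ ?_
  · rw [Complex.I_mul_re, ang_re, ang_im, ← Real.cos_add_pi_div_two]
    congr 1; ring
  · rw [Complex.I_mul_im, ang_re, ang_im, ← Real.sin_add_pi_div_two]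
    congr 1; ring

theorem exists_ang_of_mem_quad {j : Fin 4} {ζ : ℂ} (h : ζ ∈ quad j) :
    ∃ x : ℝ, (j : ℝ) ≤ 4 * x ∧ 4 * x ≤ j + 1 ∧ ζ = ‖ζ‖ * ang x := by
  -- Multiplication by -i carries each quadrant to the preceding one, which reduces everything to
  -- the first quadrant.
  have step : ∀ {ζ : ℂ} {c : ℝ}, (∃ x : ℝ, c ≤ 4 * x ∧ 4 * x ≤ c + 1 ∧
      -Complex.I * ζ = ‖-Complex.I * ζ‖ * ang x) →
      ∃ x : ℝ, c + 1 ≤ 4 * x ∧ 4 * x ≤ c + 1 + 1 ∧ ζ = ‖ζ‖ * ang x := by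
    rintro ζ c ⟨x, h1, h2, h3⟩
    refine ⟨x + 1 / 4, by linarith, by linarith, ?_⟩
    rw [ang_add_quarter]
    rw [norm_mul, norm_neg, Complex.norm_I, one_mul] at h3
    calc ζ = Complex.I * (-Complex.I * ζ) := by rw [← mul_assoc]; simp
      _ = _ := by rw [h3]; ring
  have re1 : ∀ ζ : ℂ, (-Complex.I * ζ).re = ζ.im := fun ζ => by simp
  have im1 : ∀ ζ : ℂ, (-Complex.I * ζ).im = -ζ.re := fun ζ => by simp
  have q0 : ∀ {ζ : ℂ}, ζ ∈ quad 0 → ∃ x : ℝ, 0 ≤ 4 * x ∧ 4 * x ≤ 0 + 1 ∧ ζ = ‖ζ‖ * ang x := by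
    intro ζ h
    obtain ⟨x, h1, h2, h3⟩ := exists_ang_of_mem_quad_zero h
    exact ⟨x, h1, by linarith, h3⟩
  have q1 : ∀ {ζ : ℂ}, ζ ∈ quad 1 → ∃ x : ℝ, 0 + 1 ≤ 4 * x ∧ 4 * x ≤ 0 + 1 + 1 ∧
      ζ = ‖ζ‖ * ang x := fun {ζ} h =>
    step (q0 ⟨by rw [re1]; exact h.2, by rw [im1]; exact neg_nonneg.2 h.1⟩)
  have q2 : ∀ {ζ : ℂ}, ζ ∈ quad 2 → ∃ x : ℝ, 0 + 1 + 1 ≤ 4 * x ∧ 4 * x ≤ 0 + 1 + 1 + 1 ∧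
      ζ = ‖ζ‖ * ang x := fun {ζ} h =>
    step (q1 ⟨by rw [re1]; exact h.2, by rw [im1]; exact neg_nonneg.2 h.1⟩)
  have q3 : ∀ {ζ : ℂ}, ζ ∈ quad 3 → ∃ x : ℝ, 0 + 1 + 1 + 1 ≤ 4 * x ∧
      4 * x ≤ 0 + 1 + 1 + 1 + 1 ∧ ζ = ‖ζ‖ * ang x := fun {ζ} h =>
    step (q2 ⟨by rw [re1]; exact h.2, by rw [im1]; exact neg_nonpos.2 h.1⟩)
  fin_cases j
  · obtain ⟨x, h1, h2, h3⟩ := q0 h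
    exact ⟨x, by norm_num; linarith, by norm_num; linarith, h3⟩
  · obtain ⟨x, h1, h2, h3⟩ := q1 h
    exact ⟨x, by norm_num; linarith, by norm_num; linarith, h3⟩
  · obtain ⟨x, h1, h2, h3⟩ := q2 h
    exact ⟨x, by norm_num; linarith, by norm_num; linarith, h3⟩
  · obtain ⟨x, h1, h2, h3⟩ := q3 h
    exact ⟨x, by norm_num; linarith, by norm_num; linarith, h3⟩

theorem ang_mul (d : ℕ) (x : ℝ) : (ang (d * x) : ℂ) = (ang x : ℂ) ^ d := by
  simp only [ang]
  rw [← Complex.exp_nat_mul]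
  congr 1
  push_cast
  ring

theorem polar_pow (p : unitInterval × ℝ) (d : ℕ) :
    (polar p : ℂ) ^ d = (p.1 : ℝ) ^ d * ang (d * p.2) := by
  rw [ang_mul, polar, mul_pow]

/-! ### Cells and sectors over a small disc -/

section

variable {Sh : Type*} {τ σ σ' : Equiv.Perm Sh} {a : ℝ × ℝ} (D : LocalGluing τ σ σ' a)

/-- The part of the surface over the disc around `a` with the label `w`. -/
def cell (w : Sh) : Set (SquareSurface τ σ σ') :=
  {y | Quot.lift (fun t => torusPt t.2.1 t.2.2 ∈ D.disc ∧ D.ρ.SameCycle (D.label t) w) (by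
    intro t t' h
    have hp : torusPt t.2.1 t.2.2 = torusPt t'.2.1 t'.2.2 :=
      congrArg (squareProj τ σ σ') (Quot.sound h)
    rw [← hp]
    refine propext (and_congr_right fun ht => ?_)
    have h' := D.label_rel h ht
    exact ⟨fun h => h'.symm.trans h, fun h => h'.trans h⟩) y}

theorem mk_mem_cell {t : Sh × unitInterval × unitInterval} {w : Sh} :
    Quot.mk (SquareRel τ σ σ') t ∈ D.cell w ↔
      torusPt t.2.1 t.2.2 ∈ D.disc ∧ D.ρ.SameCycle (D.label t) w := Iff.rfl

theorem continuous_squareProj [TopologicalSpace Sh] : Continuous (squareProj τ σ σ') := by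
  refine continuous_quot_lift _ ?_
  exact continuous_torusPt.comp (f := fun t : Sh × unitInterval × unitInterval =>
    ((t.2.1 : ℝ), (t.2.2 : ℝ))) (by fun_prop)

theorem isOpenMap_torusPt : IsOpenMap fun p : ℝ × ℝ => torusPt p.1 p.2 :=
  (QuotientAddGroup.isOpenMap_coe (G := ℝ) (N := AddSubgroup.zmultiples (1 : ℝ))).prodMap
    QuotientAddGroup.isOpenMap_coe

theorem isOpen_disc : IsOpen D.disc := by
  have h : D.disc = (fun p : ℝ × ℝ => torusPt p.1 p.2) ''
      ((fun p : ℝ × ℝ => (⟨p.1 - a.1, p.2 - a.2⟩ : ℂ)) ⁻¹' Metric.ball 0 D.ε) := by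
    ext b
    constructor
    · rintro ⟨ζ, hζ, rfl⟩
      exact ⟨(a.1 + ζ.re, a.2 + ζ.im), by simpa using hζ, rfl⟩
    · rintro ⟨p, hp, rfl⟩
      exact ⟨_, mem_ball_zero_iff.1 hp, by simp⟩
  rw [h]
  exact isOpenMap_torusPt _ (Metric.isOpen_ball.preimage
    (continuous_mk_complex (by fun_prop) (by fun_prop)))

/-- Openness is tested on the squares, where the label is locally constant. -/
theorem isOpen_cell [TopologicalSpace Sh] [DiscreteTopology Sh] (w : Sh) : IsOpen (D.cell w) := by
  rw [← isQuotientMap_quot_mk.isOpen_preimage, isOpen_iff_mem_nhds]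
  rintro t ⟨h1, h2⟩
  have hc : Continuous fun t : Sh × unitInterval × unitInterval => torusPt t.2.1 t.2.2 :=
    (continuous_squareProj (τ := τ) (σ := σ) (σ' := σ')).comp continuous_quot_mk
  filter_upwards [D.eventually_label_eq h1, hc.continuousAt.eventually_mem
    (D.isOpen_disc.mem_nhds h1)] with t' h3 h4
  exact D.mk_mem_cell.2 ⟨h4, by rwa [h3]⟩

theorem continuous_sq [TopologicalSpace Sh] (j : Fin 4) (w : Sh) : Continuous (D.sq j w) := by
  unfold sq
  have := continuous_projIcc (h := zero_le_one (α := ℝ))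
  fun_prop

/-- Going once around `a`, sector by sector. -/
def sector (w : Sh) (n : ℕ) (ζ : ℂ) : SquareSurface τ σ σ' :=
  Quot.mk _ (D.sq (quadIndex n) ((D.ρ ^ (n / 4)) w) ζ)

/-- The exponent n / 4 counts completed turns; it increases exactly when the last quadrant is left,
and so absorbs the factor `ρ` of `mk_sq_add_one`. -/
theorem sector_succ (w : Sh) {n : ℕ} {ζ : ℂ} (h1 : ζ ∈ quad (quadIndex n))
    (h2 : ζ ∈ quad (quadIndex (n + 1))) (h : ‖ζ‖ ≤ D.ε) :
    D.sector w n ζ = D.sector w (n + 1) ζ := by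
  rw [sector, sector, quadIndex_succ]
  rw [quadIndex_succ] at h2
  rw [D.mk_sq_add_one h1 h2 h]
  by_cases hj : quadIndex n = 3
  · rw [if_pos hj, (quadIndex_eq_three_iff n).1 hj, pow_succ', Equiv.Perm.mul_apply]
  · rw [if_neg hj]
    have : (n + 1) / 4 = n / 4 := by
      have := mt (quadIndex_eq_three_iff n).2 hj
      omega
    rw [this]

theorem zero_mem_quad (j : Fin 4) : (0 : ℂ) ∈ quad j := by
  fin_cases j <;> exact ⟨le_rfl, le_rfl⟩

/-- The centre belongs to all quadrants, so consecutive sectors share it. -/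
theorem sector_zero (w : Sh) (n : ℕ) : D.sector w n 0 = D.sector w 0 0 := by
  induction n with
  | zero => rfl
  | succ n ih =>
    rw [← D.sector_succ w (zero_mem_quad _) (zero_mem_quad _) (by simpa using D.ε_pos.le), ih]

theorem continuous_sector [TopologicalSpace Sh] (w : Sh) (n : ℕ) : Continuous (D.sector w n) :=
  continuous_quot_mk.comp (D.continuous_sq _ _)

theorem norm_le_of_disc (z : Disc) (d : ℕ) : ‖(D.ε : ℂ) * (z : ℂ) ^ d‖ ≤ D.ε := by
  rw [norm_mul, Complex.norm_real, Real.norm_of_nonneg D.ε_pos.le, norm_pow]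
  exact mul_le_of_le_one_right D.ε_pos.le
    (pow_le_one₀ (norm_nonneg _) (mem_closedBall_zero_iff.1 z.2))

theorem mem_quad_of_polar {d n : ℕ} {p : unitInterval × ℝ} (h1 : (n : ℝ) ≤ 4 * (d * p.2))
    (h2 : 4 * (d * p.2) ≤ n + 1) : (D.ε : ℂ) * (polar p : ℂ) ^ d ∈ quad (quadIndex n) := by
  refine smul_mem_quad ?_ D.ε_pos.le
  rw [polar_pow]
  have := smul_mem_quad (ang_mem_quad h1 h2) (pow_nonneg p.1.2.1 d)
  rwa [Complex.ofReal_pow] at this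

/-- A branched disc around a point over `a`. -/
theorem exists_sectorDisc [TopologicalSpace Sh] {w : Sh} {d : ℕ} (hd : 0 < d)
    (hw : (D.ρ ^ d) w = w) :
    ∃ ψ : Disc → SquareSurface τ σ σ', Continuous ψ ∧
      ∀ (n : ℕ) (r θ : unitInterval), (n : ℝ) ≤ 4 * (d * θ) → 4 * (d * (θ : ℝ)) ≤ (n : ℝ) + 1 →
        ψ (polar (r, θ)) = D.sector w n (D.ε * (polar (r, θ) : ℂ) ^ d) := by
  let μ : unitInterval × unitInterval → Disc := fun p => polar (p.1, p.2)
  have hμc : Continuous μ := continuous_polar.comp (by fun_prop)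
  have hμs : Function.Surjective μ := fun z => by
    obtain ⟨r, x, hx, h⟩ := exists_polar_eq z
    exact ⟨(r, ⟨x, hx.1, hx.2.le⟩), h⟩
  have hμ : IsQuotientMap μ := hμc.isClosedMap.isQuotientMap hμc hμs
  let F : ℕ → unitInterval × unitInterval → SquareSurface τ σ σ' := fun n p =>
    D.sector w n (D.ε * (μ p : ℂ) ^ d)
  have hF : ∀ n, Continuous (F n) := fun n => (D.continuous_sector w n).comp (by fun_prop)
  -- The sector is chosen by the number of quarter turns that the d-th power has completed.
  let Γ : unitInterval × unitInterval → SquareSurface τ σ σ' := fun p => F ⌊4 * (d * (p.2 : ℝ))⌋₊ p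
  have hΓ : ∀ (n : ℕ) (p : unitInterval × unitInterval), (n : ℝ) ≤ 4 * (d * p.2) →
      4 * (d * (p.2 : ℝ)) ≤ (n : ℝ) + 1 → Γ p = F n p := by
    intro n p h1 h2
    rcases h2.eq_or_lt with h | h
    · have hfl : ⌊4 * (d * (p.2 : ℝ))⌋₊ = n + 1 := by
        rw [h]
        exact_mod_cast Nat.floor_natCast (n + 1)
      show F _ p = F n p
      rw [hfl]
      refine (D.sector_succ w (D.mem_quad_of_polar (p := (p.1, p.2)) h1 h2)
        (D.mem_quad_of_polar (p := (p.1, p.2)) ?_ ?_) (D.norm_le_of_disc _ _)).symm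
      · push_cast; exact h.ge
      · push_cast; linarith
    · have hfl : ⌊4 * (d * (p.2 : ℝ))⌋₊ = n := by
        rw [Nat.floor_eq_iff (by have := p.2.2.1; positivity)]
        exact ⟨h1, h⟩
      show F _ p = F n p
      rw [hfl]
  have hΓc : Continuous Γ := by
    -- Finitely many closed sectors cover the parameter square, and on each of them the map is given
    -- by one continuous formula.
    let A : Fin (4 * d) → Set (unitInterval × unitInterval) := fun n =>
      {p | ((n : ℕ) : ℝ) ≤ 4 * (d * p.2) ∧ 4 * (d * (p.2 : ℝ)) ≤ ((n : ℕ) : ℝ) + 1}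
    refine (locallyFinite_of_finite A).continuous ?_ (fun n => ?_) fun n => ?_
    · refine eq_univ_of_forall fun p => mem_iUnion.2 ?_
      have h0 := p.2.2.1
      have h1 := p.2.2.2
      have hdp : (0 : ℝ) < d := by exact_mod_cast hd
      by_cases h : p.2 = 1
      · refine ⟨⟨4 * d - 1, by omega⟩, ?_⟩
        have : ((4 * d - 1 : ℕ) : ℝ) = 4 * d - 1 := by
          rw [Nat.cast_sub (by omega)]; push_cast; ring
        simp only [A, h, mem_ofPred_eq, this, Set.Icc.coe_one]
        constructor <;> linarith
      · have h2 : (p.2 : ℝ) < 1 := lt_of_le_of_ne h1 fun h' => h (Subtype.ext h')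
        have h3 : 0 ≤ 4 * (d * (p.2 : ℝ)) := by positivity
        refine ⟨⟨⌊4 * (d * (p.2 : ℝ))⌋₊, ?_⟩, Nat.floor_le h3, (Nat.lt_floor_add_one _).le⟩
        rw [Nat.floor_lt h3]
        push_cast
        nlinarith
    · have hc : Continuous fun p : unitInterval × unitInterval => 4 * (d * (p.2 : ℝ)) := by
        fun_prop
      exact (isClosed_le continuous_const hc).inter (isClosed_le hc continuous_const)
    · exact (hF n).continuousOn.congr fun p hp => hΓ n p hp.1 hp.2
  have hlift : ∀ p q, μ p = μ q → Γ p = Γ q := by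
    have hzero : ∀ p, p.1 = 0 → Γ p = D.sector w 0 0 := by
      intro p hp
      have : (μ p : ℂ) = 0 := by simp [μ, polar, hp]
      show D.sector w _ _ = _
      rw [this, zero_pow hd.ne', mul_zero, sector_zero]
    -- One turn in the source is d turns in the target, after which the monodromy has returned to
    -- `w`.
    have hone : ∀ r, Γ (r, 1) = Γ (r, 0) := by
      intro r
      have h01 : μ (r, 1) = μ (r, 0) := polar_eq_polar_iff.2 ⟨rfl, Or.inr ⟨1, by simp⟩⟩
      rw [hΓ (4 * d) (r, 1) (by simp) (by simp), hΓ 0 (r, 0) (by simp) (by simp)]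
      show D.sector w _ _ = D.sector w _ _
      rw [h01, sector, sector]
      have e1 : quadIndex (4 * d) = quadIndex 0 := by
        ext; simp [quadIndex]
      have e2 : 4 * d / 4 = d := by omega
      rw [e1, e2, hw]
      rfl
    intro p q hpq
    obtain ⟨h1, h2⟩ := polar_eq_polar_iff.1 hpq
    have h1 : p.1 = q.1 := h1
    rcases h2 with h2 | ⟨n, hn⟩
    · have h2 : p.1 = 0 := h2
      rw [hzero p h2, hzero q (h1 ▸ h2)]
    · have hn : (p.2 : ℝ) = q.2 + n := hn
      have p0 := p.2.2.1
      have p1 := p.2.2.2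
      have q0 := q.2.2.1
      have q1 := q.2.2.2
      have hn1 : (n : ℝ) ≤ 1 := by linarith
      have hn2 : (-1 : ℝ) ≤ n := by linarith
      have hn1 : n ≤ 1 := by exact_mod_cast hn1
      have hn2 : -1 ≤ n := by exact_mod_cast hn2
      have : n = -1 ∨ n = 0 ∨ n = 1 := by omega
      rcases this with rfl | rfl | rfl
      · push_cast at hn
        have hp : p = (p.1, 0) := Prod.ext rfl (Subtype.ext (by
          simp only [Set.Icc.coe_zero]; linarith))
        have hq : q = (p.1, 1) := Prod.ext h1.symm (Subtype.ext (by
          simp only [Set.Icc.coe_one]; linarith))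
        rw [hp, hq]
        exact (hone _).symm
      · have : p = q := Prod.ext h1 (Subtype.ext (by simpa using hn))
        rw [this]
      · push_cast at hn
        have hp : p = (p.1, 1) := Prod.ext rfl (Subtype.ext (by
          simp only [Set.Icc.coe_one]; linarith))
        have hq : q = (p.1, 0) := Prod.ext h1.symm (Subtype.ext (by
          simp only [Set.Icc.coe_zero]; linarith))
        rw [hp, hq]
        exact hone _
  choose κ hκ using hμs
  have hψ : ∀ p, Γ (κ (μ p)) = Γ p := fun p => hlift _ _ (hκ _)
  refine ⟨fun z => Γ (κ z), hμ.continuous_iff.2 ?_, fun n r θ h1 h2 => ?_⟩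
  · exact hΓc.congr fun p => (hψ p).symm
  · exact (hψ (r, θ)).trans (hΓ n (r, θ) h1 h2)

end

end LocalGluing

end

section

namespace LocalGluing

/-! ### Injectivity and image of the branched discs -/

section

variable {Sh : Type*} {τ σ σ' : Equiv.Perm Sh} {a : ℝ × ℝ} (D : LocalGluing τ σ σ' a)

theorem torusPt_mem_disc {ζ : ℂ} (h : ‖ζ‖ < D.ε) : torusPt (a.1 + ζ.re) (a.2 + ζ.im) ∈ D.disc :=
  ⟨ζ, h, rfl⟩

theorem mem_disc : torusPt a.1 a.2 ∈ D.disc := ⟨0, by simpa using D.ε_pos, by simp⟩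

/-- The radius is below 1/4, so two offsets cannot differ by a nonzero integer in a coordinate. -/
theorem offset_injective {ζ ζ' : ℂ} (h : ‖ζ‖ ≤ D.ε) (h' : ‖ζ'‖ ≤ D.ε)
    (he : torusPt (a.1 + ζ.re) (a.2 + ζ.im) = torusPt (a.1 + ζ'.re) (a.2 + ζ'.im)) : ζ = ζ' := by
  have key : ∀ c x y : ℝ, |x| ≤ D.ε → |y| ≤ D.ε →
      ((c + x : ℝ) : UnitAddCircle) = ((c + y : ℝ) :) → x = y := by
    intro c x y hx hy hxy
    obtain ⟨n, hn⟩ := coe_unitAddCircle_eq_iff.1 hxy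
    obtain ⟨x1, x2⟩ := abs_le.1 hx
    obtain ⟨y1, y2⟩ := abs_le.1 hy
    have hε := D.ε_lt
    have n1 : (n : ℝ) < 1 := by linarith
    have n2 : (-1 : ℝ) < n := by linarith
    have : n = 0 := by
      have n1 : n < 1 := by exact_mod_cast n1
      have n2 : -1 < n := by exact_mod_cast n2
      omega
    subst this
    push_cast at hn
    linarith
  exact Complex.ext (key _ _ _ (abs_re_le h) (abs_re_le h') (congrArg Prod.fst he))
    (key _ _ _ (abs_im_le h) (abs_im_le h') (congrArg Prod.snd he))

theorem torusPt_notMem_slitEnds {ζ : ℂ} (h : ‖ζ‖ ≤ D.ε) (h0 : ζ ≠ 0) :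
    torusPt (a.1 + ζ.re) (a.2 + ζ.im) ∉ slitEnds := by
  intro hb
  refine h0 (D.offset_injective h (by simpa using D.ε_pos.le) ?_)
  have key : ∀ c x : ℝ, |x| ≤ D.ε →
      dist ((c + x : ℝ) : UnitAddCircle) (c : UnitAddCircle) ≤ D.ε := by
    intro c x hx
    rw [dist_eq_norm, ← AddCircle.coe_sub, add_sub_cancel_left]
    exact QuotientAddGroup.norm_mk_le_norm.trans hx
  rw [D.isolated _ hb (Metric.mem_closedBall.2 (max_le (key _ _ (abs_re_le h))
    (key _ _ (abs_im_le h))))]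
  simp

end

end LocalGluing

section

variable {Sh : Type*} {τ σ σ' : Equiv.Perm Sh}

/-- The monodromy is trivial here, so lying in the same cycle means equality, and for fixed
coordinates the label determines the square. -/
theorem eq_of_mk_eq {x y : unitInterval} (h : torusPt x y ∉ slitEnds) {s s' : Sh}
    (he : Quot.mk (SquareRel τ σ σ') (s, x, y) = Quot.mk _ (s', x, y)) : s = s' := by
  obtain ⟨a, ha, hxy⟩ := exists_torusPt_eq (torusPt x y)
  obtain ⟨D, hD, -⟩ := exists_localGluing τ σ σ' ha
  have hρ := hD (hxy ▸ h)
  have hm : Quot.mk (SquareRel τ σ σ') (s', x, y) ∈ D.cell (D.label (s', x, y)) :=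
    D.mk_mem_cell.2 ⟨show torusPt x y ∈ _ from hxy ▸ D.mem_disc, Equiv.Perm.SameCycle.refl _ _⟩
  rw [← he, D.mk_mem_cell, hρ, Equiv.Perm.sameCycle_one] at hm
  exact (Equiv.injective _ ((Equiv.injective _) hm.2))

end

namespace LocalGluing

section

variable {Sh : Type*} {τ σ σ' : Equiv.Perm Sh} {a : ℝ × ℝ} (D : LocalGluing τ σ σ' a)

theorem exists_nat_sector (d : ℕ) (p : unitInterval × ℝ) (hp : 0 ≤ p.2) :
    ((⌊4 * (d * p.2)⌋₊ : ℕ) : ℝ) ≤ 4 * (d * p.2) ∧ 4 * (d * p.2) ≤ (⌊4 * (d * p.2)⌋₊ : ℕ) + 1 :=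
  ⟨Nat.floor_le (by positivity), (Nat.lt_floor_add_one _).le⟩

/-- A branched disc which covers the part of the surface over the disc around `a` with the
label `w`. -/
theorem exists_branchedDisc [Finite Sh] [TopologicalSpace Sh] (w : Sh) :
    ∃ d > 0, (D.ρ w = w → d = 1) ∧ (D.ρ w ≠ w → 2 ≤ d) ∧
      ∃ ψ : Disc → SquareSurface τ σ σ', Continuous ψ ∧ Function.Injective ψ ∧
        (∀ z : Disc, squareProj τ σ σ' (ψ z) = torusPt (a.1 + (D.ε * (z : ℂ) ^ d).re)
          (a.2 + (D.ε * (z : ℂ) ^ d).im)) ∧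
        ψ '' {z | ‖(z : ℂ)‖ < 1} = D.cell w ∧
        ∀ z : Disc, (z : ℂ) = 0 → ψ z = Quot.mk _ (D.sq 0 w 0) := by
  obtain ⟨d, hd, hdvd⟩ := exists_period D.ρ w
  obtain ⟨ψ, hψc, hψ⟩ := D.exists_sectorDisc hd ((hdvd d).2 dvd_rfl)
  have hdR : (0 : ℝ) < d := by exact_mod_cast hd
  have hrep : ∀ z : Disc, ∃ r θ : unitInterval, (θ : ℝ) < 1 ∧ polar (r, θ) = z := by
    intro z
    obtain ⟨r, x, hx, h⟩ := exists_polar_eq z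
    exact ⟨r, ⟨x, hx.1, hx.2.le⟩, hx.2, h⟩
  have hproj : ∀ z : Disc, squareProj τ σ σ' (ψ z) = torusPt (a.1 + (D.ε * (z : ℂ) ^ d).re)
      (a.2 + (D.ε * (z : ℂ) ^ d).im) := by
    intro z
    obtain ⟨r, θ, -, rfl⟩ := hrep z
    obtain ⟨h1, h2⟩ := exists_nat_sector d (r, θ) θ.2.1
    rw [hψ _ r θ h1 h2]
    exact D.squareProj_sq (D.mem_quad_of_polar (p := (r, θ)) h1 h2) (D.norm_le_of_disc _ _) _
  refine ⟨d, hd, fun h => ?_, fun h => ?_, ψ, hψc, ?_, hproj, ?_, ?_⟩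
  · exact Nat.dvd_one.1 ((hdvd 1).1 (by simpa using h))
  · by_contra hlt
    have : d = 1 := by omega
    exact h (by simpa using (hdvd 1).2 (by rw [this]))
  · have hpow : ∀ z z' : Disc, ψ z = ψ z' → (z : ℂ) ^ d = (z' : ℂ) ^ d := by
      intro z z' h
      have h' := congrArg (squareProj τ σ σ') h
      rw [hproj, hproj] at h'
      have h'' := D.offset_injective (D.norm_le_of_disc z d) (D.norm_le_of_disc z' d) h'
      exact mul_left_cancel₀ (by exact_mod_cast D.ε_pos.ne') h''
    -- Equal d-th powers force angles that differ by k / d with 0 ≤ k < d, so the sectors differ by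
    -- k full turns. Away from the centre the squares can be compared, which gives `ρ ^ k` fixing
    -- `w`; hence d divides k and k = 0.
    have key : ∀ r θ r' θ' : unitInterval, (θ' : ℝ) < 1 → (θ : ℝ) ≤ θ' →
        ψ (polar (r, θ)) = ψ (polar (r', θ')) → polar (r, θ) = polar (r', θ') := by
      intro r θ r' θ' hθ' hle h
      have hp := hpow _ _ h
      by_cases h0 : (polar (r, θ) : ℂ) = 0
      · rw [h0, zero_pow hd.ne', eq_comm, pow_eq_zero_iff hd.ne'] at hp
        exact Subtype.ext (h0.trans hp.symm)
      have hr : r = r' := by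
        have := congrArg norm hp
        rw [norm_pow, norm_pow, norm_polar, norm_polar] at this
        exact Subtype.ext ((pow_left_inj₀ r.2.1 r'.2.1 hd.ne').1 this)
      subst hr
      have hr0 : (r : ℝ) ≠ 0 := by
        intro hr0
        exact h0 (by simp [polar, hr0])
      obtain ⟨k, hk⟩ : ∃ k : ℤ, (d * θ' : ℝ) = d * θ + k := by
        rw [polar_pow, polar_pow] at hp
        have := mul_left_cancel₀ (by exact_mod_cast pow_ne_zero d hr0) hp
        exact ang_eq_ang_iff.1 (Subtype.ext this.symm)
      have hk0 : 0 ≤ k := by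
        have : (0 : ℝ) ≤ k := by nlinarith
        exact_mod_cast this
      lift k to ℕ using hk0
      push_cast at hk
      have hkd : k < d := by
        have h0 := θ.2.1
        have : (k : ℝ) < d := by nlinarith
        exact_mod_cast this
      obtain ⟨h1, h2⟩ := exists_nat_sector d (r, θ) θ.2.1
      generalize ⌊4 * (d * ((r, (θ : ℝ)) : unitInterval × ℝ).2)⌋₊ = n at h1 h2
      have hζ := D.mem_quad_of_polar (p := (r, θ)) h1 h2
      have h3 : ((n + 4 * k : ℕ) : ℝ) ≤ 4 * (d * θ') := by
        push_cast
        rw [hk]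
        linarith
      have h4 : 4 * (d * (θ' : ℝ)) ≤ ((n + 4 * k : ℕ) : ℝ) + 1 := by
        push_cast
        rw [hk]
        linarith
      rw [hψ n r θ h1 h2, hψ (n + 4 * k) r θ' h3 h4, ← hp, sector, sector] at h
      have hq : quadIndex (n + 4 * k) = quadIndex n := by
        ext; simp [quadIndex]
      have hm : (n + 4 * k) / 4 = n / 4 + k := by omega
      rw [hq, hm] at h
      have hne : (D.ε : ℂ) * (polar (r, θ) : ℂ) ^ d ≠ 0 :=
        mul_ne_zero (by exact_mod_cast D.ε_pos.ne') (pow_ne_zero _ h0)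
      have hoff := D.torusPt_notMem_slitEnds (D.norm_le_of_disc (polar (r, θ)) d) hne
      rw [← D.squareProj_sq hζ (D.norm_le_of_disc _ _) w] at hoff
      have hs := Equiv.injective _ (eq_of_mk_eq hoff h)
      rw [pow_add, Equiv.Perm.mul_apply] at hs
      have hdk := (hdvd k).1 (Equiv.injective _ hs).symm
      have hk0 : k = 0 := Nat.eq_zero_of_dvd_of_lt hdk hkd
      subst hk0
      have : (θ : ℝ) = θ' := by
        push_cast at hk
        exact mul_left_cancel₀ hdR.ne' (by linarith)
      rw [this]
    intro z z' h
    obtain ⟨r, θ, hθ, rfl⟩ := hrep z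
    obtain ⟨r', θ', hθ', rfl⟩ := hrep z'
    rcases le_total (θ : ℝ) θ' with hle | hle
    · exact key _ _ _ _ hθ' hle h
    · exact (key _ _ _ _ hθ hle h.symm).symm
  · ext y
    constructor
    · rintro ⟨z, hz, rfl⟩
      obtain ⟨r, θ, -, rfl⟩ := hrep z
      obtain ⟨h1, h2⟩ := exists_nat_sector d (r, θ) θ.2.1
      have hζ := D.mem_quad_of_polar (p := (r, θ)) h1 h2
      have hn := D.norm_le_of_disc (polar (r, θ)) d
      have hP := hproj (polar (r, θ))
      rw [hψ _ r θ h1 h2] at hP ⊢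
      refine D.mk_mem_cell.2 ⟨?_, (D.label_sq hζ hn _).trans (Equiv.Perm.sameCycle_pow_left.2
        (Equiv.Perm.SameCycle.refl _ _))⟩
      refine ⟨_, ?_, hP⟩
      rw [norm_mul, Complex.norm_real, Real.norm_of_nonneg D.ε_pos.le, norm_pow]
      exact mul_lt_of_lt_one_right D.ε_pos (pow_lt_one₀ (norm_nonneg _) hz hd.ne')
    · intro hy
      induction y using Quot.ind with | mk t => ?_
      obtain ⟨⟨ζ, hζ, hζt⟩, hl⟩ := D.mk_mem_cell.1 hy
      obtain ⟨j, v, hj, rfl⟩ := D.exists_sq hζ.le hζt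
      have hvw := ((D.label_sq hj hζ.le v).symm.trans hl).symm
      -- The square of the given point is reached from `w` after i turns, which may be reduced
      -- modulo the period.
      obtain ⟨i, hi⟩ := hvw.exists_nat_pow_eq
      have hi' : (D.ρ ^ (i % d)) w = v := by
        rw [← hi]
        conv_rhs => rw [← Nat.mod_add_div i d]
        rw [pow_add, Equiv.Perm.mul_apply, (hdvd (d * (i / d))).2 (dvd_mul_right _ _)]
      have hid : ((i % d : ℕ) : ℝ) + 1 ≤ d := by exact_mod_cast Nat.mod_lt i hd
      generalize i % d = m at hi' hid
      obtain ⟨x, hx1, hx2, hx⟩ := exists_ang_of_mem_quad hj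
      have hj3 : ((j : ℕ) : ℝ) ≤ 3 := by exact_mod_cast Nat.le_of_lt_succ j.2
      have hj0 : (0 : ℝ) ≤ (j : ℕ) := Nat.cast_nonneg _
      have hm0 : (0 : ℝ) ≤ m := Nat.cast_nonneg _
      have hq0 : 0 ≤ ‖ζ‖ / D.ε := div_nonneg (norm_nonneg _) D.ε_pos.le
      have hq1 : ‖ζ‖ / D.ε < 1 := (div_lt_one D.ε_pos).2 hζ
      have hρ0 : 0 ≤ (‖ζ‖ / D.ε) ^ ((d : ℝ)⁻¹) := Real.rpow_nonneg hq0 _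
      have hρ1 : (‖ζ‖ / D.ε) ^ ((d : ℝ)⁻¹) < 1 := Real.rpow_lt_one hq0 hq1 (by positivity)
      -- The preimage under the branched disc: the d-th root of the relative radius, and one d-th of
      -- the total angle of m full turns and x.
      let r : unitInterval := ⟨_, hρ0, hρ1.le⟩
      have hr : (r : ℝ) ^ d = ‖ζ‖ / D.ε := Real.rpow_inv_natCast_pow hq0 hd.ne'
      let θ : unitInterval := ⟨(m + x) / d, by
        have : 0 ≤ x := by linarith
        positivity, (div_le_one hdR).2 (by linarith)⟩
      have hθ : (d * θ : ℝ) = m + x := mul_div_cancel₀ _ hdR.ne'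
      refine ⟨polar (r, θ), (norm_polar _).trans_lt hρ1, ?_⟩
      rw [hψ (4 * m + j) r θ (by rw [hθ]; push_cast; linarith) (by rw [hθ]; push_cast; linarith)]
      have e1 : (4 * m + (j : ℕ)) / 4 = m := by omega
      have e2 : (D.ε : ℂ) * (polar (r, θ) : ℂ) ^ d = ζ := by
        rw [polar_pow]
        show (D.ε : ℂ) * ((r : ℝ) ^ d * ang (d * θ)) = ζ
        rw [hθ, add_comm, ← Int.cast_natCast (R := ℝ) m, ang_add_intCast]
        rw [← Complex.ofReal_pow, hr, ← mul_assoc, ← Complex.ofReal_mul,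
          mul_div_cancel₀ _ D.ε_pos.ne', ← hx]
      rw [sector, quadIndex_add, e1, hi', e2]
  · intro z hz
    have hz' : z = polar (0, (0 : unitInterval)) := Subtype.ext (by simp [polar, hz])
    rw [hz', hψ 0 0 0 (by simp) (by simp), ← hz', hz, zero_pow hd.ne', mul_zero]
    rfl

end

end LocalGluing

end

section

/-! ### Branched covers from local degrees -/

section

variable {M N M' N' : Type*} [TopologicalSpace M] [TopologicalSpace N] [TopologicalSpace M']
  [TopologicalSpace N']

/-- An embedded closed disc whose interior is open gives a chart. -/
theorem exists_chart [T2Space M] {ψ : Disc → M} (hc : Continuous ψ) (hi : Function.Injective ψ)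
    (ho : IsOpen (ψ '' {z | ‖(z : ℂ)‖ < 1})) :
    ∃ e : OpenPartialHomeomorph M ℂ, e.source = ψ '' {z | ‖(z : ℂ)‖ < 1} ∧
      ∀ z : Disc, ‖(z : ℂ)‖ < 1 → e (ψ z) = z := by
  let ι : Metric.ball (0 : ℂ) 1 → Disc := inclusion Metric.ball_subset_closedBall
  have hr : range (ψ ∘ ι) = ψ '' {z | ‖(z : ℂ)‖ < 1} := by
    rw [range_comp]
    congr 1
    ext z
    constructor
    · rintro ⟨z, rfl⟩
      exact mem_ball_zero_iff.1 z.2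
    · exact fun hz => ⟨⟨z, mem_ball_zero_iff.2 hz⟩, rfl⟩
  have hf : IsOpenEmbedding (ψ ∘ ι) :=
    ⟨(hc.isClosedEmbedding hi).isEmbedding.comp (IsEmbedding.inclusion _), hr ▸ ho⟩
  have hv : IsOpenEmbedding (Subtype.val : Metric.ball (0 : ℂ) 1 → ℂ) :=
    Metric.isOpen_ball.isOpenEmbedding_subtypeVal
  have : Nonempty (Metric.ball (0 : ℂ) 1) := ⟨⟨0, by simp⟩⟩
  refine ⟨(hf.toOpenPartialHomeomorph _).symm.trans (hv.toOpenPartialHomeomorph _), ?_, ?_⟩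
  · rw [OpenPartialHomeomorph.trans_source]
    simp [hr]
  · intro z hz
    have h := (hf.toOpenPartialHomeomorph _).left_inv
      (x := (⟨z, mem_ball_zero_iff.2 hz⟩ : Metric.ball (0 : ℂ) 1)) (by simp)
    exact congrArg Subtype.val h

theorem HasLocalDegree.comp_homeomorph {p : M → N} (h : M' ≃ₜ M) (Φ : N ≃ₜ N') {y : M'} {d : ℕ}
    (hp : HasLocalDegree p (h y) d) : HasLocalDegree (Φ ∘ p ∘ h) y d := by
  obtain ⟨hd, e, e', h1, h2, h3, h4, h5, h6⟩ := hp
  refine ⟨hd, h.transOpenPartialHomeomorph e, Φ.symm.transOpenPartialHomeomorph e', by simpa,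
    by simpa, by simpa, by simpa, fun x hx => ?_, fun x hx => ?_⟩
  · have := h5 (x := h x) (by simpa using hx)
    simpa using this
  · have := h6 (h x) (by simpa using hx)
    simpa using this

theorem HasLocalDegree.exists_openPartialHomeomorph {p : M → N} {y : M}
    (hp : HasLocalDegree p y 1) :
    ∃ e : OpenPartialHomeomorph M N, y ∈ e.source ∧ EqOn p e e.source := by
  obtain ⟨-, e, e', h1, h2, h3, h4, h5, h6⟩ := hp
  simp only [pow_one] at h6
  refine ⟨e.trans e'.symm, ?_, ?_⟩
  · rw [OpenPartialHomeomorph.trans_source]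
    refine ⟨h1, ?_⟩
    show e y ∈ e'.target
    rw [← h6 y h1]
    exact e'.map_source h3
  · intro x hx
    rw [OpenPartialHomeomorph.trans_source] at hx
    show p x = e'.symm (e x)
    rw [← h6 x hx.1, e'.left_inv (h5 hx.1)]

/-- Charts of degree one make `p` a local homeomorphism over the complement of `X`; with a compact
Hausdorff source it is then a covering there. -/
theorem isBranchedCover_of_hasLocalDegree [CompactSpace M] [T2Space M] [T2Space N] {p : M → N}
    {X : Set N} (hX : X.Finite) (hc : Continuous p) (hs : Function.Surjective p)
    (hf : ∀ x, (p ⁻¹' {x}).Finite) (h1 : ∀ y, p y ∉ X → HasLocalDegree p y 1)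
    (hb : ∀ y, p y ∈ X → ∃ d, HasLocalDegree p y d) : IsBranchedCover p X where
  finite := hX
  continuous := hc
  surjective := hs
  finite_fiber := hf
  covering := IsCoveringMapOn.of_isLocalHomeomorphOn hc
    (IsLocalHomeomorphOn.mk _ _ fun y hy => (h1 y hy).exists_openPartialHomeomorph)
  local_model := hb

end

/-! ### Square-tiled surfaces as branched covers -/

section

variable {Sh : Type*} {τ σ σ' : Equiv.Perm Sh} {a : ℝ × ℝ} (D : LocalGluing τ σ σ' a)

namespace LocalGluing

theorem exists_eq_sector {y : SquareSurface τ σ σ'}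
    (hy : squareProj τ σ σ' y = torusPt a.1 a.2) : ∃ w, y = D.sector w 0 0 := by
  induction y using Quot.ind with | mk t => ?_
  obtain ⟨j, w, -, rfl⟩ := D.exists_sq (ζ := 0) (by simpa using D.ε_pos.le) (by
    simpa using (show torusPt t.2.1 t.2.2 = _ from hy))
  refine ⟨w, ?_⟩
  have h := D.sector_zero w (4 * 0 + j)
  have e : (4 * 0 + (j : ℕ)) / 4 = 0 := by omega
  rw [← h, sector, quadIndex_add, e]
  rfl

theorem sector_mem_cell (w : Sh) : D.sector w 0 0 ∈ D.cell w := by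
  have h0 : ‖(0 : ℂ)‖ ≤ D.ε := by simpa using D.ε_pos.le
  refine D.mk_mem_cell.2 ⟨?_, D.label_sq (j := 0) (zero_mem_quad 0) h0 w⟩
  exact mem_of_eq_of_mem (D.squareProj_sq (zero_mem_quad 0) h0 w)
    (D.torusPt_mem_disc (by simpa using D.ε_pos))

/-- Turning k times around the centre without leaving it replaces the square by its image under `ρ ^
k`. -/
theorem sector_eq_of_sameCycle [Finite Sh] {w w' : Sh} (h : D.ρ.SameCycle w w') :
    D.sector w 0 0 = D.sector w' 0 0 := by
  obtain ⟨k, hk⟩ := h.exists_nat_pow_eq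
  have e1 : 4 * k / 4 = k := by omega
  have e2 : quadIndex (4 * k) = 0 := quadIndex_add 0 k
  rw [← D.sector_zero w (4 * k), sector, e1, hk, e2]
  rfl

/-- The chart upstairs inverts the branched disc, and the chart downstairs inverts the disc z ↦ a +
εz. Between them the projection is the d-th power, where d is the period of `w`. -/
theorem hasLocalDegree [Finite Sh] [TopologicalSpace Sh] [DiscreteTopology Sh]
    [T2Space (SquareSurface τ σ σ')] (w : Sh) :
    ∃ d, HasLocalDegree (squareProj τ σ σ') (D.sector w 0 0) d ∧ (D.ρ w = w → d = 1) ∧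
      (D.ρ w ≠ w → 2 ≤ d) := by
  obtain ⟨d, hd, hd1, hd2, ψ, hc, hi, hp, hr, h0⟩ := D.exists_branchedDisc w
  have hε := D.ε_pos
  obtain ⟨e, he, he'⟩ := exists_chart hc hi (hr ▸ D.isOpen_cell w)
  let κ : Disc → Torus := fun z =>
    torusPt (a.1 + ((D.ε : ℂ) * z).re) (a.2 + ((D.ε : ℂ) * z).im)
  have hκc : Continuous κ := continuous_torusPt.comp (f := fun z : Disc =>
    (a.1 + ((D.ε : ℂ) * z).re, a.2 + ((D.ε : ℂ) * z).im)) (by fun_prop)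
  have hκn : ∀ z : Disc, ‖(D.ε : ℂ) * z‖ ≤ D.ε := fun z => by
    simpa using D.norm_le_of_disc z 1
  have hκi : Function.Injective κ := fun z z' h => Subtype.ext
    (mul_left_cancel₀ (by exact_mod_cast hε.ne') (D.offset_injective (hκn z) (hκn z') h))
  have hκr : κ '' {z | ‖(z : ℂ)‖ < 1} = D.disc := by
    ext b
    constructor
    · rintro ⟨z, hz, rfl⟩
      refine D.torusPt_mem_disc ?_
      rw [norm_mul, Complex.norm_real, Real.norm_of_nonneg hε.le]
      exact mul_lt_of_lt_one_right hε hz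
    · rintro ⟨ζ, hζ, rfl⟩
      have hn : ‖ζ / D.ε‖ < 1 := by
        rw [norm_div, Complex.norm_real, Real.norm_of_nonneg hε.le]
        exact (div_lt_one hε).2 hζ
      refine ⟨⟨ζ / D.ε, mem_closedBall_zero_iff.2 hn.le⟩, hn, ?_⟩
      simp only [κ, mul_div_cancel₀ ζ (show (D.ε : ℂ) ≠ 0 by exact_mod_cast hε.ne')]
  obtain ⟨e', hs, hs'⟩ := exists_chart hκc hκi (hκr ▸ D.isOpen_disc)
  let o : Disc := ⟨0, by simp⟩
  have ho : ‖(o : ℂ)‖ < 1 := by simp [o]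
  have hpow : ∀ z : Disc, ‖(z : ℂ)‖ < 1 → ∃ u : Disc, (u : ℂ) = (z : ℂ) ^ d ∧ ‖(u : ℂ)‖ < 1 := by
    intro z hz
    have : ‖(z : ℂ) ^ d‖ < 1 := by
      rw [norm_pow]
      exact pow_lt_one₀ (norm_nonneg _) hz hd.ne'
    exact ⟨⟨_, mem_closedBall_zero_iff.2 this.le⟩, rfl, this⟩
  have hpκ : ∀ z u : Disc, (u : ℂ) = (z : ℂ) ^ d → squareProj τ σ σ' (ψ z) = κ u := by
    intro z u hu
    rw [hp]
    simp only [κ, hu]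
  have hy : D.sector w 0 0 = ψ o := (h0 o rfl).symm
  have hpo := hpκ o o (by simp [o, hd.ne'])
  refine ⟨d, ⟨hd, e, e', ?_, ?_, ?_, ?_, ?_, ?_⟩, hd1, hd2⟩
  · rw [hy, he]
    exact ⟨o, ho, rfl⟩
  · rw [hy, he' o ho]
  · rw [hy, hpo, hs]
    exact ⟨o, ho, rfl⟩
  · rw [hy, hpo, hs' o ho]
  · rw [he, hs]
    rintro _ ⟨z, hz, rfl⟩
    obtain ⟨u, hu, hu1⟩ := hpow z hz
    exact ⟨u, hu1, (hpκ z u hu).symm⟩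
  · rw [he]
    rintro _ ⟨z, hz, rfl⟩
    obtain ⟨u, hu, hu1⟩ := hpow z hz
    rw [hpκ z u hu, hs' u hu1, he' z hz, hu]

end LocalGluing

/-- Points with different projections are separated in the torus. Different points over the same `a`
belong to different cycles of the monodromy, whose cells are disjoint. -/
theorem t2Space_squareSurface [Finite Sh] [TopologicalSpace Sh] [DiscreteTopology Sh] :
    T2Space (SquareSurface τ σ σ') := by
  refine ⟨fun x y hxy => ?_⟩
  by_cases hp : squareProj τ σ σ' x = squareProj τ σ σ' y
  · obtain ⟨a, ha, hax⟩ := exists_torusPt_eq (squareProj τ σ σ' x)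
    obtain ⟨D, -, -⟩ := exists_localGluing τ σ σ' ha
    obtain ⟨w, rfl⟩ := D.exists_eq_sector hax.symm
    obtain ⟨w', rfl⟩ := D.exists_eq_sector (hax.trans hp).symm
    refine ⟨D.cell w, D.cell w', D.isOpen_cell w, D.isOpen_cell w', D.sector_mem_cell w,
      D.sector_mem_cell w', disjoint_left.2 fun t h h' => hxy (D.sector_eq_of_sameCycle ?_)⟩
    induction t using Quot.ind with | mk t => ?_
    exact (D.mk_mem_cell.1 h).2.symm.trans (D.mk_mem_cell.1 h').2
  · obtain ⟨U, V, hU, hV, hx, hy, h⟩ := t2_separation hp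
    have hc := LocalGluing.continuous_squareProj (τ := τ) (σ := σ) (σ' := σ')
    exact ⟨_, _, hU.preimage hc, hV.preimage hc, hx, hy, h.preimage _⟩

theorem squareProj_surjective [Nonempty Sh] : Function.Surjective (squareProj τ σ σ') := by
  intro b
  obtain ⟨a, ha, rfl⟩ := exists_torusPt_eq b
  exact ⟨Quot.mk _ (Classical.arbitrary Sh, ⟨a.1, ha.1.1, ha.1.2.le⟩, ⟨a.2, ha.2.1, ha.2.2.le⟩), rfl⟩

theorem finite_fiber_squareProj [Finite Sh] (b : Torus) : (squareProj τ σ σ' ⁻¹' {b}).Finite := by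
  obtain ⟨a, ha, rfl⟩ := exists_torusPt_eq b
  obtain ⟨D, -, -⟩ := exists_localGluing τ σ σ' ha
  refine (finite_range fun w => D.sector w 0 0).subset fun y hy => ?_
  obtain ⟨w, rfl⟩ := D.exists_eq_sector hy
  exact ⟨w, rfl⟩

theorem hasLocalDegree_squareProj [Finite Sh] [TopologicalSpace Sh] [DiscreteTopology Sh]
    (hσ : ∀ s, σ s ≠ σ' s) (hτ : ∀ s, τ (σ s) ≠ σ (τ s)) (y : SquareSurface τ σ σ') :
    ∃ d, HasLocalDegree (squareProj τ σ σ') y d ∧ (squareProj τ σ σ' y ∉ slitEnds → d = 1) ∧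
      (squareProj τ σ σ' y ∈ slitEnds → 2 ≤ d) := by
  have := t2Space_squareSurface (τ := τ) (σ := σ) (σ' := σ')
  obtain ⟨a, ha, hay⟩ := exists_torusPt_eq (squareProj τ σ σ' y)
  obtain ⟨D, h1, h2⟩ := exists_localGluing τ σ σ' ha
  obtain ⟨w, rfl⟩ := D.exists_eq_sector hay.symm
  obtain ⟨d, hd, hd1, hd2⟩ := D.hasLocalDegree w
  rw [← hay]
  exact ⟨d, hd, fun h => hd1 (by rw [h1 h]; rfl), fun h => hd2 (h2 hσ hτ h w)⟩

end

/-- Agreement would be a fixed point of `a`: condition 1 of the construction is what forces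
branching over z and w. -/
theorem otherSheet_ne_slit (G : Gluing) (s : Fin G.k × Fin 2) : otherSheet G.k s ≠ G.slit s :=
  (G.a_ne _).symm

/-- Only the first square of a copy moves upwards to another copy, and `otherSheet` exchanges the
two squares. The two compositions therefore differ by `b` in the copy number: condition 2 forces
branching over 0. -/
theorem top_otherSheet_ne (G : Gluing) (s : Fin G.k × Fin 2) :
    G.top (otherSheet G.k s) ≠ otherSheet G.k (G.top s) := by
  obtain ⟨i, e⟩ := s
  intro h
  have h' := congrArg Prod.fst h
  have hb := G.b_ne i
  fin_cases e
  · exact hb (Eq.symm h')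
  · exact hb h'

end

/-! ### The cut double cover -/

theorem torusPt_eq_iff {x y x' y' : ℝ} :
    torusPt x y = torusPt x' y' ↔ ∃ m n : ℤ, x = x' + m ∧ y = y' + n := by
  simp only [torusPt, Prod.mk.injEq, coe_unitAddCircle_eq_iff, exists_and_left, exists_and_right]

theorem torusPt_half_eq_iff {x y x' y' : ℝ} :
    torusPt (x / 2) y = torusPt (x' / 2) y' ↔ ∃ m n : ℤ, x = x' + 2 * m ∧ y = y' + n := by
  rw [torusPt_eq_iff]
  refine exists₂_congr fun m n => and_congr_left' ?_
  constructor <;> intro h <;> linarith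

/-- The sides of a vertical segment. -/
def sideIoo : Side → Set ℝ
  -- The plus side is where the arc is approached with increasing coordinate, so it is the right or
  -- top side of a square.
  | .plus => Ioo (-(1 / 4)) 0
  | .minus => Ioo 0 (1 / 4)

theorem sideIoo_subset (s : Side) : sideIoo s ⊆ Ioo (-(1 / 4)) (1 / 4) := by
  cases s
  · exact Ioo_subset_Ioo_right (by norm_num)
  · exact Ioo_subset_Ioo_left (by norm_num)

theorem zero_notMem_sideIoo (s : Side) : (0 : ℝ) ∉ sideIoo s := by
  cases s <;> simp [sideIoo]

/-- The map `f` straightens a neighbourhood of the arc to a rectangle on which it is injective; as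
`f` is open and continuous, the two halves of the rectangle have the required properties. -/
theorem isSides_image {N : Type*} [TopologicalSpace N] {f : ℝ × ℝ → N} (hc : Continuous f)
    (ho : IsOpenMap f) {u v : ℝ} (huv : u < v)
    (hi : InjOn f (Ioo (-(1 / 4)) (1 / 4) ×ˢ Icc u v)) {c : unitInterval → N}
    (hcf : ∀ t, c t = f (0, u + t * (v - u))) :
    IsSides c fun s => f '' (sideIoo s ×ˢ Ioo u v) := by
  have hopen : ∀ s, IsOpen (sideIoo s) := fun s => by cases s <;> exact isOpen_Ioo
  have hsub : ∀ s, sideIoo s ×ˢ Ioo u v ⊆ Ioo (-(1 / 4)) (1 / 4) ×ˢ Icc u v := fun s =>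
    prod_mono (sideIoo_subset s) Ioo_subset_Icc_self
  have h0 : (0 : ℝ) ∈ Ioo (-(1 / 4) : ℝ) (1 / 4) := by norm_num
  have hv : 0 < v - u := sub_pos.2 huv
  have hint : c '' Ioo 0 1 = f '' ({0} ×ˢ Ioo u v) := by
    ext x
    constructor
    · rintro ⟨t, ht, rfl⟩
      have h1 : (0 : ℝ) < t := ht.1
      have h2 : (t : ℝ) < 1 := ht.2
      exact ⟨(0, u + t * (v - u)), ⟨mem_singleton _, by simp only; nlinarith, by simp only; nlinarith⟩,
        (hcf t).symm⟩
    · rintro ⟨⟨z, y⟩, ⟨rfl : z = 0, hy⟩, rfl⟩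
      have h1 : 0 < (y - u) / (v - u) := div_pos (sub_pos.2 hy.1) hv
      have h2 : (y - u) / (v - u) < 1 := (div_lt_one hv).2 (by linarith [hy.2])
      refine ⟨⟨_, h1.le, h2.le⟩, ⟨h1, h2⟩, ?_⟩
      rw [hcf, div_mul_cancel₀ _ hv.ne', add_sub_cancel]
  refine ⟨fun s => ho _ ((hopen s).prod isOpen_Ioo), ?_, fun s => ?_, ?_, fun s => ?_⟩
  · refine disjoint_left.2 ?_
    rintro _ ⟨x, hx, rfl⟩ ⟨x', hx', h⟩
    have := hi (hsub _ hx') (hsub _ hx) h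
    subst this
    exact hx.1.2.not_gt hx'.1.1
  · refine disjoint_left.2 ?_
    rintro _ ⟨x, hx, rfl⟩ ⟨t, h⟩
    rw [hcf] at h
    have := hi ⟨h0, by simp only; nlinarith [t.2.1], by simp only; nlinarith [t.2.2]⟩ (hsub _ hx) h
    rw [← this] at hx
    exact zero_notMem_sideIoo s hx.1
  · rw [hint, ← image_union, ← image_union, ← union_prod, ← union_prod]
    refine ho _ (IsOpen.prod ?_ isOpen_Ioo)
    have : sideIoo .plus ∪ sideIoo .minus ∪ {0} = Ioo (-(1 / 4)) (1 / 4) := by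
      ext x
      simp only [sideIoo, mem_union, mem_Ioo, mem_singleton_iff]
      constructor
      · rintro ((h | h) | rfl)
        · exact ⟨h.1, by linarith [h.2]⟩
        · exact ⟨by linarith [h.1], h.2⟩
        · norm_num
      · rintro ⟨h1, h2⟩
        rcases lt_trichotomy x 0 with h | h | h
        · exact Or.inl (Or.inl ⟨h1, h⟩)
        · exact Or.inr h
        · exact Or.inl (Or.inr ⟨h, h2⟩)
    rw [this]
    exact isOpen_Ioo
  · rw [hint]
    refine (image_mono ?_).trans (image_closure_subset_closure_image hc)
    rw [closure_prod_eq]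
    refine prod_mono (singleton_subset_iff.2 ?_) subset_closure
    cases s
    · rw [sideIoo, closure_Ioo (by norm_num)]
      norm_num
    · rw [sideIoo, closure_Ioo (by norm_num)]
      norm_num

/-- The shear of the torus which makes the slits vertical. -/
def shear : Torus ≃ₜ Torus where
  toFun b := (b.1 + 3 • b.2, b.2)
  invFun b := (b.1 - 3 • b.2, b.2)
  left_inv b := by simp
  right_inv b := by simp
  continuous_toFun := by fun_prop
  continuous_invFun := by fun_prop

theorem shear_torusPt (x y : ℝ) : shear (torusPt x y) = torusPt (x + 3 * y) y := by
  refine Prod.ext ?_ rfl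
  show (x : UnitAddCircle) + 3 • (y : UnitAddCircle) = ((x + 3 * y : ℝ) : UnitAddCircle)
  rw [← AddCircle.coe_nsmul, ← AddCircle.coe_add]
  simp

/-- The double cover of the torus, followed by the shear. -/
def doubling : Torus →+ Torus where
  toFun b := (2 • b.1 + 3 • b.2, b.2)
  map_zero' := by simp
  map_add' b b' := by
    refine Prod.ext ?_ rfl
    simp only [Prod.fst_add, Prod.snd_add, nsmul_add]
    abel

theorem doubling_torusPt (x y : ℝ) : doubling (torusPt (x / 2) y) = shear (torusPt x y) := by
  refine Prod.ext ?_ rfl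
  show 2 • ((x / 2 : ℝ) : UnitAddCircle) + 3 • (y : UnitAddCircle) = x + 3 • (y : UnitAddCircle)
  rw [← AddCircle.coe_nsmul]
  congr 2
  simp only [nsmul_eq_mul]
  push_cast
  ring

theorem continuous_doubling : Continuous doubling := by
  show Continuous fun b : Torus => ((2 • b.1 + 3 • b.2, b.2) : Torus)
  fun_prop

theorem exists_torusPt_half_eq (b : Torus) : ∃ x y : ℝ, torusPt (x / 2) y = b := by
  obtain ⟨a, -, rfl⟩ := exists_torusPt_eq b
  exact ⟨2 * a.1, a.2, by rw [mul_div_cancel_left₀ _ two_ne_zero]⟩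

/-- The parity of the integer by which the first coordinates differ distinguishes the two preimages.
-/
theorem doubling_fiber (x y : ℝ) :
    doubling ⁻¹' {shear (torusPt x y)} = {torusPt (x / 2) y, torusPt ((x + 1) / 2) y} := by
  ext b
  obtain ⟨x', y', rfl⟩ := exists_torusPt_half_eq b
  simp only [mem_preimage, doubling_torusPt, mem_singleton_iff, shear.injective.eq_iff,
    mem_insert_iff, torusPt_half_eq_iff]
  rw [torusPt_eq_iff]
  constructor
  · rintro ⟨m, n, hm, hn⟩
    rcases Int.even_or_odd' m with ⟨r, rfl | rfl⟩
    · exact Or.inl ⟨r, n, by rw [hm]; push_cast; ring, hn⟩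
    · exact Or.inr ⟨r, n, by rw [hm]; push_cast; ring, hn⟩
  · rintro (⟨m, n, hm, hn⟩ | ⟨m, n, hm, hn⟩)
    · exact ⟨2 * m, n, by rw [hm]; push_cast; ring, hn⟩
    · exact ⟨2 * m + 1, n, by rw [hm]; push_cast; ring, hn⟩

theorem torusPt_half_ne (x y : ℝ) : torusPt (x / 2) y ≠ torusPt ((x + 1) / 2) y := by
  rw [Ne, torusPt_half_eq_iff]
  rintro ⟨m, n, hm, -⟩
  have h : (2 * m + 1 : ℝ) = 0 := by linarith
  have h : 2 * m + 1 = 0 := by exact_mod_cast h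
  omega

theorem doubling_surjective : Function.Surjective doubling := by
  intro b
  obtain ⟨b, rfl⟩ := shear.surjective b
  obtain ⟨a, -, rfl⟩ := exists_torusPt_eq b
  exact ⟨_, doubling_torusPt _ _⟩

/-- A continuous surjective homomorphism of compact Hausdorff groups is a quotient map; its kernel
is finite, hence discrete. -/
theorem isCoveringMap_doubling : IsCoveringMap doubling := by
  have hq : IsQuotientMap doubling :=
    continuous_doubling.isClosedMap.isQuotientMap continuous_doubling doubling_surjective
  have hfin : (doubling.ker : Set Torus).Finite := by
    have h0 : shear (torusPt 0 0) = 0 := by simp [shear, torusPt]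
    have h : (doubling.ker : Set Torus) = doubling ⁻¹' {shear (torusPt 0 0)} := by
      rw [h0]
      rfl
    rw [h, doubling_fiber]
    simp
  exact (hq.isAddQuotientCoveringMap_of_isDiscrete_ker_addMonoidHom hfin.isDiscrete).isCoveringMap

/-- The position on the vertical slit. -/
def slitCoord (t : unitInterval) : ℝ := 2 / 5 + t * (3 / 5 - 2 / 5)

theorem continuous_slitCoord : Continuous slitCoord := by
  unfold slitCoord
  fun_prop

theorem slitCoord_mem (t : unitInterval) : slitCoord t ∈ Icc (2 / 5 : ℝ) (3 / 5) := by
  unfold slitCoord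
  constructor <;> linarith [t.2.1, t.2.2]

theorem slitCoord_injective : Function.Injective slitCoord := by
  intro t t' h
  unfold slitCoord at h
  exact Subtype.ext (by linarith)

theorem exists_slitCoord_eq {y : ℝ} (hy : y ∈ Icc (2 / 5 : ℝ) (3 / 5)) : ∃ t, slitCoord t = y :=
  ⟨⟨5 * y - 2, by linarith [hy.1], by linarith [hy.2]⟩, by
    simp only [slitCoord]
    ring⟩

theorem slitCoord_mem_Ioo {t : unitInterval} :
    slitCoord t ∈ Ioo (2 / 5 : ℝ) (3 / 5) ↔ t ∈ Ioo 0 1 := by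
  unfold slitCoord
  constructor
  · rintro ⟨h1, h2⟩
    exact ⟨show (0 : ℝ) < t by linarith, show (t : ℝ) < 1 by linarith⟩
  · rintro ⟨h1, h2⟩
    have h1 : (0 : ℝ) < t := h1
    have h2 : (t : ℝ) < 1 := h2
    constructor <;> linarith

theorem intCast_eq_zero {n : ℤ} (h1 : (n : ℝ) < 1) (h2 : (-1 : ℝ) < n) : n = 0 := by
  have h1 : n < 1 := by exact_mod_cast h1
  have h2 : -1 < n := by exact_mod_cast h2
  omega

/-- The double cover of the torus with its slits. -/
def slitCutData : CutData where
  S := Torus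
  p := doubling
  isCoveringMap := isCoveringMap_doubling
  two_fold b := by
    obtain ⟨b, rfl⟩ := shear.surjective b
    obtain ⟨a, -, rfl⟩ := exists_torusPt_eq b
    rw [doubling_fiber, ncard_pair (torusPt_half_ne _ _)]
  α :=
    { toFun := fun t => shear (torusPt 0 (slitCoord t))
      continuous_toFun := shear.continuous.comp (continuous_torusPt.comp
        (continuous_const.prodMk continuous_slitCoord))
      source' := by
        rw [shear_torusPt]
        -- The shear sends (0, 2/5) to (6/5, 2/5), which is z; likewise (0, 3/5) goes to (9/5, 3/5),
        -- which is w.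
        exact torusPt_eq_iff.2 ⟨1, 0, by norm_num [slitCoord], by norm_num [slitCoord]⟩
      target' := by
        rw [shear_torusPt]
        exact torusPt_eq_iff.2 ⟨1, 0, by norm_num [slitCoord], by norm_num [slitCoord]⟩ }
  α_injective t t' h := by
    obtain ⟨m, n, -, hn⟩ := torusPt_eq_iff.1 (shear.injective h)
    obtain ⟨h1, h2⟩ := slitCoord_mem t
    obtain ⟨h3, h4⟩ := slitCoord_mem t'
    have h0 := intCast_eq_zero (n := n) (by linarith) (by linarith)
    subst h0
    exact slitCoord_injective (by simpa using hn)
  β :=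
    { toFun := fun t => shear (torusPt t 0)
      continuous_toFun := shear.continuous.comp (continuous_torusPt.comp
        (continuous_subtype_val.prodMk continuous_const))
      source' := by
        rw [shear_torusPt]
        exact torusPt_eq_iff.2 ⟨0, 0, by norm_num, by norm_num⟩
      target' := by
        rw [shear_torusPt]
        exact torusPt_eq_iff.2 ⟨1, 0, by norm_num, by norm_num⟩ }
  β_simple s t h := by
    obtain ⟨m, n, hm, -⟩ := torusPt_eq_iff.1 (shear.injective h)
    by_cases h0 : m = 0
    · subst h0
      exact Or.inl (Subtype.ext (by simpa using hm))
    · have hs := s.2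
      have ht := t.2
      rcases Int.lt_or_gt_of_ne h0 with h0 | h0
      · have h0 : (m : ℝ) ≤ -1 := by exact_mod_cast Int.le_sub_one_of_lt h0
        exact Or.inr (Or.inl ⟨Subtype.ext (by simp only [Icc.coe_zero]; linarith [hs.1, ht.2]),
          Subtype.ext (by simp only [Icc.coe_one]; linarith [hs.1, ht.2])⟩)
      · have h0 : (1 : ℝ) ≤ m := by exact_mod_cast h0
        exact Or.inr (Or.inr ⟨Subtype.ext (by simp only [Icc.coe_one]; linarith [hs.2, ht.1]),
          Subtype.ext (by simp only [Icc.coe_zero]; linarith [hs.2, ht.1])⟩)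
  disjoint := by
    refine disjoint_left.2 ?_
    rintro _ ⟨t, rfl⟩ ⟨t', h⟩
    obtain ⟨m, n, -, hn⟩ := torusPt_eq_iff.1 (shear.injective h.symm)
    obtain ⟨h1, h2⟩ := slitCoord_mem t
    have h0 := intCast_eq_zero (n := n) (by linarith) (by linarith)
    subst h0
    norm_num at hn
    linarith
  -- The left walls of the two squares of the cover are at 0 and 1/2.
  αLift j := ⟨fun t => torusPt ((j : ℕ) / 2) (slitCoord t), continuous_torusPt.comp
    (continuous_const.prodMk continuous_slitCoord)⟩
  p_αLift j t := by
    refine (doubling_torusPt _ _).trans (congrArg shear (torusPt_eq_iff.2 ⟨(j : ℕ), 0, ?_, ?_⟩))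
    · simp
    · simp
  αLift_ne h := by
    have h := DFunLike.congr_fun h 0
    have h' := torusPt_half_ne 0 (slitCoord 0)
    rw [zero_add] at h'
    exact h' (by simpa using h)
  βLift := ⟨fun t => torusPt (t / 2) 0, continuous_torusPt.comp
    ((continuous_subtype_val.div_const 2).prodMk continuous_const)⟩
  p_βLift t := doubling_torusPt _ _
  βLift_ne h := by
    have h' := torusPt_half_ne 0 0
    rw [zero_add] at h'
    exact h' (by simpa using h)
  αSide s := (fun a : ℝ × ℝ => shear (torusPt a.1 a.2)) '' (sideIoo s ×ˢ Ioo (2 / 5) (3 / 5))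
  αSide_isSides := by
    refine isSides_image (shear.continuous.comp continuous_torusPt)
      (shear.isOpenMap.comp LocalGluing.isOpenMap_torusPt) (by norm_num) ?_ fun t => rfl
    rintro a ⟨⟨h1, h2⟩, h3, h4⟩ b ⟨⟨h5, h6⟩, h7, h8⟩ h
    obtain ⟨m, n, hm, hn⟩ := torusPt_eq_iff.1 (shear.injective h)
    have hm0 := intCast_eq_zero (n := m) (by linarith) (by linarith)
    have hn0 := intCast_eq_zero (n := n) (by linarith) (by linarith)
    subst hm0 hn0
    exact Prod.ext (by simpa using hm) (by simpa using hn)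
  -- The coordinates are exchanged because β is horizontal: the first one measures the distance to
  -- the arc.
  βSide s := (fun a : ℝ × ℝ => torusPt (a.2 / 2) a.1) '' (sideIoo s ×ˢ Ioo 0 1)
  βSide_isSides := by
    refine isSides_image (continuous_torusPt.comp (f := fun a : ℝ × ℝ => (a.2 / 2, a.1))
      (by fun_prop)) (LocalGluing.isOpenMap_torusPt.comp (f := fun a : ℝ × ℝ => (a.2 / 2, a.1)) ?_)
      one_pos ?_ fun t => ?_
    · simp only [div_eq_mul_inv]
      exact ((Homeomorph.prodComm ℝ ℝ).trans ((Homeomorph.mulRight₀ (2⁻¹ : ℝ)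
        (by norm_num)).prodCongr (Homeomorph.refl ℝ))).isOpenMap
    · rintro a ⟨⟨h1, h2⟩, h3, h4⟩ b ⟨⟨h5, h6⟩, h7, h8⟩ h
      obtain ⟨m, n, hm, hn⟩ := torusPt_half_eq_iff.1 h
      have hm0 := intCast_eq_zero (n := m) (by linarith) (by linarith)
      have hn0 := intCast_eq_zero (n := n) (by linarith) (by linarith)
      subst hm0 hn0
      exact Prod.ext (by simpa using hn) (by simpa using hm)
    · simp

section

/-! ### Points of the cut-open surface -/

namespace CutData

variable (C : CutData)

/-- The points of the cut-open surface which can be reached from the side `s`. -/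
def OnSide (s : Side) : C.Cut → Prop
  | .off _ _ => True
  | .alpha _ _ s' => s' = s
  | .beta _ s' => s' = s

theorem exists_onSide (x : C.S) (s : Side) : ∃ y, C.reglue y = x ∧ C.OnSide s y := by
  by_cases h : x ∈ C.openArcs
  · rcases h with h | ⟨t, ht, rfl⟩
    · obtain ⟨j, t, ht, rfl⟩ := mem_iUnion.1 h
      exact ⟨.alpha j ⟨t, ht⟩ s, rfl, rfl⟩
    · exact ⟨.beta ⟨t, ht⟩ s, rfl, rfl⟩
  · exact ⟨.off x h, rfl, trivial⟩

/-- The point of the cut-open surface over `x` on the side `s`. -/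
def lift (x : C.S) (s : Side) : C.Cut := (C.exists_onSide x s).choose

theorem reglue_lift (x : C.S) (s : Side) : C.reglue (C.lift x s) = x :=
  (C.exists_onSide x s).choose_spec.1

theorem onSide_lift (x : C.S) (s : Side) : C.OnSide s (C.lift x s) :=
  (C.exists_onSide x s).choose_spec.2

theorem αLift_ne_βLift (j : Fin 2) (t t' : unitInterval) : C.αLift j t ≠ C.βLift t' := by
  intro h
  have h' := congrArg C.p h
  rw [C.p_αLift, C.p_βLift] at h'
  exact disjoint_left.1 C.disjoint ⟨t, h'⟩ ⟨t', rfl⟩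

theorem αLift_injective {j j' : Fin 2} {t t' : unitInterval}
    (h : C.αLift j t = C.αLift j' t') : t = t' := by
  have h' := congrArg C.p h
  rw [C.p_αLift, C.p_αLift] at h'
  exact C.α_injective h'

theorem βLift_injective {t t' : unitInterval} (ht : t ∈ Ioo 0 1)
    (h : C.βLift t = C.βLift t') : t = t' := by
  have h' := congrArg C.p h
  rw [C.p_βLift, C.p_βLift] at h'
  rcases C.β_simple _ _ h' with h | h | h
  · exact h
  · exact (ht.1.ne' h.1).elim
  · exact (ht.2.ne h.1).elim

theorem αLift_mem_openArcs (j : Fin 2) (t : OpenUnit) : C.αLift j t ∈ C.openArcs :=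
  Or.inl (mem_iUnion.2 ⟨j, t, t.2, rfl⟩)

theorem βLift_mem_openArcs (t : OpenUnit) : C.βLift t ∈ C.openArcs := Or.inr ⟨t, t.2, rfl⟩

variable {C} in
-- A point of the cut surface is determined by its image and the side from which it is seen. This
-- needs the lifts of α to be disjoint, whereas `CutData` only records that they are different maps;
-- for the cover used here disjointness is checked directly.
theorem eq_of_onSide (hC : ∀ j j' t, C.αLift j t = C.αLift j' t → j = j') {s : Side}
    {y y' : C.Cut} (h : C.reglue y = C.reglue y') (hy : C.OnSide s y) (hy' : C.OnSide s y') :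
    y = y' := by
  cases y with
  | off x hx =>
    cases y' with
    | off x' hx' =>
      have h : x = x' := h
      subst h
      rfl
    | alpha j t s => exact (hx (mem_of_eq_of_mem h (C.αLift_mem_openArcs j t))).elim
    | beta t s => exact (hx (mem_of_eq_of_mem h (C.βLift_mem_openArcs t))).elim
  | alpha j t s₁ =>
    obtain rfl : s₁ = s := hy
    cases y' with
    | off x hx => exact (hx (mem_of_eq_of_mem h.symm (C.αLift_mem_openArcs j t))).elim
    | alpha j' t' s₂ =>
      obtain rfl : s₂ = s₁ := hy'
      have ht : t = t' := Subtype.ext (C.αLift_injective h)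
      subst ht
      have hj := hC _ _ _ h
      subst hj
      rfl
    | beta t' s₂ => exact (C.αLift_ne_βLift _ _ _ h).elim
  | beta t s₁ =>
    obtain rfl : s₁ = s := hy
    cases y' with
    | off x hx => exact (hx (mem_of_eq_of_mem h.symm (C.βLift_mem_openArcs t))).elim
    | alpha j' t' s₂ => exact (C.αLift_ne_βLift _ _ _ h.symm).elim
    | beta t' s₂ =>
      obtain rfl : s₂ = s₁ := hy'
      have ht : t = t' := Subtype.ext (C.βLift_injective t.2 h)
      subst ht
      rfl

variable {C} in
theorem eq_lift (hC : ∀ j j' t, C.αLift j t = C.αLift j' t → j = j') {s : Side} {y : C.Cut}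
    (hy : C.OnSide s y) : y = C.lift (C.reglue y) s :=
  eq_of_onSide hC (C.reglue_lift _ _).symm hy (C.onSide_lift _ _)

theorem onSide_αEdge (j : Fin 2) (s : Side) (t : unitInterval) : C.OnSide s (C.αEdge j s t) := by
  unfold αEdge
  split_ifs <;> trivial

theorem onSide_βEdge (s : Side) (t : unitInterval) : C.OnSide s (C.βEdge s t) := by
  unfold βEdge
  split_ifs <;> trivial

theorem onSide_of_notMem {s : Side} {y : C.Cut} (h : C.reglue y ∉ C.openArcs) : C.OnSide s y := by
  cases y with
  | off x hx => trivial
  | alpha j t s => exact (h (C.αLift_mem_openArcs j t)).elim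
  | beta t s => exact (h (C.βLift_mem_openArcs t)).elim

theorem side_eq_of_mem {s s' : Side} {y : C.Cut} (h : C.reglue y ∈ C.openArcs)
    (hs : C.OnSide s y) (hs' : C.OnSide s' y) : s = s' := by
  cases y with
  | off x hx => exact (hx h).elim
  | alpha j t s => exact Eq.trans (Eq.symm hs) hs'
  | beta t s => exact Eq.trans (Eq.symm hs) hs'

theorem lift_mem_αNear {x : C.S} {s s' : Side} :
    C.lift x s ∈ C.αNear s' ↔
      C.p x ∈ C.αSide s' ∨ x ∈ (⋃ j, C.αLift j '' Ioo 0 1) ∧ s = s' := by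
  have h1 := C.reglue_lift x s
  have h2 := C.onSide_lift x s
  rw [← h1, h1]
  generalize C.lift x s = y at h1 h2
  subst h1
  refine or_congr_right ⟨?_, ?_⟩
  · rintro ⟨j, t, rfl⟩
    exact ⟨mem_iUnion.2 ⟨j, t, t.2, rfl⟩, Eq.symm h2⟩
  · rintro ⟨h, rfl⟩
    cases y with
    | off x hx => exact (hx (Or.inl h)).elim
    | alpha j t s' => exact ⟨j, t, congrArg _ h2⟩
    | beta t s' =>
      obtain ⟨j, t', -, h⟩ := mem_iUnion.1 h
      exact (C.αLift_ne_βLift _ _ _ h).elim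

theorem lift_mem_βNear {x : C.S} {s s' : Side} :
    C.lift x s ∈ C.βNear s' ↔ x ∈ C.βSide s' ∨ x ∈ C.βLift '' Ioo 0 1 ∧ s = s' := by
  have h1 := C.reglue_lift x s
  have h2 := C.onSide_lift x s
  rw [← h1, h1]
  generalize C.lift x s = y at h1 h2
  subst h1
  refine or_congr_right ⟨?_, ?_⟩
  · rintro ⟨t, rfl⟩
    exact ⟨⟨t, t.2, rfl⟩, Eq.symm h2⟩
  · rintro ⟨h, rfl⟩
    cases y with
    | off x hx => exact (hx (Or.inr h)).elim
    | alpha j t s' =>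
      obtain ⟨t', -, h⟩ := h
      exact (C.αLift_ne_βLift _ _ _ h.symm).elim
    | beta t s' => exact ⟨t, congrArg _ h2⟩

theorem continuous_reglue : Continuous C.reglue := by
  rw [continuous_iff_le_induced]
  exact inf_le_left

theorem isOpen_αNear (s : Side) : IsOpen (C.αNear s) :=
  (inf_le_right : (inferInstance : TopologicalSpace C.Cut) ≤ _) _
    (TopologicalSpace.isOpen_generateFrom_of_mem (Or.inl ⟨s, rfl⟩))

theorem isOpen_βNear (s : Side) : IsOpen (C.βNear s) :=
  (inf_le_right : (inferInstance : TopologicalSpace C.Cut) ≤ _) _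
    (TopologicalSpace.isOpen_generateFrom_of_mem (Or.inr ⟨s, rfl⟩))

theorem continuous_cut_iff {Y : Type*} [TopologicalSpace Y] {f : Y → C.Cut} :
    Continuous f ↔ Continuous (C.reglue ∘ f) ∧ (∀ s, IsOpen (f ⁻¹' C.αNear s)) ∧
      ∀ s, IsOpen (f ⁻¹' C.βNear s) := by
  refine Iff.trans (continuous_inf_rng (t₂ := TopologicalSpace.induced C.reglue inferInstance)
    (t₃ := TopologicalSpace.generateFrom (range C.αNear ∪ range C.βNear)))
    (and_congr continuous_induced_rng ?_)
  rw [continuous_generateFrom_iff]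
  constructor
  · exact fun h => ⟨fun s => h _ (Or.inl ⟨s, rfl⟩), fun s => h _ (Or.inr ⟨s, rfl⟩)⟩
  · rintro h _ (⟨s, rfl⟩ | ⟨s, rfl⟩)
    · exact h.1 s
    · exact h.2 s

variable {C} in
theorem _root_.TorusGluing.IsSides.disjoint_of_ne {N : Type*} [TopologicalSpace N]
    {c : unitInterval → N} {U : Side → Set N} (h : IsSides c U) {s s' : Side} (hs : s ≠ s') :
    Disjoint (U s) (U s') := by
  cases s <;> cases s'
  · exact (hs rfl).elim
  · exact h.disjoint
  · exact h.disjoint.symm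
  · exact (hs rfl).elim

theorem disjoint_αNear {s s' : Side} (hs : s ≠ s') : Disjoint (C.αNear s) (C.αNear s') := by
  have h := C.αSide_isSides
  refine disjoint_left.2 ?_
  rintro y (h1 | ⟨j, t, rfl⟩) (h2 | ⟨j', t', h'⟩)
  · exact disjoint_left.1 (h.disjoint_of_ne hs) h1 h2
  · subst h'
    exact disjoint_left.1 (h.disjoint_arc s) h1 ⟨_, (C.p_αLift j' t').symm⟩
  · exact disjoint_left.1 (h.disjoint_arc s') h2 ⟨_, (C.p_αLift j t).symm⟩
  · cases h'
    exact hs rfl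

theorem disjoint_βNear {s s' : Side} (hs : s ≠ s') : Disjoint (C.βNear s) (C.βNear s') := by
  have h := C.βSide_isSides
  refine disjoint_left.2 ?_
  rintro y (h1 | ⟨t, rfl⟩) (h2 | ⟨t', h'⟩)
  · exact disjoint_left.1 (h.disjoint_of_ne hs) h1 h2
  · subst h'
    exact disjoint_left.1 (h.disjoint_arc s) h1 ⟨_, rfl⟩
  · exact disjoint_left.1 (h.disjoint_arc s') h2 ⟨_, rfl⟩
  · cases h'
    exact hs rfl

variable {C} in
-- Two points over the same point of an arc are on opposite sides and are separated by the one-sided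
-- neighbourhoods. The Hausdorff property makes the map from the compact squares a quotient map.
theorem t2Space_cut [T2Space C.S] (hC : ∀ j j' t, C.αLift j t = C.αLift j' t → j = j') :
    T2Space C.Cut := by
  refine ⟨fun y y' hne => ?_⟩
  by_cases h : C.reglue y = C.reglue y'
  · by_cases ho : C.reglue y ∈ C.openArcs
    · have key : ∀ s s', C.OnSide s y → C.OnSide s' y' → s ≠ s' := fun s s' hs hs' he =>
        hne (eq_of_onSide hC h hs (he ▸ hs'))
      cases y with
      | off x hx => exact (hx ho).elim
      | alpha j t s =>
        cases y' with
        | off x hx => exact (hx (mem_of_eq_of_mem h.symm ho)).elim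
        | alpha j' t' s' => exact ⟨_, _, C.isOpen_αNear s, C.isOpen_αNear s', Or.inr ⟨_, _, rfl⟩,
            Or.inr ⟨_, _, rfl⟩, C.disjoint_αNear (key s s' rfl rfl)⟩
        | beta t' s' => exact (C.αLift_ne_βLift _ _ _ h).elim
      | beta t s =>
        cases y' with
        | off x hx => exact (hx (mem_of_eq_of_mem h.symm ho)).elim
        | alpha j' t' s' => exact (C.αLift_ne_βLift _ _ _ h.symm).elim
        | beta t' s' => exact ⟨_, _, C.isOpen_βNear s, C.isOpen_βNear s', Or.inr ⟨_, rfl⟩,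
            Or.inr ⟨_, rfl⟩, C.disjoint_βNear (key s s' rfl rfl)⟩
    · exact (hne (eq_of_onSide hC (s := .plus) h (C.onSide_of_notMem ho)
        (C.onSide_of_notMem (h ▸ ho)))).elim
  · obtain ⟨U, V, hU, hV, hx, hy, hd⟩ := t2_separation h
    exact ⟨_, _, hU.preimage C.continuous_reglue, hV.preimage C.continuous_reglue, hx, hy,
      hd.preimage _⟩

end CutData

end

/-! ### The squares of the cut double cover -/

theorem fin_two_cases (e : Fin 2) : e = 0 ∨ e = 1 := by
  fin_cases e <;> simp

instance : T2Space slitCutData.S := inferInstanceAs (T2Space Torus)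

theorem αLift_slitCutData_eq {j j' : Fin 2} {t : unitInterval}
    (h : slitCutData.αLift j t = slitCutData.αLift j' t) : j = j' := by
  have h' := torusPt_half_ne 0 (slitCoord t)
  rw [zero_add] at h'
  rcases fin_two_cases j with rfl | rfl <;> rcases fin_two_cases j' with rfl | rfl
  · rfl
  · exact (h' (by simpa using (show torusPt _ _ = torusPt _ _ from h))).elim
  · exact (h' (by simpa using (show torusPt _ _ = torusPt _ _ from h.symm))).elim
  · rfl

/-- The point of the double cover with coordinates `x` and `y` in the square number `e`. -/
def squarePt (e : Fin 2) (p : unitInterval × unitInterval) : slitCutData.S :=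
  torusPt ((p.1 + (e : ℕ)) / 2) p.2

theorem squarePt_eq_iff {e e' : Fin 2} {p p' : unitInterval × unitInterval} :
    squarePt e p = squarePt e' p' ↔
      ∃ m n : ℤ, (p.1 : ℝ) + (e : ℕ) = p'.1 + (e' : ℕ) + 2 * m ∧ (p.2 : ℝ) = p'.2 + n :=
  torusPt_half_eq_iff

theorem p_squarePt (e : Fin 2) (p : unitInterval × unitInterval) :
    slitCutData.p (squarePt e p) = shear (torusPt p.1 p.2) := by
  refine (doubling_torusPt _ _).trans (congrArg shear (torusPt_eq_iff.2 ⟨(e : ℕ), 0, ?_, ?_⟩)) <;>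
    simp

theorem continuous_squarePt (e : Fin 2) : Continuous (squarePt e) :=
  continuous_torusPt.comp (f := fun p : unitInterval × unitInterval =>
    (((p.1 : ℝ) + (e : ℕ)) / 2, (p.2 : ℝ))) (by fun_prop)

theorem squarePt_right (e : Fin 2) (y : unitInterval) :
    squarePt e (1, y) = squarePt (e + 1) (0, y) := by
  rw [squarePt_eq_iff]
  rcases fin_two_cases e with rfl | rfl
  · exact ⟨0, 0, by simp, by simp⟩
  · exact ⟨1, 0, by norm_num, by simp⟩

theorem squarePt_left_slit (e : Fin 2) (t y : unitInterval) (hy : (y : ℝ) = slitCoord t) :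
    squarePt e (0, y) = slitCutData.αLift e t := by
  show torusPt _ _ = torusPt _ _
  simp [hy]

theorem squarePt_bottom (x : unitInterval) : squarePt 0 (x, 0) = slitCutData.βLift x := by
  show torusPt _ _ = torusPt _ _
  simp

theorem squarePt_top (e : Fin 2) (x : unitInterval) :
    squarePt e (x, 1) = squarePt e (x, 0) :=
  squarePt_eq_iff.2 ⟨0, 1, by simp, by simp⟩

theorem eq_zero_or_one_of_intCast {x : unitInterval} {m : ℤ} (h : (x : ℝ) = m) :
    x = 0 ∨ x = 1 := by
  have h0 := x.2.1
  have h1 := x.2.2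
  rw [h] at h0 h1
  have h0 : 0 ≤ m := by exact_mod_cast h0
  have h1 : m ≤ 1 := by exact_mod_cast h1
  rcases (by omega : m = 0 ∨ m = 1) with rfl | rfl
  · exact Or.inl (Subtype.ext (by simpa using h))
  · exact Or.inr (Subtype.ext (by simpa using h))

theorem squarePt_mem_alphaArcs {e : Fin 2} {x y : unitInterval} :
    squarePt e (x, y) ∈ (⋃ j, slitCutData.αLift j '' Ioo 0 1) ↔
      (x = 0 ∨ x = 1) ∧ (y : ℝ) ∈ Ioo (2 / 5 : ℝ) (3 / 5) := by
  constructor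
  · intro h
    obtain ⟨j, t, ht, h⟩ := mem_iUnion.1 h
    obtain ⟨m, n, hm, hn⟩ := torusPt_half_eq_iff.1 h
    have ht' := slitCoord_mem_Ioo.2 ht
    have hn0 := intCast_eq_zero (n := n) (by linarith [ht'.2, y.2.1]) (by linarith [ht'.1, y.2.2])
    subst hn0
    have hy : slitCoord t = y := by simpa using hn
    refine ⟨eq_zero_or_one_of_intCast (m := (j : ℕ) - (e : ℕ) - 2 * m) ?_, hy ▸ ht'⟩
    push_cast
    simp only at hm
    linarith
  · rintro ⟨hx, hy⟩
    obtain ⟨t, ht⟩ := exists_slitCoord_eq (Ioo_subset_Icc_self hy)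
    have ht' := slitCoord_mem_Ioo.1 (ht.symm ▸ hy)
    rcases hx with rfl | rfl
    · exact mem_iUnion.2 ⟨e, t, ht', (squarePt_left_slit e t y ht.symm).symm⟩
    · rw [squarePt_right]
      exact mem_iUnion.2 ⟨e + 1, t, ht', (squarePt_left_slit (e + 1) t y ht.symm).symm⟩

/-- The condition to lie in the square number zero, seen from the lower side of it. -/
theorem add_eq_add_two_mul_iff {e : Fin 2} {x t : ℝ} {m : ℤ} (hx : x ∈ Icc (0 : ℝ) 1)
    (ht : t ∈ Ioo (0 : ℝ) 1) (h : t = x + (e : ℕ) + 2 * m) : e = 0 ∧ t = x := by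
  rcases fin_two_cases e with rfl | rfl
  · norm_num at h
    have hm : m = 0 := intCast_eq_zero (by linarith [hx.1, ht.2]) (by linarith [hx.2, ht.1])
    subst hm
    exact ⟨rfl, by simpa using h⟩
  · norm_num at h
    have h1 : (m : ℝ) < 0 := by linarith [hx.1, ht.2]
    have h2 : (-1 : ℝ) < m := by linarith [hx.2, ht.1]
    have h1 : m < 0 := by exact_mod_cast h1
    have h2 : -1 < m := by exact_mod_cast h2
    omega

theorem squarePt_mem_betaArc {e : Fin 2} {x y : unitInterval} :
    squarePt e (x, y) ∈ slitCutData.βLift '' Ioo 0 1 ↔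
      e = 0 ∧ x ∈ Ioo 0 1 ∧ (y = 0 ∨ y = 1) := by
  constructor
  · rintro ⟨t, ht, h⟩
    obtain ⟨m, n, hm, hn⟩ := torusPt_half_eq_iff.1 h
    obtain ⟨rfl, htx⟩ := add_eq_add_two_mul_iff x.2 (t := t) ⟨ht.1, ht.2⟩ hm
    obtain rfl : t = x := Subtype.ext htx
    refine ⟨rfl, ht, eq_zero_or_one_of_intCast (m := -n) ?_⟩
    push_cast
    simp only at hn
    linarith
  · rintro ⟨rfl, hx, rfl | rfl⟩
    · exact ⟨x, hx, (squarePt_bottom x).symm⟩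
    · rw [squarePt_top]
      exact ⟨x, hx, (squarePt_bottom x).symm⟩

/-- The side from which the arcs on the boundary of the square are seen. -/
def squareSide (p : unitInterval × unitInterval) : Side :=
  open Classical in
  -- The value matters only on the open arcs, where the right and top walls are plus sides and the
  -- left and bottom walls are minus sides; elsewhere it is an arbitrary default.
  if (p.2 : ℝ) ∈ Ioo (2 / 5 : ℝ) (3 / 5) then (if 1 / 2 < (p.1 : ℝ) then .plus else .minus)
  else if 1 / 2 < (p.2 : ℝ) then .plus else .minus

/-- The points of the unit interval which are close to its end seen from the given side. -/
def endNear : Side → Set unitInterval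
  | .plus => {x | 3 / 4 < (x : ℝ)}
  | .minus => {x | (x : ℝ) < 1 / 4}

theorem isOpen_endNear (s : Side) : IsOpen (endNear s) := by
  cases s
  · exact isOpen_lt continuous_const continuous_subtype_val
  · exact isOpen_lt continuous_subtype_val continuous_const

theorem squareSide_of_mem {x y : unitInterval} (hy : (y : ℝ) ∈ Ioo (2 / 5 : ℝ) (3 / 5)) :
    squareSide (x, y) = if 1 / 2 < (x : ℝ) then .plus else .minus := if_pos hy

theorem squareSide_of_notMem {x y : unitInterval} (hy : (y : ℝ) ∉ Ioo (2 / 5 : ℝ) (3 / 5)) :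
    squareSide (x, y) = if 1 / 2 < (y : ℝ) then .plus else .minus := if_neg hy

theorem squareSide_zero_right (x : unitInterval) : squareSide (x, 0) = .minus := by
  rw [squareSide_of_notMem (by norm_num), if_neg (by norm_num)]

theorem squareSide_one_right (x : unitInterval) : squareSide (x, 1) = .plus := by
  rw [squareSide_of_notMem (by norm_num), if_pos (by norm_num)]

theorem squareSide_zero_left {y : unitInterval} (hy : (y : ℝ) ∈ Ioo (2 / 5 : ℝ) (3 / 5)) :
    squareSide (0, y) = .minus := by
  rw [squareSide_of_mem hy, if_neg (by norm_num)]

theorem squareSide_one_left {y : unitInterval} (hy : (y : ℝ) ∈ Ioo (2 / 5 : ℝ) (3 / 5)) :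
    squareSide (1, y) = .plus := by
  rw [squareSide_of_mem hy, if_pos (by norm_num)]

theorem zero_or_one_mem_endNear {x : unitInterval} {s : Side} (h : x = 0 ∨ x = 1) :
    x ∈ endNear s ↔ (x = 0 ∧ s = .minus ∨ x = 1 ∧ s = .plus) := by
  rcases h with rfl | rfl <;> cases s <;> norm_num [endNear] <;> exact fun h => nomatch h

/-- Off the open arcs there is only one point of the cut surface over x, so the side is immaterial.
-/
theorem _root_.TorusGluing.CutData.lift_congr {C : CutData}
    (hC : ∀ j j' t, C.αLift j t = C.αLift j' t → j = j') {x : C.S} {s s' : Side}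
    (h : x ∈ C.openArcs → s = s') : C.lift x s = C.lift x s' := by
  by_cases hx : x ∈ C.openArcs
  · rw [h hx]
  · have := CutData.eq_lift hC (s := s') (C.onSide_of_notMem (y := C.lift x s)
      (by rwa [C.reglue_lift]))
    rwa [C.reglue_lift] at this

theorem squarePt_mem_openArcs {e : Fin 2} {x y : unitInterval} :
    squarePt e (x, y) ∈ slitCutData.openArcs ↔
      (x = 0 ∨ x = 1) ∧ (y : ℝ) ∈ Ioo (2 / 5 : ℝ) (3 / 5) ∨
        e = 0 ∧ x ∈ Ioo 0 1 ∧ (y = 0 ∨ y = 1) :=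
  or_congr squarePt_mem_alphaArcs squarePt_mem_betaArc

/-- The map from the square number `e` to the cut double cover. -/
def cutSquare (e : Fin 2) (p : unitInterval × unitInterval) : slitCutData.Cut :=
  slitCutData.lift (squarePt e p) (squareSide p)

/-- The right wall of a square is the left wall of the other one, seen from the plus side; hence the
shift of the sheet number. -/
theorem cutSquare_eq_αEdge_plus (e : Fin 2) (t y : unitInterval) (hy : (y : ℝ) = slitCoord t) :
    cutSquare e (1, y) = slitCutData.αEdge (e + 1) .plus t := by
  rw [CutData.eq_lift (fun _ _ _ => αLift_slitCutData_eq) (slitCutData.onSide_αEdge _ _ _),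
    slitCutData.reglue_αEdge, cutSquare, squarePt_right, squarePt_left_slit _ t y hy]
  refine CutData.lift_congr (fun _ _ _ => αLift_slitCutData_eq) fun h => ?_
  rw [← squarePt_left_slit _ t y hy, squarePt_mem_openArcs] at h
  rcases h with h | h
  · exact squareSide_one_left h.2
  · exact (lt_irrefl _ h.2.1.1).elim

theorem cutSquare_eq_αEdge_minus (e : Fin 2) (t y : unitInterval) (hy : (y : ℝ) = slitCoord t) :
    cutSquare e (0, y) = slitCutData.αEdge e .minus t := by
  rw [CutData.eq_lift (fun _ _ _ => αLift_slitCutData_eq) (slitCutData.onSide_αEdge _ _ _),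
    slitCutData.reglue_αEdge, cutSquare, squarePt_left_slit _ t y hy]
  refine CutData.lift_congr (fun _ _ _ => αLift_slitCutData_eq) fun h => ?_
  rw [← squarePt_left_slit _ t y hy, squarePt_mem_openArcs] at h
  rcases h with h | h
  · exact squareSide_zero_left h.2
  · exact (lt_irrefl _ h.2.1.1).elim

theorem cutSquare_eq_βEdge_plus (x : unitInterval) :
    cutSquare 0 (x, 1) = slitCutData.βEdge .plus x := by
  rw [CutData.eq_lift (fun _ _ _ => αLift_slitCutData_eq) (slitCutData.onSide_βEdge _ _),
    slitCutData.reglue_βEdge, cutSquare, squareSide_one_right, squarePt_top, squarePt_bottom]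

theorem cutSquare_eq_βEdge_minus (x : unitInterval) :
    cutSquare 0 (x, 0) = slitCutData.βEdge .minus x := by
  rw [CutData.eq_lift (fun _ _ _ => αLift_slitCutData_eq) (slitCutData.onSide_βEdge _ _),
    slitCutData.reglue_βEdge, cutSquare, squareSide_zero_right, squarePt_bottom]

/-- The coordinates close to a vertical or horizontal line, from one of its sides. -/
theorem mem_endNear_iff {x : unitInterval} {s : Side} :
    x ∈ endNear s ↔ (∃ n : ℤ, ∃ x' ∈ sideIoo s, x' = (x : ℝ) + n) ∨
      (x = 0 ∧ s = .minus ∨ x = 1 ∧ s = .plus) := by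
  by_cases h : x = 0 ∨ x = 1
  · rw [zero_or_one_mem_endNear h]
    refine ⟨Or.inr, ?_⟩
    rintro (⟨n, x', hx', h'⟩ | h')
    · exfalso
      have hx'' := sideIoo_subset s hx'
      rcases h with rfl | rfl
      · have : n = 0 := intCast_eq_zero (by norm_num at h'; linarith [hx''.2])
          (by norm_num at h'; linarith [hx''.1])
        subst this
        norm_num at h'
        exact zero_notMem_sideIoo s (h' ▸ hx')
      · rw [Icc.coe_one] at h'
        have : n + 1 = 0 := intCast_eq_zero (by push_cast; linarith [hx''.2])
          (by push_cast; linarith [hx''.1])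
        obtain rfl : n = -1 := by omega
        norm_num at h'
        exact zero_notMem_sideIoo s (h' ▸ hx')
    · exact h'
  · have h0 : (0 : ℝ) < x := lt_of_le_of_ne x.2.1 fun h' => h (Or.inl (Subtype.ext h'.symm))
    have h1 : (x : ℝ) < 1 := lt_of_le_of_ne x.2.2 fun h' => h (Or.inr (Subtype.ext h'))
    constructor
    · intro hx
      left
      cases s
      · have hx : 3 / 4 < (x : ℝ) := hx
        exact ⟨-1, (x : ℝ) + (-1 : ℤ), ⟨by push_cast; linarith, by push_cast; linarith⟩, rfl⟩
      · have hx : (x : ℝ) < 1 / 4 := hx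
        exact ⟨0, (x : ℝ) + (0 : ℤ), ⟨by push_cast; linarith, by push_cast; linarith⟩, rfl⟩
    · rintro (⟨n, x', hx', h'⟩ | h')
      · cases s
        · have h2 : (n : ℝ) < 0 := by linarith [hx'.2]
          have h3 : (-2 : ℝ) < n := by linarith [hx'.1]
          have h2 : n < 0 := by exact_mod_cast h2
          have h3 : -2 < n := by exact_mod_cast h3
          obtain rfl : n = -1 := by omega
          push_cast at h'
          show 3 / 4 < (x : ℝ)
          linarith [hx'.1]
        · have h2 : (n : ℝ) < 1 := by linarith [hx'.2]
          have h3 : (-1 : ℝ) < n := by linarith [hx'.1]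
          have := intCast_eq_zero h2 h3
          subst this
          push_cast at h'
          show (x : ℝ) < 1 / 4
          linarith [hx'.2]
      · exact (h (h'.imp And.left And.left)).elim

/-- Inside a closed square, a side of the slit together with its copy of the open arc is a rectangle
along one wall, which is open in the square. This gives the continuity of `cutSquare`. -/
theorem cutSquare_preimage_αNear (e : Fin 2) (s : Side) :
    cutSquare e ⁻¹' slitCutData.αNear s =
      {p | p.1 ∈ endNear s ∧ (p.2 : ℝ) ∈ Ioo (2 / 5 : ℝ) (3 / 5)} := by
  ext ⟨x, y⟩
  rw [mem_preimage, cutSquare, CutData.lift_mem_αNear, squarePt_mem_alphaArcs]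
  constructor
  · rintro (⟨a, ⟨ha1, ha2⟩, h⟩ | ⟨⟨hx, hy⟩, hs⟩)
    · rw [p_squarePt] at h
      obtain ⟨m, n, hm, hn⟩ := torusPt_eq_iff.1 (shear.injective h)
      have hn0 := intCast_eq_zero (n := n) (by linarith [ha2.2, y.2.1])
        (by linarith [ha2.1, y.2.2])
      subst hn0
      have hn : a.2 = y := by simpa using hn
      exact ⟨mem_endNear_iff.2 (Or.inl ⟨m, a.1, ha1, hm⟩), hn ▸ ha2⟩
    · refine ⟨(zero_or_one_mem_endNear hx).2 ?_, hy⟩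
      subst hs
      rcases hx with rfl | rfl
      · exact Or.inl ⟨rfl, squareSide_zero_left hy⟩
      · exact Or.inr ⟨rfl, squareSide_one_left hy⟩
  · rintro ⟨hx, hy⟩
    rcases mem_endNear_iff.1 hx with ⟨m, x', hx', h⟩ | h | h
    · refine Or.inl ⟨(x', y), ⟨hx', hy⟩, ?_⟩
      rw [p_squarePt]
      exact congrArg shear (torusPt_eq_iff.2 ⟨m, 0, h, by simp⟩)
    · obtain ⟨rfl, rfl⟩ := h
      exact Or.inr ⟨⟨Or.inl rfl, hy⟩, squareSide_zero_left hy⟩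
    · obtain ⟨rfl, rfl⟩ := h
      exact Or.inr ⟨⟨Or.inr rfl, hy⟩, squareSide_one_left hy⟩

theorem cutSquare_preimage_βNear (e : Fin 2) (s : Side) :
    cutSquare e ⁻¹' slitCutData.βNear s =
      {p | (e = 0 ∧ p.1 ∈ Ioo 0 1) ∧ p.2 ∈ endNear s} := by
  ext ⟨x, y⟩
  rw [mem_preimage, cutSquare, CutData.lift_mem_βNear, squarePt_mem_betaArc]
  constructor
  · rintro (⟨a, ⟨ha1, ha2⟩, h⟩ | ⟨⟨he, hx, hy⟩, hs⟩)
    · obtain ⟨m, n, hm, hn⟩ := torusPt_half_eq_iff.1 h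
      obtain ⟨rfl, hax⟩ := add_eq_add_two_mul_iff x.2 ha2 hm
      rw [hax] at ha2
      exact ⟨⟨rfl, ha2⟩, mem_endNear_iff.2 (Or.inl ⟨n, a.1, ha1, hn⟩)⟩
    · refine ⟨⟨he, hx⟩, (zero_or_one_mem_endNear hy).2 ?_⟩
      subst hs
      rcases hy with rfl | rfl
      · exact Or.inl ⟨rfl, squareSide_zero_right x⟩
      · exact Or.inr ⟨rfl, squareSide_one_right x⟩
  · rintro ⟨⟨rfl, hx⟩, hy⟩
    rcases mem_endNear_iff.1 hy with ⟨n, y', hy', h⟩ | h | h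
    · exact Or.inl ⟨(y', x), ⟨hy', hx⟩, torusPt_half_eq_iff.2 ⟨0, n, by simp, h⟩⟩
    · obtain ⟨rfl, rfl⟩ := h
      exact Or.inr ⟨⟨rfl, hx, Or.inl rfl⟩, squareSide_zero_right x⟩
    · obtain ⟨rfl, rfl⟩ := h
      exact Or.inr ⟨⟨rfl, hx, Or.inr rfl⟩, squareSide_one_right x⟩

theorem continuous_cutSquare (e : Fin 2) : Continuous (cutSquare e) := by
  refine slitCutData.continuous_cut_iff.2 ⟨?_, fun s => ?_, fun s => ?_⟩
  · exact (continuous_squarePt e).congr fun p => (slitCutData.reglue_lift _ _).symm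
  · rw [cutSquare_preimage_αNear]
    exact ((isOpen_endNear s).preimage continuous_fst).inter
      (isOpen_Ioo.preimage (continuous_subtype_val.comp continuous_snd))
  · rw [cutSquare_preimage_βNear]
    exact (isOpen_const.and (isOpen_Ioo.preimage continuous_fst)).inter
      ((isOpen_endNear s).preimage continuous_snd)

theorem exists_cutSquare_eq (y : slitCutData.Cut) : ∃ e p, cutSquare e p = y := by
  cases y with
  | off x hx =>
    obtain ⟨a, ⟨⟨h1, h2⟩, h3, h4⟩, hax⟩ := exists_torusPt_eq x
    obtain ⟨e, p, hp⟩ : ∃ e p, squarePt e p = x := by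
      rcases le_total a.1 (1 / 2) with h | h
      · refine ⟨0, (⟨2 * a.1, by linarith, by linarith⟩, ⟨a.2, h3, h4.le⟩), ?_⟩
        rw [← hax, squarePt]
        simp
        rfl
      · refine ⟨1, (⟨2 * a.1 - 1, by linarith, by linarith⟩, ⟨a.2, h3, h4.le⟩), ?_⟩
        rw [← hax, squarePt]
        simp
        rfl
    subst hp
    exact ⟨e, p, (CutData.eq_lift (fun _ _ _ => αLift_slitCutData_eq)
      (slitCutData.onSide_of_notMem (y := .off _ hx) hx)).symm⟩
  | alpha j t s =>
    have h : CutData.Cut.alpha j t s = slitCutData.αEdge j s t := by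
      rw [CutData.αEdge, dif_pos t.2]
    rw [h]
    have hy := slitCoord_mem t
    have hy' : slitCoord t ∈ Icc (0 : ℝ) 1 := ⟨by linarith [hy.1], by linarith [hy.2]⟩
    cases s
    · refine ⟨j + 1, (1, ⟨_, hy'⟩), ?_⟩
      rw [cutSquare_eq_αEdge_plus _ t _ rfl]
      congr 1
      rcases fin_two_cases j with rfl | rfl <;> rfl
    · exact ⟨j, (0, ⟨_, hy'⟩), cutSquare_eq_αEdge_minus _ t _ rfl⟩
  | beta t s =>
    have h : CutData.Cut.beta t s = slitCutData.βEdge s t := by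
      rw [CutData.βEdge, dif_pos t.2]
    rw [h]
    cases s
    · exact ⟨0, (t, 1), cutSquare_eq_βEdge_plus t⟩
    · exact ⟨0, (t, 0), cutSquare_eq_βEdge_minus t⟩

section

/-! ### The glued surface is tiled by squares -/

theorem cutSquare_eq_iff {e e' : Fin 2} {p p' : unitInterval × unitInterval}
    (h : cutSquare e p = cutSquare e' p') :
    squarePt e p = squarePt e' p' ∧
      (squarePt e p ∈ slitCutData.openArcs → squareSide p = squareSide p') := by
  have hp := congrArg slitCutData.reglue h
  have h1 : slitCutData.reglue (cutSquare e p) = squarePt e p := slitCutData.reglue_lift _ _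
  have h2 : slitCutData.reglue (cutSquare e' p') = squarePt e' p' := slitCutData.reglue_lift _ _
  refine ⟨by rw [← h1, hp, h2], fun ho => ?_⟩
  have h3 : slitCutData.OnSide (squareSide p) (cutSquare e p) := slitCutData.onSide_lift _ _
  have h4 : slitCutData.OnSide (squareSide p') (cutSquare e' p') := slitCutData.onSide_lift _ _
  rw [← h] at h4
  exact slitCutData.side_eq_of_mem (h1.symm ▸ ho) h3 h4

section

variable (G : Gluing)

/-- The point of the square-tiled surface. -/
abbrev Gluing.pt (t : (Fin G.k × Fin 2) × unitInterval × unitInterval) : G.Squares :=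
  Quot.mk (SquareRel G.top (otherSheet G.k) G.slit) t

theorem Gluing.pt_right (i : Fin G.k) (e : Fin 2) {y : unitInterval}
    (hy : (y : ℝ) ≤ 2 / 5 ∨ 3 / 5 ≤ (y : ℝ)) : G.pt ((i, e), 1, y) = G.pt ((i, e + 1), 0, y) :=
  Quot.sound (.right (i, e) y hy)

theorem Gluing.pt_top_one (i : Fin G.k) (x : unitInterval) :
    G.pt ((i, 1), x, 1) = G.pt ((i, 1), x, 0) :=
  Quot.sound (.top (i, 1) x)

/-- In the second square this is the gluing itself. At the corners of the first square, top and
bottom are joined by a detour through the second square of the same copy. -/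
theorem Gluing.pt_top (i : Fin G.k) {e : Fin 2} {x : unitInterval}
    (h : ¬ (e = 0 ∧ x ∈ Ioo 0 1)) : G.pt ((i, e), x, 1) = G.pt ((i, e), x, 0) := by
  rcases fin_two_cases e with rfl | rfl
  · have r1 : ((1 : unitInterval) : ℝ) ≤ 2 / 5 ∨ 3 / 5 ≤ ((1 : unitInterval) : ℝ) := by norm_num
    have r0 : ((0 : unitInterval) : ℝ) ≤ 2 / 5 ∨ 3 / 5 ≤ ((0 : unitInterval) : ℝ) := by norm_num
    have hx : x = 0 ∨ x = 1 := by
      by_contra! hx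
      exact h ⟨rfl, lt_of_le_of_ne unitInterval.nonneg' hx.1.symm,
        lt_of_le_of_ne unitInterval.le_one' hx.2⟩
    rcases hx with rfl | rfl
    · exact (G.pt_right i 1 r1).symm.trans ((G.pt_top_one i 1).trans (G.pt_right i 1 r0))
    · exact (G.pt_right i 0 r1).trans ((G.pt_top_one i 0).trans (G.pt_right i 0 r0).symm)
  · exact G.pt_top_one i x

/-- Two points of a copy at the same height and over the same point of the cover are equal or face
each other across a vertical wall. On the slit their sides would differ, so the wall is not cut
there and they are glued. -/
theorem Gluing.pt_eq_of_snd_eq (i : Fin G.k) {e e' : Fin 2} {x x' y : unitInterval}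
    (h : squarePt e (x, y) = squarePt e' (x', y))
    (hs : squarePt e (x, y) ∈ slitCutData.openArcs → squareSide (x, y) = squareSide (x', y)) :
    G.pt ((i, e), x, y) = G.pt ((i, e'), x', y) := by
  obtain ⟨m, -, hm, -⟩ := squarePt_eq_iff.1 h
  have key : ∀ (f : Fin 2), squarePt f (1, y) ∈ slitCutData.openArcs →
      squareSide (1, y) ≠ squareSide (0, y) := by
    intro f ho
    rcases squarePt_mem_openArcs.1 ho with ⟨-, hy⟩ | ⟨-, hx, -⟩
    · rw [squareSide_one_left hy, squareSide_zero_left hy]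
      exact fun h => nomatch h
    · exact (lt_irrefl _ hx.2).elim
  have out : ∀ f : Fin 2, squarePt f (1, y) ∉ slitCutData.openArcs →
      (y : ℝ) ≤ 2 / 5 ∨ 3 / 5 ≤ (y : ℝ) := by
    intro f ho
    by_contra! hy
    exact ho (squarePt_mem_openArcs.2 (Or.inl ⟨Or.inr rfl, hy.1, hy.2⟩))
  have x0 := x.2.1
  have x1 := x.2.2
  have x0' := x'.2.1
  have x1' := x'.2.2
  have hee : ((e : ℕ) : ℝ) = (e' : ℕ) ∧ e = e' ∨
      (((e : ℕ) : ℝ) = 0 ∧ ((e' : ℕ) : ℝ) = 1 ∨ ((e : ℕ) : ℝ) = 1 ∧ ((e' : ℕ) : ℝ) = 0) ∧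
        e' = e + 1 ∧ e = e' + 1 := by
    rcases fin_two_cases e with rfl | rfl <;> rcases fin_two_cases e' with rfl | rfl <;> simp
  simp only at hm
  rcases hee with ⟨he, rfl⟩ | ⟨he, he', he''⟩
  · have : m = 0 := intCast_eq_zero (by linarith) (by linarith)
    subst this
    have : x = x' := Subtype.ext (by simpa using hm)
    rw [this]
  · have hx : x = 1 ∧ x' = 0 ∨ x = 0 ∧ x' = 1 := by
      have hodd : ∃ n : ℤ, (x : ℝ) - x' = 2 * n + 1 := by
        rcases he with ⟨h1, h2⟩ | ⟨h1, h2⟩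
        · exact ⟨m, by rw [h1, h2] at hm; linarith⟩
        · exact ⟨m - 1, by rw [h1, h2] at hm; push_cast; linarith⟩
      obtain ⟨n, hn⟩ := hodd
      have n1 : (n : ℝ) < 1 := by linarith
      have n2 : (-2 : ℝ) < n := by linarith
      have n1 : n < 1 := by exact_mod_cast n1
      have n2 : -2 < n := by exact_mod_cast n2
      rcases (by omega : n = 0 ∨ n = -1) with rfl | rfl
      · push_cast at hn
        exact Or.inl ⟨Subtype.ext (by rw [Icc.coe_one]; linarith),
          Subtype.ext (by rw [Icc.coe_zero]; linarith)⟩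
      · push_cast at hn
        exact Or.inr ⟨Subtype.ext (by rw [Icc.coe_zero]; linarith),
          Subtype.ext (by rw [Icc.coe_one]; linarith)⟩
    rcases hx with ⟨rfl, rfl⟩ | ⟨rfl, rfl⟩
    · rw [he']
      exact G.pt_right i e (out e fun ho => key e ho (hs ho))
    · rw [he'']
      refine (G.pt_right i e' (out e' fun ho => key e' ho (hs ?_).symm)).symm
      rwa [h]

/-- The map from the squares to the copies of the cut double cover. -/
def Gluing.tile (t : (Fin G.k × Fin 2) × unitInterval × unitInterval) :
    Fin G.k × slitCutData.Cut := (t.1.1, cutSquare t.1.2 t.2)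

/-- The tiling of a copy identifies points only across uncut walls, and these are exactly the
gluings of the squares within a copy. A height difference of one is first removed by `pt_top`. -/
theorem Gluing.pt_eq_of_tile_eq {t t' : (Fin G.k × Fin 2) × unitInterval × unitInterval}
    (h : G.tile t = G.tile t') : G.pt t = G.pt t' := by
  obtain ⟨⟨i, e⟩, x, y⟩ := t
  obtain ⟨⟨i', e'⟩, x', y'⟩ := t'
  obtain rfl : i = i' := congrArg Prod.fst h
  obtain ⟨h1, h2⟩ := cutSquare_eq_iff (congrArg Prod.snd h)
  simp only at h1 h2
  obtain ⟨m, n, hm, hn⟩ := squarePt_eq_iff.1 h1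
  have wrap : ∀ {f f' : Fin 2} {u u' : unitInterval}, squarePt f (u, 1) = squarePt f' (u', 0) →
      (squarePt f (u, 1) ∈ slitCutData.openArcs → squareSide (u, 1) = squareSide (u', 0)) →
      G.pt ((i, f), u, 1) = G.pt ((i, f'), u', 0) := by
    intro f f' u u' h1 h2
    have ho : squarePt f (u, 1) ∉ slitCutData.openArcs := fun ho => by
      have := h2 ho
      rw [squareSide_one_right, squareSide_zero_right] at this
      cases this
    rw [G.pt_top i fun hf => ho (squarePt_mem_openArcs.2 (Or.inr ⟨hf.1, hf.2, Or.inr rfl⟩))]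
    rw [squarePt_top] at h1 ho
    exact G.pt_eq_of_snd_eq i h1 fun h => (ho h).elim
  have y0 := y.2.1
  have y1 := y.2.2
  have y0' := y'.2.1
  have y1' := y'.2.2
  simp only at hn
  by_cases h0 : n = 0
  · subst h0
    obtain rfl : y = y' := Subtype.ext (by simpa using hn)
    exact G.pt_eq_of_snd_eq i h1 h2
  · rcases Int.lt_or_gt_of_ne h0 with h0 | h0
    · have h0 : (n : ℝ) ≤ -1 := by exact_mod_cast Int.le_sub_one_of_lt h0
      obtain rfl : y = 0 := Subtype.ext (by rw [Icc.coe_zero]; linarith)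
      obtain rfl : y' = 1 := Subtype.ext (by rw [Icc.coe_one]; linarith)
      exact (wrap h1.symm fun h => (h2 (h1 ▸ h)).symm).symm
    · have h0 : (1 : ℝ) ≤ n := by exact_mod_cast h0
      obtain rfl : y = 1 := Subtype.ext (by rw [Icc.coe_one]; linarith)
      obtain rfl : y' = 0 := Subtype.ext (by rw [Icc.coe_zero]; linarith)
      exact wrap h1 h2

theorem Gluing.isQuotientMap_tile : IsQuotientMap G.tile := by
  have := CutData.t2Space_cut (C := slitCutData) fun _ _ _ => αLift_slitCutData_eq
  have hc : Continuous G.tile := by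
    refine continuous_prod_of_discrete_left.2 fun s => ?_
    show Continuous fun p => (s.1, cutSquare s.2 p)
    exact continuous_const.prodMk (continuous_cutSquare s.2)
  refine hc.isClosedMap.isQuotientMap hc fun y => ?_
  obtain ⟨e, p, hp⟩ := exists_cutSquare_eq y.2
  exact ⟨((y.1, e), p), Prod.ext rfl hp⟩

theorem otherSheet_otherSheet {k : ℕ} (x : Fin k × Fin 2) : otherSheet k (otherSheet k x) = x := by
  obtain ⟨i, e⟩ := x
  rw [otherSheet_apply, otherSheet_apply]
  refine Prod.ext rfl (?_ : e + 1 + 1 = e)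
  rcases fin_two_cases e with rfl | rfl <;> rfl

/-- Gluings across uncut walls are already equalities in the cut surface, and those across cut walls
are the prescribed gluings of exposed arcs; so the two relations match along `tile`. -/
theorem exists_squares_homeomorph_gluedSurface :
    ∃ h : G.Squares ≃ₜ GluedSurface slitCutData G,
      ∀ y, gluedProj slitCutData G (h y) =
        shear (squareProj G.top (otherSheet G.k) G.slit y) := by
  obtain ⟨h, hh⟩ : ∃ h : G.Squares ≃ₜ GluedSurface slitCutData G,
      ∀ t, h (G.pt t) = Quot.mk _ (G.tile t) := by
    refine nonempty_quot_homeomorph G.isQuotientMap_tile ?_ (fun _ _ h => G.pt_eq_of_tile_eq h) ?_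
    · rintro _ _ (⟨s, y, hy⟩ | ⟨s, y, hy, hy'⟩ | ⟨s, x⟩)
      · have : G.tile (s, 1, y) = G.tile (otherSheet G.k s, 0, y) := by
          refine Prod.ext rfl ?_
          show slitCutData.lift _ _ = slitCutData.lift (squarePt (s.2 + 1) _) _
          rw [squarePt_right]
          refine CutData.lift_congr (fun _ _ _ => αLift_slitCutData_eq) fun h => ?_
          exfalso
          rcases squarePt_mem_openArcs.1 h with ⟨-, h1, h2⟩ | ⟨-, h, -⟩
          · rcases hy with hy | hy <;> linarith
          · exact lt_irrefl _ h.1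
        rw [this]
      · obtain ⟨t, ht⟩ := exists_slitCoord_eq ⟨hy, hy'⟩
        have h1 : G.tile (s, 1, y) = (s.1, slitCutData.αEdge (s.2 + 1) .plus t) :=
          Prod.ext rfl (cutSquare_eq_αEdge_plus _ _ _ ht.symm)
        have h2 : G.tile (G.slit s, 0, y) =
            ((G.slit s).1, slitCutData.αEdge (G.slit s).2 .minus t) :=
          Prod.ext rfl (cutSquare_eq_αEdge_minus _ _ _ ht.symm)
        rw [h1, h2]
        -- The right wall of the square `s` is the plus side of the lift in the other sheet, so `a`
        -- is applied after `otherSheet`; this is `slit`.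
        exact Quot.sound (GlueRel.alpha (otherSheet G.k s) t)
      · obtain ⟨i, e⟩ := s
        rcases fin_two_cases e with rfl | rfl
        · have h1 : G.tile ((i, 0), x, 1) = (i, slitCutData.βEdge .plus x) :=
            Prod.ext rfl (cutSquare_eq_βEdge_plus x)
          have h2 : G.tile (G.top (i, 0), x, 0) = (G.b i, slitCutData.βEdge .minus x) :=
            Prod.ext rfl (cutSquare_eq_βEdge_minus x)
          rw [h1, h2]
          exact Quot.sound (GlueRel.beta i x)
        · have : G.tile ((i, 1), x, 1) = G.tile (G.top (i, 1), x, 0) := by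
            refine Prod.ext rfl ?_
            show slitCutData.lift _ _ = slitCutData.lift (squarePt 1 _) _
            rw [squarePt_top]
            refine CutData.lift_congr (fun _ _ _ => αLift_slitCutData_eq) fun h => ?_
            exfalso
            rcases squarePt_mem_openArcs.1 h with ⟨-, h1, h2⟩ | ⟨h, -⟩
            · norm_num at h1
            · exact one_ne_zero (show (1 : Fin 2) = 0 from h)
          rw [this]
    · rintro _ _ (⟨x, t⟩ | ⟨i, x⟩)
      · have hy := slitCoord_mem t
        have hy' : slitCoord t ∈ Icc (0 : ℝ) 1 := ⟨by linarith [hy.1], by linarith [hy.2]⟩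
        have hx : (otherSheet G.k x).2 + 1 = x.2 := congrArg Prod.snd (otherSheet_otherSheet x)
        have ha : G.slit (otherSheet G.k x) = G.a x := congrArg G.a (otherSheet_otherSheet x)
        refine ⟨(otherSheet G.k x, 1, ⟨_, hy'⟩), (G.a x, 0, ⟨_, hy'⟩), ?_,
          Prod.ext rfl (cutSquare_eq_αEdge_minus _ _ _ rfl), ?_⟩
        · rw [← hx]
          exact Prod.ext rfl (cutSquare_eq_αEdge_plus _ _ _ rfl)
        · rw [← ha]
          exact Quot.sound (.slit _ _ hy.1 hy.2)
      · exact ⟨((i, 0), x, 1), ((G.b i, 0), x, 0), Prod.ext rfl (cutSquare_eq_βEdge_plus x),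
          Prod.ext rfl (cutSquare_eq_βEdge_minus x), Quot.sound (.top (i, 0) x)⟩
  refine ⟨h, fun y => ?_⟩
  induction y using Quot.ind with | mk t => ?_
  rw [hh]
  show slitCutData.p (slitCutData.reglue (slitCutData.lift _ _)) = _
  rw [slitCutData.reglue_lift, p_squarePt]
  rfl

end

theorem shear_mem_marked_iff {b : Torus} : shear b ∈ marked ↔ b ∈ slitEnds := by
  have h0 : shear (torusPt 0 0) = 0 := by simp [shear, torusPt]
  have hz : shear (torusPt 0 (2 / 5)) = zPt := slitCutData.α.source ▸ (by
    show shear _ = shear _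
    simp [slitCoord])
  have hw : shear (torusPt 0 (3 / 5)) = wPt := slitCutData.α.target ▸ (by
    show shear _ = shear _
    simp [slitCoord])
  rw [marked, slitEnds, ← h0, ← hz, ← hw]
  simp only [mem_insert_iff, mem_singleton_iff, shear.injective.eq_iff]

/-- The glued surface is a branched cover of the torus. -/
theorem isBranchedCover_gluedProj_comp {G : Gluing} (hk : 0 < G.k) {M : Type*}
    [TopologicalSpace M] (f : M ≃ₜ G.Squares) (h : G.Squares ≃ₜ GluedSurface slitCutData G)
    (hh : ∀ y, gluedProj slitCutData G (h y) =
      shear (squareProj G.top (otherSheet G.k) G.slit y)) :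
    IsBranchedCover (gluedProj slitCutData G ∘ f.trans h) marked ∧
      ∀ y, (gluedProj slitCutData G ∘ f.trans h) y ∈ marked →
        ∃ d, 2 ≤ d ∧ HasLocalDegree (gluedProj slitCutData G ∘ f.trans h) y d := by
  have heq : gluedProj slitCutData G ∘ f.trans h =
      shear ∘ squareProj G.top (otherSheet G.k) G.slit ∘ f := funext fun y => hh (f y)
  rw [heq]
  have : NeZero G.k := ⟨hk.ne'⟩
  have := t2Space_squareSurface (τ := G.top) (σ := otherSheet G.k) (σ' := G.slit)
  have : T2Space M := f.symm.t2Space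
  have : CompactSpace M := f.symm.compactSpace
  have hd : ∀ y, ∃ d, HasLocalDegree (shear ∘ squareProj G.top (otherSheet G.k) G.slit ∘ f) y d ∧
      (shear (squareProj G.top (otherSheet G.k) G.slit (f y)) ∉ marked → d = 1) ∧
      (shear (squareProj G.top (otherSheet G.k) G.slit (f y)) ∈ marked → 2 ≤ d) := by
    intro y
    rw [shear_mem_marked_iff]
    obtain ⟨d, h1, h2⟩ := hasLocalDegree_squareProj (otherSheet_ne_slit G) (top_otherSheet_ne G)
      (f y)
    exact ⟨d, h1.comp_homeomorph f shear, h2⟩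
  refine ⟨isBranchedCover_of_hasLocalDegree (by simp [marked])
    (shear.continuous.comp (LocalGluing.continuous_squareProj.comp f.continuous))
    (shear.surjective.comp (squareProj_surjective.comp f.surjective)) (fun x => ?_)
    (fun y hy => ?_) fun y hy => ?_, fun y hy => ?_⟩
  · obtain ⟨x, rfl⟩ := shear.surjective x
    refine ((finite_fiber_squareProj x).preimage f.injective.injOn).subset fun y hy => ?_
    exact shear.injective hy
  · obtain ⟨d, h1, h2, -⟩ := hd y
    exact h2 hy ▸ h1
  · obtain ⟨d, h1, -⟩ := hd y
    exact ⟨d, h1⟩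
  · obtain ⟨d, h1, -, h2⟩ := hd y
    exact ⟨d, h2 hy, h1⟩

end

end TorusGluing

end

theorem mainTheorem11 (g : ℕ) (hg : 4 ≤ g) (M : Type*) [TopologicalSpace M]
    (hM : TorusGluing.IsClosedOrientableSurface g M) :
    ∃ (C : TorusGluing.CutData) (G : TorusGluing.Gluing)
      (h : M ≃ₜ TorusGluing.GluedSurface C G),
      TorusGluing.IsBranchedCover (TorusGluing.gluedProj C G ∘ h) TorusGluing.marked ∧
      ∀ y : M, (TorusGluing.gluedProj C G ∘ h) y ∈ TorusGluing.marked →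
        ∃ d : ℕ, 2 ≤ d ∧
          TorusGluing.HasLocalDegree (TorusGluing.gluedProj C G ∘ h) y d := by
  obtain ⟨e⟩ := hM
  obtain ⟨G, ⟨f⟩⟩ := TorusGluing.exists_squares_homeomorph hg
  obtain ⟨h, hh⟩ := TorusGluing.exists_squares_homeomorph_gluedSurface G
  -- A surface without copies would be empty, but the standard surface has a point.
  have hk : 0 < G.k := by
    obtain ⟨⟨s, -⟩, -⟩ := Quot.exists_rep (f.symm (Quot.mk _ ⟨0, by simp⟩))
    exact s.1.pos
  exact ⟨TorusGluing.slitCutData, G, (e.trans f.symm).trans h,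
    TorusGluing.isBranchedCover_gluedProj_comp hk (e.trans f.symm) h hh⟩
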